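/- A digraph here is a finite, nonempty directed graph without loops and without two distinct arcs having the same tail and the same head (two arcs with the same pair of ends but opposite directions are allowed). An orientation of $K_4$ is a digraph obtained from the complete graph $K_4$ by replacing each edge $uv$ by exactly one of the arcs $(u,v)$, $(v,u)$. A subdivision of a digraph $H$ is a digraph obtained from $H$ by replacing each arc $(u,v)$ by a directed path (of length at least one) from $u$ to $v$, where the inner vertices of these paths are new and the paths are pairwise internally disjoint. A digraph contains a subdivision of $H$ if it has a subdigraph isomorphic to a subdivision of $H$. **Corollary.** Let $G$ be a digraph in which every vertex has out-degree at least $3$ and in-degree at least $3$. Then $G$ contains a subdivision of every orientation of $K_4$. -/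

import Mathlib

namespace Digraph

/-- The digraph has no loops. (Parallel arcs do not exist for `Digraph`; opposite arcs are
allowed.) Thus a loopless `Digraph` is a simple digraph. -/
def Loopless {V : Type*} (G : Digraph V) : Prop :=
  ∀ v, ¬ G.Adj v v

/-- The number of out-neighbours of `v`. -/
noncomputable def outDegree {V : Type*} (G : Digraph V) (v : V) : ℕ :=
  {w | G.Adj v w}.ncard

/-- The number of in-neighbours of `v`. -/
noncomputable def inDegree {V : Type*} (G : Digraph V) (v : V) : ℕ :=
  {w | G.Adj w v}.ncard

/-- `D` is an orientation of the graph `K`: each edge of `K` is replaced by exactly one of its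
two possible arcs, and there are no other arcs. -/
def IsOrientation {V : Type*} (D : Digraph V) (K : SimpleGraph V) : Prop :=
  (∀ u v, K.Adj u v ↔ D.Adj u v ∨ D.Adj v u) ∧ ∀ u v, ¬ (D.Adj u v ∧ D.Adj v u)

/-- The list `p` is the vertex sequence of a directed path of `G` from `a` to `b`. -/
structure IsDirPath {V : Type*} (G : Digraph V) (p : List V) (a b : V) : Prop where
  chain : p.IsChain G.Adj
  nodup : p.Nodup
  head_eq : p.head? = some a
  last_eq : p.getLast? = some b

/-- `S` is a subdivision of the simple digraph `H`: it arises from `H` (whose vertices are placed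
by `f`) by replacing each arc `(u, v)` with a directed path `P u v` from `f u` to `f v`, where the
paths have pairwise disjoint interiors that avoid the vertices of `H`, and `S` has
no further vertices and arcs. -/
def IsSubdivision {W U : Type*} (S : Digraph W) (H : Digraph U) : Prop :=
  ∃ (f : U → W) (P : U → U → List W),
    Function.Injective f ∧
    (∀ u v, H.Adj u v → S.IsDirPath (P u v) (f u) (f v)) ∧
    -- inner vertices of the paths are new vertices
    (∀ u v, H.Adj u v → ∀ x ∈ P u v, x ≠ f u → x ≠ f v → x ∉ Set.range f) ∧
    -- an inner vertex of one path is on no other path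
    (∀ u v u' v', H.Adj u v → H.Adj u' v' → (u, v) ≠ (u', v') →
      ∀ x ∈ P u v, x ≠ f u → x ≠ f v → x ∉ P u' v') ∧
    -- there are no other vertices
    (∀ x, x ∈ Set.range f ∨ ∃ u v, H.Adj u v ∧ x ∈ P u v) ∧
    -- the arcs are exactly those of the paths
    (∀ x y, S.Adj x y ↔ ∃ u v, H.Adj u v ∧ [x, y] <:+: P u v)

/-- `G` contains a subdivision of `H`: some subdigraph of `G`, with vertex set `s` and arcs
given by `S`, is a subdivision of `H`. -/
def ContainsSubdivision {V U : Type*} (G : Digraph V) (H : Digraph U) : Prop :=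
  ∃ (s : Set V) (S : Digraph s),
    (∀ x y : s, S.Adj x y → G.Adj x y) ∧ S.IsSubdivision H

end Digraph

/-!
Up to isomorphism there are four tournaments on four vertices: the strong one, the one with a source
dominating a directed triangle, its reverse, and the transitive one. The third follows from the
second by reversing all arcs.

For the strong tournament and the one with a source, take a directed path that ends in a set `R`
which can only be left towards the first two vertices of the path, and extend it until all
out-neighbours of its last vertex `v m` lie on it. Let `v i`, `v j`, `v k` be such out-neighbours,
the first, an intermediate and the last one. Either a walk avoiding `v j` and `v m` leads from `v k`
back to the path between `v i` and `v j`, which closes up both subdivisions, or the vertices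
reachable from `v k` without `v j` and `v m` form a smaller set of the same kind.

For the transitive tournament with source `a` and sink `d`, it suffices that a set `T` filled by
paths from `a` to `d` contains two vertices joined by a walk through `T` in addition to an arc from
`a` to `d`; by Menger's theorem, a counterexample has a cutvertex for every arc. In a
counterexample with as few vertices of out-degree at least three as possible, contracting
the outside of a set with two exits yields no smaller one. This forces the cutvertices to be nested
until every set of the quotient by the maximal sets with a single entry has too few exits, which
contradicts a count of the arcs.
-/

namespace TournamentSubdivision

section Walks

variable {V : Type*} {D D' : Digraph V} {S T A B : Set V} {u v w a b z : V}

/-- `Reach D T u v`: there is a walk of `D` from `u` to `v` all of whose vertices, except possibly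
the initial vertex `u`, lie in `T`. Exempting only `u` makes these walks composable. -/
def Reach (D : Digraph V) (T : Set V) : V → V → Prop :=
  Relation.ReflTransGen fun a b => D.Adj a b ∧ b ∈ T

/-- The digraph with all arcs reversed. -/
def reversed (D : Digraph V) : Digraph V := ⟨fun a b => D.Adj b a⟩

theorem isDirPath_cons {p : List V} (hab : D.Adj a b) (h : D.IsDirPath p b v) (ha : a ∉ p) :
    D.IsDirPath (a :: p) a v := by
  obtain ⟨t, rfl⟩ := List.head?_eq_some_iff.mp h.head_eq
  exact ⟨h.chain.cons_cons hab, List.nodup_cons.mpr ⟨ha, h.nodup⟩, rfl, by simpa using h.last_eq⟩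

theorem isDirPath_reverse {p : List V} (h : D.IsDirPath p a b) :
    (reversed D).IsDirPath p.reverse b a where
  chain := List.isChain_reverse.mpr h.chain
  nodup := List.nodup_reverse.mpr h.nodup
  head_eq := List.head?_reverse.trans h.last_eq
  last_eq := List.getLast?_reverse.trans h.head_eq

namespace Reach

theorem refl : Reach D T u u := Relation.ReflTransGen.refl

theorem trans (h : Reach D T u v) (h' : Reach D T v w) : Reach D T u w :=
  Relation.ReflTransGen.trans h h'

theorem tail (h : Reach D T u v) (h' : D.Adj v w) (hw : w ∈ T) : Reach D T u w :=
  Relation.ReflTransGen.tail h ⟨h', hw⟩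

theorem head (h' : D.Adj u v) (hv : v ∈ T) (h : Reach D T v w) : Reach D T u w :=
  Relation.ReflTransGen.head ⟨h', hv⟩ h

theorem of_adj (h : D.Adj u v) (hv : v ∈ T) : Reach D T u v :=
  refl.tail h hv

theorem of_adj_insert (h : D.Adj u v) : Reach D (insert v T) u v :=
  of_adj h (Set.mem_insert _ _)

theorem simulate (h : Reach D T u v) (hu : u ∈ A)
    (hA : ∀ a ∈ A, ∀ b ∈ T, D.Adj a b → b ∈ A ∧ Reach D' S a b) : v ∈ A ∧ Reach D' S u v := by
  induction h with
  | refl => exact ⟨hu, refl⟩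
  | tail _ hstep ih =>
    obtain ⟨hmem, hreach⟩ := hA _ ih.1 _ hstep.2 hstep.1
    exact ⟨hmem, ih.2.trans hreach⟩

theorem transfer (h : Reach D T u v) (hu : u ∈ A)
    (hA : ∀ a ∈ A, ∀ b ∈ T, D.Adj a b → b ∈ A ∧ b ∈ S ∧ D'.Adj a b) :
    v ∈ A ∧ Reach D' S u v :=
  h.simulate hu fun a ha b hb hab =>
    have ⟨hbA, hbS, hab'⟩ := hA a ha b hb hab
    ⟨hbA, of_adj hab' hbS⟩

theorem mem_of_closed (h : Reach D T u v) (hu : u ∈ A)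
    (hA : ∀ a ∈ A, ∀ b ∈ T, D.Adj a b → b ∈ A) : v ∈ A :=
  (h.transfer hu fun a ha b hb hab => ⟨hA a ha b hb hab, hb, hab⟩).1

theorem mono_adj (h : Reach D S u v) (hST : S ⊆ T) (hD : D ≤ D') : Reach D' T u v :=
  (h.transfer (Set.mem_univ u) fun _ _ _ hb hab => ⟨Set.mem_univ _, hST hb, hD hab⟩).2

theorem mono (h : Reach D S u v) (hST : S ⊆ T) : Reach D T u v :=
  h.mono_adj hST le_rfl

theorem eq_or_mem (h : Reach D T u v) : u = v ∨ v ∈ T := by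
  cases h with
  | refl => exact Or.inl rfl
  | tail _ hstep => exact Or.inr hstep.2

theorem mem_of_mem (h : Reach D T u v) (hu : u ∈ T) : v ∈ T :=
  h.eq_or_mem.elim (fun huv => huv ▸ hu) id

theorem eq_or_head (h : Reach D T u v) : u = v ∨ ∃ w ∈ T, D.Adj u w ∧ Reach D T w v := by
  rcases Relation.ReflTransGen.cases_head h with huv | ⟨w, hstep, hwv⟩
  · exact Or.inl huv
  · exact Or.inr ⟨w, hstep.2, hstep.1, hwv⟩

theorem inter_reachable (h : Reach D T a b) : Reach D (T ∩ {w | Reach D T a w}) a b := by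
  induction h with
  | refl => exact refl
  | tail hav hstep ih => exact ih.tail hstep.1 ⟨hstep.2, hav.tail hstep⟩

theorem inter_coreachable (h : Reach D T a b) : Reach D (T ∩ {w | Reach D T w b}) a b := by
  induction h using Relation.ReflTransGen.head_induction_on with
  | refl => exact refl
  | head hstep hcb ih => exact head hstep.1 ⟨hstep.2, hcb⟩ ih

theorem of_between (h : Reach D T u v)
    (hS : ∀ w ∈ T, Reach D T u w → Reach D T w v → w ∈ S) : Reach D S u v :=
  h.inter_reachable.inter_coreachable.mono fun w hw =>
    hS w hw.1.1 hw.1.2 (hw.2.mono Set.inter_subset_left)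

theorem exists_first_entry (h : Reach D S u v) (hu : u ∉ B) (hv : v ∈ B) :
    ∃ w, Reach D (S \ B) u w ∧ ∃ c ∈ B, c ∈ S ∧ D.Adj w c := by
  induction h using Relation.ReflTransGen.head_induction_on with
  | refl => exact absurd hv hu
  | @head u c hstep _ ih =>
    by_cases hc : c ∈ B
    · exact ⟨u, refl, c, hc, hstep.2, hstep.1⟩
    · obtain ⟨w, hcw, hw⟩ := ih hc
      exact ⟨w, head hstep.1 ⟨hstep.2, hc⟩ hcw, hw⟩

theorem exists_last_exit (h : Reach D S u v) (hu : u ∈ A) :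
    ∃ w ∈ A, Reach D (S \ A) w v := by
  induction h with
  | refl => exact ⟨u, hu, refl⟩
  | @tail _ c _ hstep ih =>
    by_cases hc : c ∈ A
    · exact ⟨c, hc, refl⟩
    · obtain ⟨w, hw, hwb⟩ := ih
      exact ⟨w, hw, hwb.tail hstep.1 ⟨hstep.2, hc⟩⟩

theorem exists_crossing (h : Reach D S u v) (hu : u ∈ A) (hv : v ∈ B) (hAB : Disjoint A B) :
    ∃ b ∈ A, ∃ c ∈ B, c ∈ S ∧ Reach D (insert c (S \ (A ∪ B))) b c := by
  obtain ⟨w, huw, c, hcB, hcS, hwc⟩ := h.exists_first_entry (Set.disjoint_left.mp hAB hu) hv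
  obtain ⟨b, hb, hbw⟩ := huw.exists_last_exit hu
  rw [Set.sdiff_sdiff, Set.union_comm B A] at hbw
  exact ⟨b, hb, c, hcB, hcS, (hbw.mono (Set.subset_insert _ _)).tail hwc (Set.mem_insert _ _)⟩

theorem reverse (h : Reach D T u v) : Reach (reversed D) (insert u T) v u := by
  induction h with
  | refl => exact refl
  | @tail w _ huw hstep ih =>
    exact head (D := reversed D) hstep.1 ((eq_or_mem huw).imp Eq.symm id) ih

theorem reverse_insert (h : Reach D (insert v T) u v) :
    Reach (reversed D) (insert u T) v u := by
  obtain ⟨w, hw, hwu⟩ := h.reverse.exists_last_exit (A := {v}) rfl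
  rw [Set.mem_singleton_iff.mp hw] at hwu
  exact hwu.mono (by grind)

/-- Shortcutting the walk at the first repeated vertex makes it a path. -/
theorem exists_isDirPath (h : Reach D T u v) :
    ∃ p, D.IsDirPath p u v ∧ ∀ x ∈ p, x ≠ u → x ∈ T := by
  induction h using Relation.ReflTransGen.head_induction_on with
  | refl => exact ⟨[v], ⟨by simp, by simp, rfl, rfl⟩, by simp⟩
  | @head a c hstep _ ih =>
    obtain ⟨p, hp, hpT⟩ := ih
    have hpT' : ∀ x ∈ p, x ∈ T := fun x hx =>
      (eq_or_ne x c).elim (fun hxc => hxc ▸ hstep.2) (hpT x hx)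
    by_cases ha : a ∈ p
    · obtain ⟨s, t, rfl⟩ := List.append_of_mem ha
      refine ⟨a :: t, ⟨hp.chain.right_of_append, (List.nodup_append.mp hp.nodup).2.1, rfl, ?_⟩,
        fun x hx _ => hpT' x (List.mem_append_right s hx)⟩
      simpa using hp.last_eq
    · exact ⟨a :: p, isDirPath_cons hstep.1 hp ha,
        fun x hx hxa => hpT' x ((List.mem_cons.mp hx).resolve_left hxa)⟩

theorem of_isChain {l : List V} (h : (u :: l).IsChain D.Adj) (hT : ∀ x ∈ l, x ∈ T)
    (hv : v ∈ u :: l) : Reach D T u v := by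
  induction l generalizing u with
  | nil => exact List.mem_singleton.mp hv ▸ refl
  | cons c l ih =>
    rw [List.isChain_cons_cons] at h
    rcases List.mem_cons.mp hv with rfl | hv
    · exact refl
    · exact head h.1 (hT c List.mem_cons_self)
        (ih h.2 (fun y hy => hT y (List.mem_cons_of_mem c hy)) hv)

theorem mem_union_or {X : Set V} {P : Prop} (hu : u ∈ X ∪ {w | Reach D Xᶜ z w})
    (huw : D.Adj u w) (hout : u ∈ X → w ∈ X ∨ w = z ∨ P) :
    w ∈ X ∪ {w | Reach D Xᶜ z w} ∨ P := by
  rcases hu with hu | hu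
  · rcases hout hu with hw | rfl | hP
    exacts [Or.inl (Or.inl hw), Or.inl (Or.inr refl), Or.inr hP]
  · by_cases hw : w ∈ X
    · exact Or.inl (Or.inl hw)
    · exact Or.inl (Or.inr (hu.tail huw hw))

end Reach

theorem exists_split_of_isDirPath {p : List V} {d : V} (h : D.IsDirPath p a d) (hb : b ∈ p) :
    ∃ P Q : Set V, Disjoint P Q ∧ b ∉ P ∧ b ∉ Q ∧ P ⊆ {x | x ∈ p ∧ x ≠ a ∧ x ≠ d} ∧
      Q ⊆ {x | x ∈ p ∧ x ≠ a ∧ x ≠ d} ∧ Reach D (insert b P) a b ∧ Reach D (insert d Q) b d := by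
  obtain ⟨s, t, rfl⟩ := List.append_of_mem hb
  obtain ⟨hchain, hnodup, hhead, hlast⟩ := h
  obtain ⟨hs, ht, hst⟩ := List.nodup_append.mp hnodup
  have hbt : b ∉ t := (List.nodup_cons.mp ht).1
  have hdt : d ∈ b :: t := List.mem_of_getLast? (by simpa using hlast)
  refine ⟨{x | x ∈ s ∧ x ≠ a}, {x | x ∈ t ∧ x ≠ d}, ?_, ?_, ?_, ?_, ?_, ?_, ?_⟩
  · exact Set.disjoint_left.mpr fun x hx hx' => hst x hx.1 x (List.mem_cons_of_mem b hx'.1) rfl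
  · exact fun hbs => hst b hbs.1 b List.mem_cons_self rfl
  · exact fun hbt' => hbt hbt'.1
  · exact fun x hx => ⟨List.mem_append_left _ hx.1, hx.2, hst x hx.1 d hdt⟩
  · refine fun x hx => ⟨by simp [hx.1], ?_, hx.2⟩
    rintro rfl
    cases s with
    | nil => exact hbt (by simpa [← Option.some.inj hhead] using hx.1)
    | cons c s => exact hst x (by simp [← Option.some.inj hhead]) x (by simp [hx.1]) rfl
  · cases s with
    | nil => exact Option.some.inj hhead ▸ Reach.refl
    | cons c s =>
      obtain rfl : c = a := Option.some.inj hhead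
      have hcs : (c :: (s ++ [b])).IsChain D.Adj :=
        List.IsChain.left_of_append (l₂ := t) (by simpa using hchain)
      exact Reach.of_isChain hcs (by grind) (by simp)
  · exact Reach.of_isChain hchain.right_of_append (by grind) hdt

end Walks

section Models

variable {V U W ι : Type*} {G : Digraph V} {H : Digraph U} {A : ι → W × W}

theorem isDirPath_of_map_val {s : Set V} {S : Digraph s} {p : List s} {a b : s}
    (hS : ∀ x y, [x, y] <:+: p → S.Adj x y) (h : G.IsDirPath (p.map Subtype.val) a b) :
    S.IsDirPath p a b where
  chain := p.isChain_isInfix.imp hS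
  nodup := h.nodup.of_map _
  head_eq := Option.map_injective Subtype.val_injective <| by
    rw [← List.head?_map, h.head_eq, Option.map_some]
  last_eq := Option.map_injective Subtype.val_injective <| by
    rw [← List.getLast?_map, h.last_eq, Option.map_some]

theorem containsSubdivision_of_paths (f : U → V) (P : U → U → List V)
    (hf : Function.Injective f)
    (hP : ∀ u v, H.Adj u v → G.IsDirPath (P u v) (f u) (f v))
    (hnew : ∀ u v, H.Adj u v → ∀ x ∈ P u v, x ≠ f u → x ≠ f v → x ∉ Set.range f)
    (hdisj : ∀ u v u' v', H.Adj u v → H.Adj u' v' → (u, v) ≠ (u', v') →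
      ∀ x ∈ P u v, x ≠ f u → x ≠ f v → x ∉ P u' v') :
    G.ContainsSubdivision H := by
  classical
  let s : Set V := {x | x ∈ Set.range f ∨ ∃ u v, H.Adj u v ∧ x ∈ P u v}
  let P' : U → U → List s := fun u v =>
    if h : H.Adj u v then (P u v).attachWith (· ∈ s) fun _ hx => Or.inr ⟨u, v, h, hx⟩ else []
  have hval : ∀ u v, H.Adj u v → (P' u v).map Subtype.val = P u v := fun u v h => by
    simp [P', h]
  have hmem : ∀ u v, H.Adj u v → ∀ x : s, x ∈ P' u v ↔ x.1 ∈ P u v := fun u v h x => by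
    simp [← hval u v h]
  let S : Digraph s := ⟨fun x y => ∃ u v, H.Adj u v ∧ [x, y] <:+: P' u v⟩
  refine ⟨s, S, ?_, fun u => ⟨f u, Or.inl ⟨u, rfl⟩⟩, P', ?_, ?_, ?_, ?_, ?_, fun _ _ => Iff.rfl⟩
  · rintro x y ⟨u, v, h, hxy⟩
    have hxy' : [x.1, y.1] <:+: P u v := hval u v h ▸ hxy.map Subtype.val
    exact List.isChain_pair.mp ((hP u v h).chain.infix hxy')
  · exact fun u v h => hf (congrArg Subtype.val h)
  · exact fun u v h => isDirPath_of_map_val (G := G) (fun x y hxy => ⟨u, v, h, hxy⟩)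
      (by rw [hval u v h]; exact hP u v h)
  · rintro u v h x hx hxu hxv ⟨w, rfl⟩
    exact hnew u v h _ ((hmem u v h _).mp hx) (fun e => hxu (Subtype.ext e))
      (fun e => hxv (Subtype.ext e)) ⟨w, rfl⟩
  · intro u v u' v' h h' hne x hx hxu hxv hx'
    exact hdisj u v u' v' h h' hne x ((hmem u v h x).mp hx) (fun e => hxu (Subtype.ext e))
      (fun e => hxv (Subtype.ext e)) ((hmem u' v' h' x).mp hx')
  · rintro ⟨x, ⟨u, rfl⟩ | ⟨u, v, h, hx⟩⟩
    · exact Or.inl ⟨u, rfl⟩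
    · exact Or.inr ⟨u, v, h, (hmem u v h _).mpr hx⟩

/-- A subdivision in `G` of the digraph on `W` with the list of arcs `A`, recorded by the placement
`f` of the vertices and, for each arc `A i`, a set `T i` through which a walk joins its ends. Walks
instead of paths suffice, since a walk can be shortened to a path within the same set. -/
def HasModel (G : Digraph V) (A : ι → W × W) : Prop :=
  ∃ f : W → V, Function.Injective f ∧ ∃ T : ι → Set V,
    Pairwise (fun i j => Disjoint (T i) (T j)) ∧ (∀ i k, f k ∉ T i) ∧
    ∀ i, Reach G (insert (f (A i).2) (T i)) (f (A i).1) (f (A i).2)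

theorem HasModel.containsSubdivision (h : HasModel G A) {τ : U → W}
    (hτ : Function.Injective τ) (hH : ∀ u v, H.Adj u v → ∃ i, A i = (τ u, τ v)) :
    G.ContainsSubdivision H := by
  obtain ⟨f, hf, T, hT, hfT, hreach⟩ := h
  have hpath : ∀ u v, ∃ p : List V, H.Adj u v → ∃ i, A i = (τ u, τ v) ∧
      G.IsDirPath p (f (τ u)) (f (τ v)) ∧ ∀ x ∈ p, x ≠ f (τ u) → x ≠ f (τ v) → x ∈ T i := by
    intro u v
    by_cases huv : H.Adj u v
    · obtain ⟨i, hi⟩ := hH u v huv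
      have hr := hreach i
      rw [hi] at hr
      obtain ⟨p, hp, hpT⟩ := hr.exists_isDirPath
      exact ⟨p, fun _ => ⟨i, hi, hp, fun x hx hxu hxv => (hpT x hx hxu).resolve_left hxv⟩⟩
    · exact ⟨[], fun h => absurd h huv⟩
  choose P hP using hpath
  refine containsSubdivision_of_paths (f ∘ τ) P (hf.comp hτ) ?_ ?_ ?_
  · exact fun u v h => (hP u v h).choose_spec.2.1
  · rintro u v h x hx hxu hxv ⟨w, rfl⟩
    obtain ⟨i, -, -, hPT⟩ := hP u v h
    exact hfT i _ (hPT _ hx hxu hxv)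
  · intro u v u' v' h h' hne x hx hxu hxv hx'
    obtain ⟨i, hi, -, hPT⟩ := hP u v h
    obtain ⟨i', hi', -, hPT'⟩ := hP u' v' h'
    have hxT := hPT x hx hxu hxv
    have hii : i ≠ i' := by
      rintro rfl
      rw [hi, Prod.mk.injEq] at hi'
      exact hne (Prod.ext (hτ hi'.1) (hτ hi'.2))
    refine Set.disjoint_left.mp (hT hii) hxT (hPT' x hx' ?_ ?_) <;>
      exact fun e => hfT i _ (e ▸ hxT)

theorem HasModel.of_reversed (h : HasModel (reversed G) A) :
    HasModel G fun i => (A i).swap := by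
  obtain ⟨f, hf, T, hT, hfT, hr⟩ := h
  exact ⟨f, hf, T, hT, hfT, fun i => (hr i).reverse_insert⟩

end Models

section Tournaments

/-- The arcs of the transitive tournament on four vertices. -/
def transitiveArcs : Fin 6 → Fin 4 × Fin 4 := ![(0, 1), (0, 2), (0, 3), (1, 2), (1, 3), (2, 3)]

/-- The arcs of the strongly connected tournament on four vertices. -/
def strongArcs : Fin 6 → Fin 4 × Fin 4 := ![(0, 1), (1, 2), (2, 3), (3, 0), (3, 1), (2, 0)]

/-- The arcs of the tournament in which a source dominates a directed triangle. -/
def sourceArcs : Fin 6 → Fin 4 × Fin 4 := ![(0, 1), (0, 2), (0, 3), (1, 2), (2, 3), (3, 1)]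

/-- The four tournaments on four vertices, up to isomorphism. -/
def fourTournaments : Fin 4 → Fin 6 → Fin 4 × Fin 4 :=
  ![transitiveArcs, strongArcs, sourceArcs, fun i => (sourceArcs i).swap]

theorem fourTournaments_complete :
    ∀ k a b, a ≠ b → ∃ i, fourTournaments k i = (a, b) ∨ fourTournaments k i = (b, a) := by
  decide

/-- The adjacency table of the tournament on `Fin 4` that has, for `u < v`, the arc `(u, v)` if the
corresponding argument is true, and `(v, u)` otherwise. -/
def tournamentAdj (b₀₁ b₀₂ b₀₃ b₁₂ b₁₃ b₂₃ : Bool) : Fin 4 → Fin 4 → Bool :=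
  ![![false, b₀₁, b₀₂, b₀₃], ![!b₀₁, false, b₁₂, b₁₃], ![!b₀₂, !b₁₂, false, b₂₃],
    ![!b₀₃, !b₁₃, !b₂₃, false]]

theorem exists_fourTournaments_tournamentAdj : ∀ b₀₁ b₀₂ b₀₃ b₁₂ b₁₃ b₂₃ : Bool,
    ∃ k, ∃ σ : Equiv.Perm (Fin 4), ∀ i, tournamentAdj b₀₁ b₀₂ b₀₃ b₁₂ b₁₃ b₂₃
      (σ (fourTournaments k i).1) (σ (fourTournaments k i).2) := by
  decide +kernel

variable {H : Digraph (Fin 4)}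

theorem exists_fourTournaments_adj (hH : H.IsOrientation ⊤) :
    ∃ k, ∃ σ : Equiv.Perm (Fin 4), ∀ i,
      H.Adj (σ (fourTournaments k i).1) (σ (fourTournaments k i).2) := by
  classical
  have htotal : ∀ u v, u ≠ v → H.Adj u v ∨ H.Adj v u := fun u v huv => (hH.1 u v).mp huv
  obtain ⟨k, σ, hσ⟩ := exists_fourTournaments_tournamentAdj
    (H.Adj 0 1) (H.Adj 0 2) (H.Adj 0 3) (H.Adj 1 2) (H.Adj 1 3) (H.Adj 2 3)
  have hadj : ∀ u v, tournamentAdj (H.Adj 0 1) (H.Adj 0 2) (H.Adj 0 3) (H.Adj 1 2) (H.Adj 1 3)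
      (H.Adj 2 3) u v → H.Adj u v := by
    intro u v
    fin_cases u <;> fin_cases v <;> simp [tournamentAdj] <;>
      exact fun h => (htotal _ _ (by decide)).resolve_right h
  exact ⟨k, σ, fun i => hadj _ _ (hσ i)⟩

theorem exists_fourTournaments_of_isOrientation (hH : H.IsOrientation ⊤) :
    ∃ k, ∃ τ : Equiv.Perm (Fin 4), ∀ u v, H.Adj u v → ∃ i, fourTournaments k i = (τ u, τ v) := by
  obtain ⟨k, σ, hσ⟩ := exists_fourTournaments_adj hH
  have hasymm : ∀ u v, H.Adj u v → ¬ H.Adj v u := fun u v h h' => hH.2 u v ⟨h, h'⟩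
  refine ⟨k, σ.symm, fun u v huv => ?_⟩
  have hne : σ.symm u ≠ σ.symm v := fun e => hasymm u v huv (σ.symm.injective e ▸ huv)
  obtain ⟨i, hi | hi⟩ := fourTournaments_complete k _ _ hne
  · exact ⟨i, hi⟩
  · have harc := hσ i
    simp only [hi, Equiv.apply_symm_apply] at harc
    exact absurd harc (hasymm u v huv)

end Tournaments

section TailPaths

variable {V : Type*} {G : Digraph V} {R : Set V} {v : ℕ → V} {h m a b i j k l n r w : ℕ} {x : V}

/-- For any two vertices, `u` has an out-neighbour different from both. -/
def ThreeOut (D : Digraph V) (u : V) : Prop := ∀ y z, ∃ w, D.Adj u w ∧ w ≠ y ∧ w ≠ z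

theorem threeOut_of_outDegree [Finite V] {u : V} (hu : 3 ≤ G.outDegree u) : ThreeOut G u := by
  intro y z
  have hlt : ({y, z} : Set V).ncard < {w | G.Adj u w}.ncard :=
    ((Set.ncard_insert_le y {z}).trans_eq (by rw [Set.ncard_singleton])).trans_lt hu
  obtain ⟨w, hw, hyz⟩ := Set.exists_mem_notMem_of_ncard_lt_ncard hlt
  exact ⟨w, hw, fun h => hyz (Or.inl h), fun h => hyz (Or.inr h)⟩

/-- The vertices `v 0, …, v m` form a directed path; the values of `v` after time `m` are
irrelevant. -/
structure IsTimedPath (G : Digraph V) (v : ℕ → V) (m : ℕ) : Prop where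
  injOn : Set.InjOn v (Set.Iic m)
  adj : ∀ a < m, G.Adj (v a) (v (a + 1))

/-- The set of vertices visited by `v` in the time interval `[a, b)`. -/
def segment (v : ℕ → V) (a b : ℕ) : Set V := v '' Set.Ico a b

/-- The sequence `v` preceded by `x`. -/
def prepend (x : V) (v : ℕ → V) : ℕ → V
  | 0 => x
  | t + 1 => v t

theorem segment_mono (ha : b ≤ a) (hn : m ≤ n) : segment v a m ⊆ segment v b n :=
  Set.image_mono (Set.Ico_subset_Ico ha hn)

theorem mem_segment {t : ℕ} (ha : a ≤ t) (hb : t < b) : v t ∈ segment v a b :=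
  ⟨t, ⟨ha, hb⟩, rfl⟩

namespace IsTimedPath

theorem ne (hv : IsTimedPath G v m) (ha : a ≤ m) (hb : b ≤ m) (hab : a ≠ b) : v a ≠ v b :=
  fun e => hab (hv.injOn ha hb e)

theorem injective_comp {ι : Type*} {t : ι → ℕ} (hv : IsTimedPath G v m)
    (ht : Function.Injective t) (hm : ∀ i, t i ≤ m) : Function.Injective fun i => v (t i) :=
  fun i j hij => ht (hv.injOn (hm i) (hm j) hij)

theorem lt_card [Finite V] (hv : IsTimedPath G v m) : m < Nat.card V := by
  have hinj := hv.injective_comp (t := ((↑) : Fin (m + 1) → ℕ)) Fin.val_injective Fin.is_le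
  simpa using Nat.card_le_card_of_injective _ hinj

theorem notMem_segment (hv : IsTimedPath G v m) {t : ℕ} (ht : t ≤ m) (hb : b ≤ m + 1)
    (htab : t < a ∨ b ≤ t) : v t ∉ segment v a b := by
  rintro ⟨s, ⟨has, hsb⟩, hst⟩
  exact hv.ne (a := s) (b := t) (by omega) ht (by omega) hst

theorem disjoint_segment (hv : IsTimedPath G v m) (hb : b ≤ m + 1) (hn : n ≤ m + 1)
    (hab : b ≤ a ∨ n ≤ l ∨ b ≤ l ∨ n ≤ a) : Disjoint (segment v a b) (segment v l n) := by
  refine Set.disjoint_left.mpr ?_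
  rintro _ ⟨t, ⟨hat, htb⟩, rfl⟩ ⟨s, ⟨hls, hsn⟩, hst⟩
  exact hv.ne (a := s) (b := t) (by omega) (by omega) (by omega) hst

theorem snoc (hv : IsTimedPath G v m) (hx : G.Adj (v m) x) (hnew : ∀ t ≤ m, x ≠ v t) :
    IsTimedPath G (Function.update v (m + 1) x) (m + 1) where
  injOn a ha b hb hab := by
    simp only [Set.mem_Iic] at ha hb
    simp only [Function.update_apply] at hab
    split_ifs at hab with ham hbm hbm
    · omega
    · exact absurd hab (hnew b (by omega))
    · exact absurd hab.symm (hnew a (by omega))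
    · exact hv.injOn (show a ≤ m by omega) (show b ≤ m by omega) hab
  adj a ha := by
    rw [Function.update_of_ne ha.ne]
    rcases (Nat.lt_succ_iff.mp ha).eq_or_lt with rfl | ham
    · rwa [Function.update_self]
    · rw [Function.update_of_ne (by omega)]
      exact hv.adj a ham

theorem prepend (hv : IsTimedPath G v m) (hx : G.Adj x (v 0)) (hnew : ∀ t ≤ m, x ≠ v t) :
    IsTimedPath G (prepend x v) (m + 1) where
  injOn a ha b hb hab := by
    cases a <;> cases b
    · rfl
    · exact absurd hab (hnew _ (Nat.le_of_succ_le_succ hb))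
    · exact absurd hab.symm (hnew _ (Nat.le_of_succ_le_succ ha))
    · exact congrArg _ (hv.injOn (Nat.le_of_succ_le_succ ha) (Nat.le_of_succ_le_succ hb) hab)
  adj a ha := by
    cases a
    · exact hx
    · exact hv.adj _ (Nat.lt_of_succ_lt_succ ha)

theorem shift (hv : IsTimedPath G v m) (hn : j + n ≤ m) : IsTimedPath G (fun t => v (j + t)) n where
  injOn a ha b hb hab := by
    simp only [Set.mem_Iic] at ha hb
    have := hv.injOn (show j + a ≤ m by omega) (show j + b ≤ m by omega) hab
    omega
  adj a ha := hv.adj (j + a) (by omega)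

theorem reach_segment (hv : IsTimedPath G v m) (hab : a ≤ b) (hb : b ≤ m) :
    Reach G (insert (v b) (segment v (a + 1) b)) (v a) (v b) := by
  induction b, hab using Nat.le_induction with
  | base => exact Reach.refl
  | succ b hab ih =>
    rcases hab.eq_or_lt with rfl | hlt
    · exact Reach.of_adj_insert (hv.adj a (by omega))
    · refine ((ih (by omega)).mono ?_).tail (hv.adj b (by omega)) (Set.mem_insert _ _)
      rintro _ (rfl | hx)
      · exact Or.inr (mem_segment hlt b.lt_succ_self)
      · exact Or.inr (segment_mono le_rfl b.le_succ hx)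

theorem reach_arc_segment (hv : IsTimedPath G v m) (hx : G.Adj x (v a)) (hab : a ≤ b)
    (hb : b ≤ m) : Reach G (insert (v b) (segment v a b)) x (v b) := by
  rcases hab.eq_or_lt with rfl | hlt
  · exact Reach.of_adj_insert hx
  · exact Reach.head hx (Or.inr (mem_segment le_rfl hlt))
      ((hv.reach_segment hab hb).mono (Set.insert_subset_insert (segment_mono a.le_succ le_rfl)))

theorem hasModel_strong_of_reach (hv : IsTimedPath G v m) (hil : i ≤ l) (hlj : l < j) (hjr : j < r)
    (hrm : r < m) (hi : G.Adj (v m) (v i)) (hj : G.Adj (v m) (v j))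
    (hr : Reach G (insert (v l) (segment v i (m + 1))ᶜ) (v r) (v l)) :
    HasModel G strongArcs := by
  refine ⟨fun t => v (![l, j, r, m] t), hv.injective_comp ?_ ?_,
    ![segment v (l + 1) j, segment v (j + 1) r, segment v (r + 1) m, segment v i l, ∅,
      (segment v i (m + 1))ᶜ], (pairwise_disjoint_on _).mpr ?_, ?_, ?_⟩
  · intro a b hab
    fin_cases a <;> fin_cases b <;> simp at hab ⊢ <;> omega
  · intro t
    fin_cases t <;> simp <;> omega
  · intro a b hab
    fin_cases a <;> fin_cases b <;> simp at hab ⊢ <;>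
      first
        | exact hv.disjoint_segment (by omega) (by omega) (by omega)
        | exact Set.disjoint_compl_right_iff_subset.mpr (segment_mono (by omega) (by omega))
  · intro a b
    fin_cases a <;> fin_cases b <;> simp <;>
      first
        | exact hv.notMem_segment (by omega) (by omega) (by omega)
        | exact mem_segment (by omega) (by omega)
  · intro a
    fin_cases a
    · exact hv.reach_segment hlj.le (hjr.trans hrm).le
    · exact hv.reach_segment hjr.le hrm.le
    · exact hv.reach_segment hrm.le le_rfl
    · exact hv.reach_arc_segment hi hil (hlj.trans (hjr.trans hrm)).le
    · exact Reach.of_adj_insert hj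
    · exact hr

theorem hasModel_strong (hv : IsTimedPath G v m) (hil : i ≤ l) (hlj : l < j) (hjk : j < k)
    (hkm : k < m) (hi : G.Adj (v m) (v i)) (hj : G.Adj (v m) (v j))
    (hr : Reach G {v j, v m}ᶜ (v k) (v l)) : HasModel G strongArcs := by
  obtain ⟨_, ⟨r, ⟨hjr, hrm⟩, rfl⟩, _, ⟨l', ⟨hil', hlj'⟩, rfl⟩, -, hr'⟩ :=
    hr.exists_crossing (mem_segment (a := j + 1) hjk hkm) (mem_segment hil hlj)
      (hv.disjoint_segment (by omega) (by omega) (by omega))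
  refine hv.hasModel_strong_of_reach hil' hlj' hjr hrm hi hj
    (hr'.mono (Set.insert_subset_insert ?_))
  rintro _ ⟨hx, hx'⟩ ⟨t, ⟨hit, htm⟩, rfl⟩
  rcases lt_trichotomy t j with htj | rfl | hjt
  · exact hx' (Or.inr (mem_segment hit htj))
  · exact hx (Or.inl rfl)
  · rcases (Nat.lt_succ_iff.mp htm).eq_or_lt with rfl | htm
    · exact hx (Or.inr rfl)
    · exact hx' (Or.inl (mem_segment hjt htm))

theorem hasModel_source_of_reach {P Q : Set V} (hv : IsTimedPath G v m) (hil : i ≤ l) (hlj : l < j)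
    (hjw : j < w) (hwm : w < m) (hi : G.Adj (v m) (v i)) (hj : G.Adj (v m) (v j))
    (hPQ : Disjoint P Q) (hP : Disjoint (segment v i (w + 1)) P)
    (hQ : Disjoint (segment v i (w + 1)) Q) (hmP : v m ∉ P) (hmQ : v m ∉ Q)
    (hmw : Reach G (insert (v w) P) (v m) (v w)) (hwl : Reach G (insert (v l) Q) (v w) (v l)) :
    HasModel G sourceArcs := by
  have hdisj : ∀ T, Disjoint (segment v i (w + 1)) T → ∀ a b, i ≤ a → b ≤ w + 1 →
      Disjoint (segment v a b) T := fun T hT a b ha hb => hT.mono_left (segment_mono ha hb)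
  refine ⟨fun t => v (![m, l, j, w] t), hv.injective_comp ?_ ?_,
    ![segment v i l, ∅, P, segment v (l + 1) j, segment v (j + 1) w, Q],
    (pairwise_disjoint_on _).mpr ?_, ?_, ?_⟩
  · intro a b hab
    fin_cases a <;> fin_cases b <;> simp at hab ⊢ <;> omega
  · intro t
    fin_cases t <;> simp <;> omega
  · intro a b hab
    fin_cases a <;> fin_cases b <;> simp at hab ⊢ <;>
      first
        | exact hv.disjoint_segment (by omega) (by omega) (by omega)
        | exact hdisj P hP _ _ (by omega) (by omega)
        | exact (hdisj P hP _ _ (by omega) (by omega)).symm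
        | exact hdisj Q hQ _ _ (by omega) (by omega)
        | exact hPQ
  · intro a b
    fin_cases a <;> fin_cases b <;> simp <;>
      first
        | exact hv.notMem_segment (by omega) (by omega) (by omega)
        | assumption
        | exact Set.disjoint_left.mp hP (mem_segment (by omega) (by omega))
        | exact Set.disjoint_left.mp hQ (mem_segment (by omega) (by omega))
  · intro a
    fin_cases a
    · exact hv.reach_arc_segment hi hil (hlj.trans (hjw.trans hwm)).le
    · exact Reach.of_adj_insert hj
    · exact hmw
    · exact hv.reach_segment hlj.le (hjw.trans hwm).le
    · exact hv.reach_segment hjw.le hwm.le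
    · exact hwl

theorem hasModel_source (hv : IsTimedPath G v m) (hil : i ≤ l) (hlj : l < j) (hjk : j < k)
    (hkm : k < m) (hi : G.Adj (v m) (v i)) (hj : G.Adj (v m) (v j)) (hk : G.Adj (v m) (v k))
    (hr : Reach G {v j, v m}ᶜ (v k) (v l)) : HasModel G sourceArcs := by
  classical
  have hkB : v k ∉ segment v i j := hv.notMem_segment hkm.le (by omega) (by omega)
  obtain ⟨_, rfl, _, ⟨l, ⟨hil, hlj⟩, rfl⟩, hl, hr⟩ :=
    hr.exists_crossing (A := {v k}) rfl (mem_segment hil hlj) (Set.disjoint_singleton_left.mpr hkB)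
  obtain ⟨p, hp, hpT⟩ := hr.exists_isDirPath
  have hpavoid : ∀ x ∈ p, x ≠ v j ∧ x ≠ v m ∧ (x ∈ segment v i j → x = v l) := by
    intro x hx
    by_cases hxk : x = v k
    · subst hxk
      exact ⟨hv.ne hkm.le (by omega) hjk.ne', hv.ne hkm.le le_rfl hkm.ne, fun h => absurd h hkB⟩
    · rcases hpT x hx hxk with rfl | ⟨hxjm, hxB⟩
      · exact ⟨fun h => hl (Or.inl h), fun h => hl (Or.inr h), fun _ => rfl⟩
      · exact ⟨fun h => hxjm (Or.inl h), fun h => hxjm (Or.inr h), fun h => absurd (Or.inr h) hxB⟩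
  have hw : ∃ w, j < w ∧ v w ∈ p := ⟨k, hjk, List.mem_of_head? hp.head_eq⟩
  obtain ⟨hjw, hwp⟩ := Nat.find_spec hw
  have hwk : Nat.find hw ≤ k := Nat.find_min' hw ⟨hjk, List.mem_of_head? hp.head_eq⟩
  have hmin : ∀ t, j < t → t < Nat.find hw → v t ∉ p := fun t hjt htw htp =>
    Nat.find_min hw htw ⟨hjt, htp⟩
  generalize Nat.find hw = w at *
  obtain ⟨P, Q, hPQ, hwP, hwQ, hP, hQ, hmw, hwl⟩ := exists_split_of_isDirPath
    (isDirPath_cons hk hp fun h => (hpavoid _ h).2.1 rfl) (List.mem_cons_of_mem _ hwp)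
  have hdisj : ∀ T ⊆ {x | x ∈ v m :: p ∧ x ≠ v m ∧ x ≠ v l}, v w ∉ T →
      Disjoint (segment v i (w + 1)) T := by
    refine fun T hT hwT => Set.disjoint_left.mpr ?_
    rintro _ ⟨t, ⟨hit, htw⟩, rfl⟩ htT
    obtain ⟨htp, htm, htl⟩ := hT htT
    replace htp := (List.mem_cons.mp htp).resolve_left htm
    rcases lt_trichotomy t j with htj | rfl | hjt
    · exact htl ((hpavoid _ htp).2.2 (mem_segment hit htj))
    · exact (hpavoid _ htp).1 rfl
    · rcases (Nat.lt_succ_iff.mp htw).eq_or_lt with rfl | htw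
      · exact hwT htT
      · exact hmin t hjt htw htp
  exact hv.hasModel_source_of_reach hil hlj hjw (by omega) hi hj hPQ (hdisj P hP hwP)
    (hdisj Q hQ hwQ) (fun h => (hP h).2.1 rfl) (fun h => (hQ h).2.1 rfl) hmw hwl

end IsTimedPath

/-- The path `v 0, …, v m` enters `R` at time `h ≥ 2` and stays there, and the only arcs leaving
`R` go to `v 0` and `v 1`. -/
structure IsTailPath (G : Digraph V) (R : Set V) (v : ℕ → V) (h m : ℕ) : Prop
    extends IsTimedPath G v m where
  notMem : ∀ a < h, v a ∉ R
  mem : ∀ a, h ≤ a → a ≤ m → v a ∈ R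
  out : ∀ u ∈ R, ∀ w, G.Adj u w → w ∈ R ∨ w = v 0 ∨ w = v 1
  two_le : 2 ≤ h
  le : h ≤ m

namespace IsTailPath

theorem last_mem (hv : IsTailPath G R v h m) : v m ∈ R := hv.mem m hv.le le_rfl

theorem snoc (hv : IsTailPath G R v h m) (hx : G.Adj (v m) x) (hnew : ∀ t ≤ m, x ≠ v t) :
    IsTailPath G R (Function.update v (m + 1) x) h (m + 1) where
  toIsTimedPath := hv.toIsTimedPath.snoc hx hnew
  notMem a ha := by
    rw [Function.update_of_ne (by have := hv.le; omega)]
    exact hv.notMem a ha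
  mem a ha ham := by
    rcases ham.eq_or_lt with rfl | ham
    · rw [Function.update_self]
      have hne1 : x ≠ v 1 := hnew 1 (by have := hv.two_le; have := hv.le; omega)
      exact (hv.out _ hv.last_mem x hx).resolve_right (by simp [hnew 0, hne1])
    · rw [Function.update_of_ne ham.ne]
      exact hv.mem a ha (Nat.lt_succ_iff.mp ham)
  out := by
    have := hv.two_le
    have := hv.le
    rw [Function.update_of_ne (by omega), Function.update_of_ne (by omega)]
    exact hv.out
  two_le := hv.two_le
  le := hv.le.trans m.le_succ

theorem exists_maximal [Finite V] (hv : IsTailPath G R v h m) :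
    ∃ v m, IsTailPath G R v h m ∧ ∀ w, G.Adj (v m) w → ∃ t ≤ m, w = v t := by
  induction hn : Nat.card V - m generalizing v m with
  | zero => exact absurd hv.lt_card (by omega)
  | succ n ih =>
    by_cases hmax : ∀ w, G.Adj (v m) w → ∃ t ≤ m, w = v t
    · exact ⟨v, m, hv, hmax⟩
    · push Not at hmax
      obtain ⟨w, hw, hnew⟩ := hmax
      exact ih (hv.snoc hw hnew) (by omega)

theorem exists_three_adj (hG : G.Loopless) (h3 : ThreeOut G (v m))
    (hmax : ∀ w, G.Adj (v m) w → ∃ t ≤ m, w = v t) :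
    ∃ i j k, i < j ∧ j < k ∧ k < m ∧ G.Adj (v m) (v i) ∧ G.Adj (v m) (v j) ∧
      G.Adj (v m) (v k) := by
  set N : Set ℕ := {t | t < m ∧ G.Adj (v m) (v t)}
  have hN : ∀ w, G.Adj (v m) w → ∃ t ∈ N, w = v t := by
    intro w hw
    obtain ⟨t, htm, rfl⟩ := hmax w hw
    exact ⟨t, ⟨lt_of_le_of_ne htm (by rintro rfl; exact hG _ hw), hw⟩, rfl⟩
  have hbdd : BddAbove N := ⟨m, fun t ht => ht.1.le⟩
  have hne : N.Nonempty := by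
    obtain ⟨w, hw, -⟩ := h3 (v m) (v m)
    obtain ⟨t, ht, -⟩ := hN w hw
    exact ⟨t, ht⟩
  have hi := Nat.sInf_mem hne
  have hk := Nat.sSup_mem hne hbdd
  obtain ⟨w, hw, hwi, hwk⟩ := h3 (v (sInf N)) (v (sSup N))
  obtain ⟨j, hj, rfl⟩ := hN w hw
  exact ⟨sInf N, j, sSup N, lt_of_le_of_ne (Nat.sInf_le hj) (by rintro rfl; exact hwi rfl),
    lt_of_le_of_ne (le_csSup hbdd hj) (by rintro rfl; exact hwk rfl), hk.1, hi.2, hw, hk.2⟩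

theorem reachable_subset (hv : IsTailPath G R v h m) (hj : 0 < j) (hjk : j < k) (hkm : k < m)
    (hk : G.Adj (v m) (v k)) (hlow : ∀ t < j, ¬ Reach G {v j, v m}ᶜ (v k) (v t)) :
    {x | Reach G {v j, v m}ᶜ (v k) x} ⊆ R := by
  intro x hx
  have hkR : v k ∈ R := (hv.out _ hv.last_mem _ hk).resolve_right <| by
    rintro (hk0 | hk1)
    · exact hv.ne hkm.le m.zero_le (by omega) hk0
    · exact hv.ne hkm.le (by omega) (by omega) hk1
  refine (hx.mem_of_closed (A := {x | Reach G {v j, v m}ᶜ (v k) x} ∩ R) ⟨Reach.refl, hkR⟩ ?_).2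
  intro a ⟨hka, haR⟩ b hb hab
  have hkb := hka.tail hab hb
  refine ⟨hkb, ?_⟩
  rcases hv.out a haR b hab with hbR | rfl | rfl
  · exact hbR
  · exact absurd hkb (hlow 0 hj)
  · rcases (Nat.succ_le_of_lt hj).eq_or_lt with rfl | hj
    · exact absurd (Or.inl rfl) hb
    · exact absurd hkb (hlow 1 hj)

theorem exists_smaller [Finite V] (hv : IsTailPath G R v h m) (hjk : j < k) (hkm : k < m)
    (hj : G.Adj (v m) (v j)) (hXR : {x | Reach G {v j, v m}ᶜ (v k) x} ⊆ R) :
    ∃ R' v' h' m', IsTailPath G R' v' h' m' ∧ R'.ncard < R.ncard := by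
  classical
  set X : Set V := {x | Reach G {v j, v m}ᶜ (v k) x}
  have hkX : v k ∈ X := Reach.refl
  have hXc : X ⊆ {v j, v m}ᶜ := fun x hx => hx.mem_of_mem <| by
    simp [hv.ne hkm.le (by omega : j ≤ m) hjk.ne', hv.ne hkm.le le_rfl hkm.ne]
  have hjX : v j ∉ X := fun h => hXc h (Or.inl rfl)
  have hmX : v m ∉ X := fun h => hXc h (Or.inr rfl)
  have hn : ∃ n, v (j + n) ∈ X := ⟨k - j, by rwa [Nat.add_sub_cancel' hjk.le]⟩
  have hnX := Nat.find_spec hn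
  have hnk : Nat.find hn ≤ k - j := Nat.find_min' hn (by rwa [Nat.add_sub_cancel' hjk.le])
  have hmin : ∀ t < Nat.find hn, v (j + t) ∉ X := fun t => Nat.find_min hn
  have hpos : Nat.find hn ≠ 0 := fun e => hjX (by rwa [e] at hnX)
  generalize Nat.find hn = n at *
  refine ⟨X, prepend (v m) fun t => v (j + t), n + 1, n + 1, ⟨?_, ?_, ?_, ?_, by omega, le_rfl⟩, ?_⟩
  · exact (hv.shift (by omega)).prepend hj fun t ht => hv.ne le_rfl (by omega) (by omega)
  · rintro (_ | a) ha
    · exact hmX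
    · exact hmin a (by omega)
  · intro a ha ha'
    rwa [le_antisymm ha' ha]
  · intro u hu w huw
    by_cases hw : w ∈ ({v j, v m} : Set V)
    · exact Or.inr hw.symm
    · exact Or.inl (Reach.tail hu huw hw)
  · exact Set.ncard_lt_ncard ⟨hXR, fun h => hmX (h hv.last_mem)⟩

theorem hasModel_strong_source [Finite V] (hG : G.Loopless) (h3 : ∀ u, ThreeOut G u)
    (hv : IsTailPath G R v h m) : HasModel G strongArcs ∧ HasModel G sourceArcs := by
  induction hn : R.ncard using Nat.strong_induction_on generalizing R v h m with
  | _ n ih =>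
  obtain ⟨v, m, hv, hmax⟩ := hv.exists_maximal
  obtain ⟨i, j, k, hij, hjk, hkm, hi, hj, hk⟩ := exists_three_adj hG (h3 _) hmax
  by_cases hcase : ∃ l, i ≤ l ∧ l < j ∧ Reach G {v j, v m}ᶜ (v k) (v l)
  · obtain ⟨l, hil, hlj, hr⟩ := hcase
    exact ⟨hv.hasModel_strong hil hlj hjk hkm hi hj hr,
      hv.hasModel_source hil hlj hjk hkm hi hj hk hr⟩
  · have hlow : ∀ t < j, ¬ Reach G {v j, v m}ᶜ (v k) (v t) := by
      intro t htj hr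
      rcases le_or_gt i t with hit | hti
      · exact hcase ⟨t, hit, htj, hr⟩
      · refine hcase ⟨i, le_rfl, hij, hr.trans ((hv.reach_segment hti.le (by omega)).mono ?_)⟩
        rintro _ (rfl | ⟨s, ⟨-, hsi⟩, rfl⟩) (he | he) <;>
          exact hv.ne (by omega) (by omega) (by omega) he
    obtain ⟨R', v', h', m', hv', hlt⟩ :=
      hv.exists_smaller hjk hkm hj (hv.reachable_subset (by omega) hjk hkm hk hlow)
    exact ih _ (hn ▸ hlt) hv' rfl

end IsTailPath

theorem hasModel_strong_source [Finite V] [Nonempty V] (hG : G.Loopless)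
    (h3 : ∀ u, ThreeOut G u) : HasModel G strongArcs ∧ HasModel G sourceArcs := by
  obtain ⟨p⟩ := ‹Nonempty V›
  obtain ⟨q, hpq, -⟩ := h3 p p p
  obtain ⟨x, hqx, hxp, hxq⟩ := h3 q p q
  have hne : p ≠ q := by rintro rfl; exact hG _ hpq
  have hpath : IsTimedPath G (prepend p (prepend q fun _ => x)) 2 := by
    refine IsTimedPath.prepend (IsTimedPath.prepend (m := 0) ⟨?_, ?_⟩ hqx ?_) hpq ?_
    · simp [Set.InjOn]
    · simp
    · exact fun _ _ => hxq.symm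
    · rintro (_ | t) -
      exacts [hne, hxp.symm]
  refine IsTailPath.hasModel_strong_source hG h3 (R := {p, q}ᶜ) (h := 2)
    ⟨hpath, ?_, ?_, ?_, le_rfl, le_rfl⟩
  · intro a ha
    interval_cases a <;> simp [prepend]
  · intro a ha ha'
    rw [le_antisymm ha' ha]
    simp [prepend, hxp, hxq]
  · intro u _ w _
    simp only [prepend, Set.mem_compl_iff, Set.mem_insert_iff, Set.mem_singleton_iff]
    tauto

end TailPaths

section Menger

variable {V : Type*} {D D' : Digraph V} {A B S T : Set V} {a u v w x y z : V}

/-- The digraph with the arc from `x` to `y`, if there is one, removed. -/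
def deleteArc (D : Digraph V) (x y : V) : Digraph V := ⟨fun u v => D.Adj u v ∧ ¬ (u = x ∧ v = y)⟩

theorem deleteArc_le : deleteArc D x y ≤ D := fun _ _ h => h.1

theorem deleteArc_adj_or (h : D.Adj u v) : (deleteArc D x y).Adj u v ∨ u = x ∧ v = y :=
  or_iff_not_imp_right.mpr fun hne => ⟨h, hne⟩

theorem reversed_deleteArc : reversed (deleteArc D x y) = deleteArc (reversed D) y x :=
  Digraph.ext (funext₂ fun _ _ => propext (and_congr_right fun _ => not_congr and_comm))

/-- Some walk inside `T`, endpoints included, leads from `A` to `B`. -/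
def Links (D : Digraph V) (A B T : Set V) : Prop := ∃ a ∈ A, ∃ b ∈ B, a ∈ T ∧ Reach D T a b

namespace Links

theorem mono_adj (h : Links D A B T) (hD : D ≤ D') : Links D' A B T :=
  have ⟨a, ha, b, hb, haT, hab⟩ := h
  ⟨a, ha, b, hb, haT, hab.mono_adj subset_rfl hD⟩

theorem mono (h : Links D A B S) (hST : S ⊆ T) : Links D A B T :=
  have ⟨a, ha, b, hb, haS, hab⟩ := h
  ⟨a, ha, b, hb, hST haS, hab.mono hST⟩

theorem mono_target {B' : Set V} (h : Links D A B T) (hB : B ⊆ B') : Links D A B' T :=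
  have ⟨a, ha, b, hb, haT, hab⟩ := h
  ⟨a, ha, b, hB hb, haT, hab⟩

theorem mono_source {A' : Set V} (h : Links D A B T) (hA : A ⊆ A') : Links D A' B T :=
  have ⟨a, ha, b, hb, haT, hab⟩ := h
  ⟨a, hA ha, b, hb, haT, hab⟩

theorem reverse (h : Links D A B T) : Links (reversed D) B A T :=
  have ⟨a, ha, b, hb, haT, hab⟩ := h
  ⟨b, hb, a, ha, hab.mem_of_mem haT, Set.insert_eq_of_mem haT ▸ hab.reverse⟩

theorem mem_of_singleton (h : Links D A {z} T) : z ∈ T := by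
  obtain ⟨a, -, b, rfl, haT, hab⟩ := h
  exact hab.mem_of_mem haT

theorem trans_arc (h : Links D A {x} S) (hxy : D.Adj x y) (h' : Links D {y} B T) :
    Links D A B (S ∪ T) := by
  obtain ⟨a, ha, _, rfl, haS, hax⟩ := h
  obtain ⟨_, rfl, b, hb, hyT, hyb⟩ := h'
  exact ⟨a, ha, b, hb, Or.inl haS, ((hax.mono Set.subset_union_left).tail hxy (Or.inr hyT)).trans
    (hyb.mono Set.subset_union_right)⟩

theorem trans (h : Links D A {w} S) (h' : Links D {w} B T) : Links D A B (S ∪ T) := by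
  obtain ⟨a, ha, _, rfl, haS, haw⟩ := h
  obtain ⟨_, rfl, b, hb, -, hwb⟩ := h'
  exact ⟨a, ha, b, hb, Or.inl haS, (haw.mono Set.subset_union_left).trans
    (hwb.mono Set.subset_union_right)⟩

theorem to_separator (h : Links D A B S) (hz : ¬ Links D A B {z}ᶜ) : Links D A {z} S := by
  obtain ⟨a, ha, b, hb, haS, hab⟩ := h
  by_contra hcon
  refine hz ⟨a, ha, b, hb, ?_, hab.inter_reachable.mono ?_⟩
  · rintro rfl
    exact hcon ⟨a, ha, a, rfl, haS, Reach.refl⟩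
  · rintro w hw rfl
    exact hcon ⟨a, ha, w, rfl, haS, hw.2⟩

theorem from_separator (h : Links D A B S) (hz : ¬ Links D A B {z}ᶜ) : Links D {z} B S :=
  (h.reverse.to_separator fun h' => hz h'.reverse).reverse

theorem exists_trim (h : Links D A {z} T) :
    ∃ S ⊆ T, Links D A {z} S ∧ ∀ w ∈ S, w ≠ z → Links D A {w} (S \ {z}) := by
  have hzT := h.mem_of_singleton
  obtain ⟨a, ha, c, hc, haT, haz⟩ := h
  obtain rfl : z = c := hc.symm
  by_cases hne : a = z
  · exact ⟨{z}, Set.singleton_subset_iff.mpr hzT, ⟨a, ha, a, hne, hne, Reach.refl⟩,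
      fun w hw hwz => absurd hw hwz⟩
  obtain ⟨w, haw, c, hc, -, hwz⟩ := haz.exists_first_entry (B := {z}) hne rfl
  obtain rfl : z = c := hc.symm
  set U : Set V := (T \ {z}) ∩ {w | Reach D (T \ {z}) a w} with hU
  have haU : a ∈ U := ⟨⟨haT, hne⟩, Reach.refl⟩
  refine ⟨insert z U, Set.insert_subset hzT fun w hw => hw.1.1, ⟨a, ha, z, rfl, Or.inr haU, ?_⟩, ?_⟩
  · exact (haw.inter_reachable.mono (Set.subset_insert z U)).tail hwz (Set.mem_insert z U)
  · intro u hu huz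
    have hU' : U ⊆ insert z U \ {z} := fun w hw => ⟨Or.inr hw, hw.1.2⟩
    exact ⟨a, ha, u, rfl, hU' haU, (hu.resolve_left huz).2.inter_reachable.mono hU'⟩

theorem exists_trim_source (h : Links D {z} B T) :
    ∃ S ⊆ T, Links D {z} B S ∧ ∀ w ∈ S, w ≠ z → Links D {w} B (S \ {z}) := by
  obtain ⟨S, hST, hS, htrim⟩ := h.reverse.exists_trim
  exact ⟨S, hST, hS.reverse, fun w hw hwz => (htrim w hw hwz).reverse⟩

theorem deleteArc_or_to_tail (h : Links D A B T) :
    Links (deleteArc D x y) A B T ∨ Links (deleteArc D x y) A {x} T := by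
  obtain ⟨a, ha, b, hb, haT, hab⟩ := h
  suffices Reach (deleteArc D x y) T a b ∨ Reach (deleteArc D x y) T a x from
    this.imp (fun h => ⟨a, ha, b, hb, haT, h⟩) fun h => ⟨a, ha, x, rfl, haT, h⟩
  clear hb
  induction hab with
  | refl => exact Or.inl Reach.refl
  | tail _ hstep ih =>
    rcases ih with ih | ih
    · rcases deleteArc_adj_or (x := x) (y := y) hstep.1 with hadj | ⟨rfl, -⟩
      · exact Or.inl (ih.tail hadj hstep.2)
      · exact Or.inr ih
    · exact Or.inr ih

theorem deleteArc_or_from_head (h : Links D A B T) :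
    Links (deleteArc D x y) A B T ∨ Links (deleteArc D x y) {y} B T := by
  have hrev := h.reverse.deleteArc_or_to_tail (x := y) (y := x)
  rw [← reversed_deleteArc] at hrev
  exact hrev.imp reverse reverse

theorem exists_distribute (hS : Links D A {z, x} S) (hT : Links D A {z, x} T)
    (hST : Disjoint S T) :
    ∃ Pz Px, Disjoint Pz Px ∧ Links D A {z} Pz ∧ Links D A {x} Px := by
  obtain ⟨a, ha, b, hb, haS, hab⟩ := hS
  obtain ⟨a', ha', b', hb', haT, hab'⟩ := hT
  have hne : b ≠ b' := fun h =>
    Set.disjoint_left.mp hST (hab.mem_of_mem haS) (h ▸ hab'.mem_of_mem haT)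
  have hS : Links D A {b} S := ⟨a, ha, b, rfl, haS, hab⟩
  have hT : Links D A {b'} T := ⟨a', ha', b', rfl, haT, hab'⟩
  rcases hb with rfl | rfl <;> rcases hb' with rfl | rfl
  · exact absurd rfl hne
  · exact ⟨S, T, hST, hS, hT⟩
  · exact ⟨T, S, hST.symm, hT, hS⟩
  · exact absurd rfl hne

theorem exists_distribute_source (hS : Links D {z, y} B S) (hT : Links D {z, y} B T)
    (hST : Disjoint S T) :
    ∃ Qz Qy, Disjoint Qz Qy ∧ Links D {z} B Qz ∧ Links D {y} B Qy := by
  obtain ⟨Qz, Qy, hQ, hz, hy⟩ := hS.reverse.exists_distribute hT.reverse hST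
  exact ⟨Qz, Qy, hQ, hz.reverse, hy.reverse⟩

end Links

/-- Two walks to the cutvertex `z` and to `x` and two walks from `z` and from `y` can only meet in
`z`, since otherwise they would combine to a walk around `z`. -/
theorem exists_disjoint_links_of_separator {Pz Px Qz Qy : Set V} (hD : D' ≤ D) (hxy : D.Adj x y)
    (hz : ¬ Links D' A B {z}ᶜ) (hP : Disjoint Pz Px) (hPz : Links D' A {z} Pz)
    (hPx : Links D' A {x} Px) (hQ : Disjoint Qz Qy) (hQz : Links D' {z} B Qz)
    (hQy : Links D' {y} B Qy) :
    ∃ T₁ T₂, Disjoint T₁ T₂ ∧ Links D A B T₁ ∧ Links D A B T₂ := by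
  obtain ⟨Pz, hsub, hPz, hPz_trim⟩ := hPz.exists_trim
  replace hP := hP.mono_left hsub
  obtain ⟨Px, hsub, hPx, hPx_trim⟩ := hPx.exists_trim
  replace hP := hP.mono_right hsub
  obtain ⟨Qz, hsub, hQz, hQz_trim⟩ := hQz.exists_trim_source
  replace hQ := hQ.mono_left hsub
  obtain ⟨Qy, hsub, hQy, hQy_trim⟩ := hQy.exists_trim_source
  replace hQ := hQ.mono_right hsub
  have hzPx : z ∉ Px := Set.disjoint_left.mp hP hPz.mem_of_singleton
  have hzQy : z ∉ Qy := Set.disjoint_left.mp hQ hQz.reverse.mem_of_singleton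
  have hPx_all : ∀ w ∈ Px, Links D' A {w} Px := fun w hw =>
    (eq_or_ne w x).elim (fun h => h ▸ hPx) fun h => (hPx_trim w hw h).mono Set.sdiff_subset
  have hQy_all : ∀ w ∈ Qy, Links D' {w} B Qy := fun w hw =>
    (eq_or_ne w y).elim (fun h => h ▸ hQy) fun h => (hQy_trim w hw h).mono Set.sdiff_subset
  have hno : ∀ {w S T}, z ∉ S → z ∉ T → Links D' A {w} S → ¬ Links D' {w} B T :=
    fun hzS hzT h h' => hz ((h.trans h').mono
      (Set.subset_compl_singleton_iff.mpr fun h => h.elim hzS hzT))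
  have hPzQy : Disjoint Pz Qy := Set.disjoint_left.mpr fun w hw hw' =>
    hno (by simp) hzQy (hPz_trim w hw fun h => hzQy (h ▸ hw')) (hQy_all w hw')
  have hPxQz : Disjoint Px Qz := Set.disjoint_left.mpr fun w hw hw' =>
    hno hzPx (by simp) (hPx_all w hw) (hQz_trim w hw' fun h => hzPx (h ▸ hw))
  have hPxQy : Disjoint Px Qy := Set.disjoint_left.mpr fun w hw hw' =>
    hno hzPx hzQy (hPx_all w hw) (hQy_all w hw')
  refine ⟨Pz ∪ Qz, Px ∪ Qy, ?_, (hPz.trans hQz).mono_adj hD,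
    (hPx.mono_adj hD).trans_arc hxy (hQy.mono_adj hD)⟩
  simp only [Set.disjoint_union_left, Set.disjoint_union_right]
  exact ⟨⟨hP, hPxQz.symm⟩, hPzQy, hQ⟩

theorem exists_disjoint_links_of_forall_not_adj [Nonempty V] (hD : ∀ x y, ¬ D.Adj x y)
    (hsep : ∀ z, Links D A B {z}ᶜ) :
    ∃ T₁ T₂, Disjoint T₁ T₂ ∧ Links D A B T₁ ∧ Links D A B T₂ := by
  have hcommon : ∀ z, ∃ a ∈ A, a ∈ B ∧ a ≠ z := fun z => by
    obtain ⟨a, ha, b, hb, haz, hab⟩ := hsep z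
    rcases hab.eq_or_head with rfl | ⟨w, -, haw, -⟩
    · exact ⟨a, ha, hb, haz⟩
    · exact absurd haw (hD a w)
  obtain ⟨a, haA, haB, -⟩ := hcommon (Classical.arbitrary V)
  obtain ⟨b, hbA, hbB, hba⟩ := hcommon a
  exact ⟨{a}, {b}, Set.disjoint_singleton.mpr hba.symm, ⟨a, haA, a, haB, rfl, Reach.refl⟩,
    ⟨b, hbA, b, hbB, rfl, Reach.refl⟩⟩

/-- The case of two paths of Menger's theorem, by Göring's induction on the number of arcs. -/
theorem exists_disjoint_links [Finite V] [Nonempty V] (hsep : ∀ z, Links D A B {z}ᶜ) :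
    ∃ T₁ T₂, Disjoint T₁ T₂ ∧ Links D A B T₁ ∧ Links D A B T₂ := by
  induction hn : {e : V × V | D.Adj e.1 e.2}.ncard using Nat.strong_induction_on
    generalizing D A B with
  | _ n ih =>
  by_cases hE : ∃ x y, D.Adj x y
  swap
  · push Not at hE
    exact exists_disjoint_links_of_forall_not_adj hE hsep
  obtain ⟨x, y, hxy⟩ := hE
  set D' := deleteArc D x y
  have hlt : {e : V × V | D'.Adj e.1 e.2}.ncard < n := hn ▸
    Set.ncard_lt_ncard ⟨fun e he => he.1, fun h => (h (a := (x, y)) hxy).2 ⟨rfl, rfl⟩⟩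
      (Set.toFinite _)
  by_cases hsep' : ∀ z, Links D' A B {z}ᶜ
  · obtain ⟨T₁, T₂, hT, h₁, h₂⟩ := ih _ hlt hsep' rfl
    exact ⟨T₁, T₂, hT, h₁.mono_adj deleteArc_le, h₂.mono_adj deleteArc_le⟩
  push Not at hsep'
  obtain ⟨z, hz⟩ := hsep'
  have hsepP : ∀ s, Links D' A {z, x} {s}ᶜ := fun s => by
    rcases (hsep s).deleteArc_or_to_tail (x := x) (y := y) with h | h
    · exact (h.to_separator hz).mono_target (by simp)
    · exact h.mono_target (by simp)
  have hsepQ : ∀ s, Links D' {z, y} B {s}ᶜ := fun s => by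
    rcases (hsep s).deleteArc_or_from_head (x := x) (y := y) with h | h
    · exact (h.from_separator hz).mono_source (by simp)
    · exact h.mono_source (by simp)
  obtain ⟨_, _, hP, hP₁, hP₂⟩ := ih _ hlt hsepP rfl
  obtain ⟨Pz, Px, hP, hPz, hPx⟩ := hP₁.exists_distribute hP₂ hP
  obtain ⟨_, _, hQ, hQ₁, hQ₂⟩ := ih _ hlt hsepQ rfl
  obtain ⟨Qz, Qy, hQ, hQz, hQy⟩ := hQ₁.exists_distribute_source hQ₂ hQ
  exact exists_disjoint_links_of_separator deleteArc_le hxy hz hP hPz hPx hQ hQz hQy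

end Menger

section Thick

variable {V : Type*} {D D' : Digraph V} {S T : Set V} {a d u v w : V}

/-- `T` is nonempty and is a union of interiors of paths from `a` to `d`: every vertex of `T` is
reached from `a`, and reaches `d`, through `T`. Working with such sets rather than with single
paths makes it possible to expand and to contract parts of the digraph. -/
structure Thick (D : Digraph V) (a d : V) (T : Set V) : Prop where
  start : a ∉ T
  finish : d ∉ T
  nonempty : T.Nonempty
  from_start : ∀ w ∈ T, Reach D T a w
  to_finish : ∀ w ∈ T, Reach D (insert d T) w d

theorem exists_thick (ha : a ∉ T) (hd : d ∉ T) (hw : w ∈ T) (haw : Reach D T a w)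
    (hwd : Reach D (insert d T) w d) : ∃ S ⊆ T, w ∈ S ∧ Thick D a d S := by
  have hmono : T ⊆ insert d T := Set.subset_insert d T
  refine ⟨{v ∈ T | Reach D T a v ∧ Reach D (insert d T) v d}, fun v hv => hv.1, ⟨hw, haw, hwd⟩,
    fun h => ha h.1, fun h => hd h.1, ⟨w, hw, haw, hwd⟩, ?_, ?_⟩
  · rintro v ⟨-, hav, hvd⟩
    exact hav.of_between fun x hx hax hxv => ⟨hx, hax, (hxv.mono hmono).trans hvd⟩
  · rintro v ⟨hv, hav, hvd⟩
    obtain ⟨x, hvx, c, hc, -, hxd⟩ := hvd.exists_first_entry (B := {d}) (fun h => hd (h ▸ hv)) rfl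
    obtain rfl : d = c := hc.symm
    rw [Set.insert_sdiff_self_of_notMem hd] at hvx
    refine Reach.tail (hvx.of_between fun y hy hvy hyx => Or.inr ⟨hy, hav.trans hvy, ?_⟩) hxd
      (Set.mem_insert d _)
    exact (hyx.mono hmono).tail hxd (Set.mem_insert d T)

namespace Thick

theorem mono_adj (h : Thick D' a d T) (hD : D' ≤ D) : Thick D a d T where
  start := h.start
  finish := h.finish
  nonempty := h.nonempty
  from_start w hw := (h.from_start w hw).mono_adj subset_rfl hD
  to_finish w hw := (h.to_finish w hw).mono_adj subset_rfl hD

theorem reverse (h : Thick D a d T) : Thick (reversed D) d a T where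
  start := h.finish
  finish := h.start
  nonempty := h.nonempty
  from_start w hw := Set.insert_eq_of_mem hw ▸ (h.to_finish w hw).reverse_insert
  to_finish w hw := (h.from_start w hw).reverse

theorem exists_first (h : Thick D a d T) (hu : u ∈ T) : ∃ w ∈ T, D.Adj a w ∧ Reach D T w u :=
  (h.from_start u hu).eq_or_head.resolve_left fun hau => h.start (hau ▸ hu)

theorem exists_last (h : Thick D a d T) (hu : u ∈ T) : ∃ w ∈ T, D.Adj w d ∧ Reach D T u w := by
  obtain ⟨w, hw, hwd, hwu⟩ := h.reverse.exists_first hu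
  exact ⟨w, hw, hwd, Set.insert_eq_of_mem hw ▸ hwu.reverse⟩

theorem exists_isDirPath_first (h : Thick D a d T) (had : a ≠ d) (hu : u ∈ T) :
    ∃ p, D.IsDirPath p a d ∧ (∀ x ∈ p, x ≠ a → x ≠ d → x ∈ T) ∧
      ∃ w ∈ p, w ∈ T ∧ Reach D T w u := by
  obtain ⟨w, hw, haw, hwu⟩ := h.exists_first hu
  obtain ⟨p, hp, hpT⟩ := (h.to_finish w hw).exists_isDirPath
  have hpT' : ∀ x ∈ p, x = d ∨ x ∈ T := fun x hx =>
    (eq_or_ne x w).elim (fun hxw => Or.inr (hxw ▸ hw)) (hpT x hx)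
  exact ⟨a :: p, isDirPath_cons haw hp fun ha => (hpT' a ha).elim had h.start, by grind,
    w, List.mem_cons_of_mem a (List.mem_of_head? hp.head_eq), hw, hwu⟩

theorem exists_isDirPath_last (h : Thick D a d T) (had : a ≠ d) (hu : u ∈ T) :
    ∃ p, D.IsDirPath p a d ∧ (∀ x ∈ p, x ≠ a → x ≠ d → x ∈ T) ∧
      ∃ w ∈ p, w ∈ T ∧ Reach D T u w := by
  obtain ⟨p, hp, hpT, w, hwp, hw, hwu⟩ := h.reverse.exists_isDirPath_first had.symm hu
  exact ⟨p.reverse, isDirPath_reverse hp,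
    fun x hx hxa hxd => hpT x (List.mem_reverse.mp hx) hxd hxa,
    w, List.mem_reverse.mpr hwp, hw, Set.insert_eq_of_mem hw ▸ hwu.reverse⟩

end Thick

theorem exists_thick_of_links (ha : a ∉ T) (hd : d ∉ T)
    (h : Links D {w | D.Adj a w} {w | D.Adj w d} T) : ∃ S ⊆ T, Thick D a d S := by
  obtain ⟨u, hau, v, hvd, hu, huv⟩ := h
  obtain ⟨S, hST, -, hS⟩ := exists_thick ha hd hu (Reach.of_adj hau hu)
    ((huv.mono (Set.subset_insert d T)).tail hvd (Set.mem_insert d T))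
  exact ⟨S, hST, hS⟩

theorem links_of_reach_deleteArc (had : a ≠ d) (h : Reach (deleteArc D a d) S a d) :
    Links D {w | D.Adj a w} {w | D.Adj w d} (S \ {a, d}) := by
  obtain ⟨_, rfl, h⟩ := h.exists_last_exit (A := {a}) rfl
  obtain ⟨v, hav, c, hc, -, hvd⟩ := h.exists_first_entry (B := {d}) had rfl
  obtain rfl : c = d := hc
  rw [Set.sdiff_sdiff, Set.singleton_union] at hav
  rcases hav.eq_or_head with rfl | ⟨u, hu, hau, huv⟩
  · exact absurd ⟨rfl, rfl⟩ hvd.2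
  · exact ⟨u, hau.1, v, hvd.1, hu, huv.mono_adj subset_rfl deleteArc_le⟩

theorem exists_disjoint_thick [Finite V] (had : a ≠ d)
    (h : ∀ z, z ≠ d → Reach (deleteArc D a d) {z}ᶜ a d) :
    ∃ T₁ T₂, Disjoint T₁ T₂ ∧ Thick D a d T₁ ∧ Thick D a d T₂ := by
  have : Nonempty V := ⟨a⟩
  set D' : Digraph V := ⟨fun u v => D.Adj u v ∧ v ∉ ({a, d} : Set V)⟩
  have hle : D' ≤ D := fun _ _ huv => huv.1
  have hsep : ∀ z, Links D' {w | D.Adj a w ∧ w ∉ ({a, d} : Set V)} {w | D.Adj w d} {z}ᶜ := by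
    intro z
    suffices Links D {w | D.Adj a w} {w | D.Adj w d} ({z}ᶜ \ {a, d}) by
      obtain ⟨u, hau, v, hvd, hu, huv⟩ := this
      exact ⟨u, ⟨hau, hu.2⟩, v, hvd, hu.1,
        (huv.transfer (D' := D') (Set.mem_univ u) fun x _ y hy hxy =>
          ⟨Set.mem_univ y, hy.1, hxy, hy.2⟩).2⟩
    by_cases hz : z = d
    · exact (links_of_reach_deleteArc had (h a had)).mono (by grind)
    · exact links_of_reach_deleteArc had (h z hz)
  have hthick : ∀ T, Links D' {w | D.Adj a w ∧ w ∉ ({a, d} : Set V)} {w | D.Adj w d} T →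
      ∃ S ⊆ T, Thick D a d S := by
    rintro T ⟨u, hau, v, hvd, hu, huv⟩
    have huv' : Reach D (T \ {a, d}) u v := (huv.transfer (S := T \ {a, d}) (Set.mem_univ u)
      fun x _ y hy hxy => ⟨Set.mem_univ y, ⟨hy, hxy.2⟩, hxy.1⟩).2
    obtain ⟨S, hST, hS⟩ := exists_thick_of_links (T := T \ {a, d}) (by simp) (by simp)
      ⟨u, hau.1, v, hvd, ⟨hu, hau.2⟩, huv'⟩
    exact ⟨S, hST.trans Set.sdiff_subset, hS⟩
  obtain ⟨T₁, T₂, hT, hT₁, hT₂⟩ := exists_disjoint_links hsep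
  obtain ⟨S₁, hST₁, hS₁⟩ := hthick T₁ hT₁
  obtain ⟨S₂, hST₂, hS₂⟩ := hthick T₂ hT₂
  exact ⟨S₁, S₂, hT.mono hST₁ hST₂, hS₁, hS₂⟩

theorem exists_closed_or_disjoint_thick [Finite V] (had : a ≠ d) :
    (∃ (Z : Set V) (z : V), a ∈ Z ∧ d ∉ Z ∧ z ≠ d ∧
      (∀ u ∈ Z, ∀ w, D.Adj u w → w ∈ Z ∨ w = z ∨ u = a ∧ w = d) ∧
      ∀ w ∈ Z, w ≠ a → ∃ u ∈ Z, D.Adj u w) ∨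
    ∃ T₁ T₂, Disjoint T₁ T₂ ∧ Thick D a d T₁ ∧ Thick D a d T₂ := by
  by_cases h : ∀ z, z ≠ d → Reach (deleteArc D a d) {z}ᶜ a d
  · exact Or.inr (exists_disjoint_thick had h)
  push Not at h
  obtain ⟨z, hzd, hz⟩ := h
  refine Or.inl ⟨{v | Reach (deleteArc D a d) {z}ᶜ a v}, z, Reach.refl, hz, hzd, ?_, ?_⟩
  · intro u hu w huw
    by_cases hwz : w = z
    · exact Or.inr (Or.inl hwz)
    · exact (deleteArc_adj_or huw).imp (fun huw' => Reach.tail hu huw' hwz) Or.inr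
  · intro w hw hwa
    cases hw with
    | refl => exact absurd rfl hwa
    | tail hau huw => exact ⟨_, hau, huw.1.1⟩

end Thick

section HasTransitive

variable {V : Type*} {D D' : Digraph V} {T W : Set V} {a b c d u v w : V} {p q : List V}

/-- The arc from `a` to `d` can play the role of the arc from the source to the sink in a subdivided
transitive tournament: besides this arc there are two disjoint thick sets from `a` to `d`, and a
walk joining them. -/
def HasTransitive (D : Digraph V) (a d : V) : Prop :=
  a ≠ d ∧ D.Adj a d ∧ ∃ T₁ T₂, Disjoint T₁ T₂ ∧ Thick D a d T₁ ∧ Thick D a d T₂ ∧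
    ∃ u ∈ T₁, ∃ v ∈ T₂, Reach D {a, d}ᶜ u v

theorem hasModel_transitive_of_split {X Y P₁ Q₁ P₂ Q₂ : Set V} (had : a ≠ d) (hadj : D.Adj a d)
    (hXY : Disjoint X Y) (haX : a ∉ X) (hdX : d ∉ X) (haY : a ∉ Y) (hdY : d ∉ Y)
    (hb : b ∈ X) (hPQ₁ : Disjoint P₁ Q₁) (hbP₁ : b ∉ P₁) (hbQ₁ : b ∉ Q₁) (hP₁ : P₁ ⊆ X)
    (hQ₁ : Q₁ ⊆ X) (hc : c ∈ Y) (hPQ₂ : Disjoint P₂ Q₂) (hcP₂ : c ∉ P₂) (hcQ₂ : c ∉ Q₂)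
    (hP₂ : P₂ ⊆ Y) (hQ₂ : Q₂ ⊆ Y) (hab : Reach D (insert b P₁) a b)
    (hbd : Reach D (insert d Q₁) b d) (hac : Reach D (insert c P₂) a c)
    (hcd : Reach D (insert d Q₂) c d) (hbc : Reach D (insert c ({a, d}ᶜ \ (X ∪ Y))) b c) :
    HasModel D transitiveArcs := by
  set R : Set V := {a, d}ᶜ \ (X ∪ Y)
  have hXR : Disjoint X R := Set.disjoint_left.mpr fun x hx hxR => hxR.2 (Or.inl hx)
  have hYR : Disjoint Y R := Set.disjoint_left.mpr fun x hx hxR => hxR.2 (Or.inr hx)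
  have hR : a ∉ R ∧ d ∉ R ∧ b ∉ R ∧ c ∉ R := by grind
  have hbY : b ∉ Y := Set.disjoint_left.mp hXY hb
  have hcX : c ∉ X := Set.disjoint_right.mp hXY hc
  refine ⟨![a, b, c, d], ?_, ![P₁, P₂, ∅, R, Q₁, Q₂], (pairwise_disjoint_on _).mpr ?_, ?_, ?_⟩
  · exact List.nodup_ofFn.mp (by simp; grind)
  · intro i j hij
    fin_cases i <;> fin_cases j <;> first
      | exact absurd hij (by decide)
      | exact Set.disjoint_empty _
      | exact Set.empty_disjoint _
      | exact hPQ₁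
      | exact hPQ₂
      | exact hXY.mono ‹_› ‹_›
      | exact hXR.mono_left ‹_›
      | exact hYR.mono_left ‹_›
      | exact (hXR.mono_left ‹_›).symm
      | exact (hYR.mono_left ‹_›).symm
      | exact (hXY.mono ‹_› ‹_›).symm
  · intro i k
    fin_cases i <;> fin_cases k <;> first
      | exact Set.notMem_empty _
      | assumption
      | exact hR.1
      | exact hR.2.1
      | exact hR.2.2.1
      | exact hR.2.2.2
      | exact Set.notMem_subset ‹_› ‹_›
  · intro i
    fin_cases i
    exacts [hab, hac, Reach.of_adj_insert hadj, hbc, hbd, hcd]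

theorem hasModel_transitive_of_isDirPath (had : a ≠ d) (hadj : D.Adj a d)
    (hp : D.IsDirPath p a d) (hq : D.IsDirPath q a d)
    (hpq : ∀ x ∈ p, x ∈ q → x = a ∨ x = d) (hu : u ∈ p) (hua : u ≠ a) (hud : u ≠ d)
    (hv : v ∈ q) (hva : v ≠ a) (hvd : v ≠ d) (huv : Reach D {a, d}ᶜ u v) :
    HasModel D transitiveArcs := by
  set X : Set V := {x | x ∈ p ∧ x ≠ a ∧ x ≠ d}
  set Y : Set V := {x | x ∈ q ∧ x ≠ a ∧ x ≠ d}
  have hXY : Disjoint X Y := Set.disjoint_left.mpr fun x hx hx' =>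
    (hpq x hx.1 hx'.1).elim hx.2.1 hx.2.2
  obtain ⟨b, hb, c, hc, -, hbc⟩ := huv.exists_crossing (A := X) (B := Y) ⟨hu, hua, hud⟩
    ⟨hv, hva, hvd⟩ hXY
  obtain ⟨P₁, Q₁, hPQ₁, hbP₁, hbQ₁, hP₁, hQ₁, hab, hbd⟩ := exists_split_of_isDirPath hp hb.1
  obtain ⟨P₂, Q₂, hPQ₂, hcP₂, hcQ₂, hP₂, hQ₂, hac, hcd⟩ := exists_split_of_isDirPath hq hc.1
  exact hasModel_transitive_of_split had hadj hXY (fun h => h.2.1 rfl) (fun h => h.2.2 rfl)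
    (fun h => h.2.1 rfl) (fun h => h.2.2 rfl) hb hPQ₁ hbP₁ hbQ₁ hP₁ hQ₁ hc hPQ₂ hcP₂ hcQ₂ hP₂ hQ₂
    hab hbd hac hcd hbc

theorem HasTransitive.hasModel (h : HasTransitive D a d) : HasModel D transitiveArcs := by
  obtain ⟨had, hadj, T₁, T₂, hT, hT₁, hT₂, u, hu, v, hv, huv⟩ := h
  obtain ⟨p, hp, hpT, w₁, hw₁p, hw₁, hw₁u⟩ := hT₁.exists_isDirPath_first had hu
  obtain ⟨q, hq, hqT, w₂, hw₂q, hw₂, hvw₂⟩ := hT₂.exists_isDirPath_last had hv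
  refine hasModel_transitive_of_isDirPath had hadj hp hq ?_ hw₁p ?_ ?_ hw₂q ?_ ?_
    ((hw₁u.mono ?_).trans (huv.trans (hvw₂.mono ?_)))
  · intro x hxp hxq
    by_contra! hx
    exact Set.disjoint_left.mp hT (hpT x hxp hx.1 hx.2) (hqT x hxq hx.1 hx.2)
  all_goals grind [Thick]

theorem HasTransitive.mono (h : HasTransitive D' a d) (hD : D' ≤ D) : HasTransitive D a d := by
  obtain ⟨had, hadj, T₁, T₂, hT, hT₁, hT₂, u, hu, v, hv, huv⟩ := h
  exact ⟨had, hD hadj, T₁, T₂, hT, hT₁.mono_adj hD, hT₂.mono_adj hD, u, hu, v, hv,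
    huv.mono_adj subset_rfl hD⟩

/-- Away from arcs leaving `d` or entering `a`, every arc of `D'` that is not an arc of `D` stands
for a walk of `D` through `W`, and has an end in `W` (other than the head `d`). This is the
situation when `D'` is obtained from `D` by contracting or shortcutting inside `W`. -/
def ArcsLift (D' D : Digraph V) (W : Set V) (a d : V) : Prop :=
  ∀ x y, x ≠ d → y ≠ a → D'.Adj x y → D.Adj x y ∨
    (x ∈ W ∨ y ∈ W ∧ y ≠ d) ∧ Reach D (insert y (W \ {d})) x y

theorem Thick.exists_expand (hT : Thick D' a d T) (hlift : ArcsLift D' D W a d) (had : a ≠ d)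
    (haW : a ∉ W) (hw : w ∈ T) :
    ∃ S, w ∈ S ∧ (∀ x ∈ S, x ∉ T → x ∈ W ∧ (T ∩ W).Nonempty) ∧ Thick D a d S := by
  set E : Set V := {x | x ∈ T ∨ x ∈ W \ {d} ∧ (T ∩ W).Nonempty}
  have hTE : T ⊆ E := fun x hx => Or.inl hx
  have hWE : ∀ x ∈ T, x ∈ W → W \ {d} ⊆ E := fun x hx hxW y hy => Or.inr ⟨hy, x, hx, hxW⟩
  have hstep : ∀ x ∈ insert a T, ∀ y ∈ T, D'.Adj x y → Reach D E x y := by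
    intro x hx y hy hxy
    have hxd : x ≠ d := by rintro rfl; exact hx.elim had.symm hT.finish
    rcases hlift x y hxd (fun h => hT.start (h ▸ hy)) hxy with hadj | ⟨hW, hreach⟩
    · exact Reach.of_adj hadj (hTE hy)
    · refine hreach.mono (Set.insert_subset (hTE hy) ?_)
      rcases hW with hxW | hyW
      · exact hWE x (hx.resolve_left fun h => haW (h ▸ hxW)) hxW
      · exact hWE y hy hyW.1
  have haw : Reach D E a w := ((hT.from_start w hw).simulate (Set.mem_insert a T)
    fun x hx y hy hxy => ⟨Or.inr hy, hstep x hx y hy hxy⟩).2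
  have hwd : Reach D (insert d E) w d := by
    obtain ⟨x, hx, hxd, hwx⟩ := hT.exists_last hw
    have hwx' : Reach D E w x :=
      (hwx.simulate hw fun x hx y hy hxy => ⟨hy, hstep x (Or.inr hx) y hy hxy⟩).2
    refine (hwx'.mono (Set.subset_insert d E)).trans ?_
    rcases hlift x d (fun h => hT.finish (h ▸ hx)) had.symm hxd with hadj | ⟨hW, hreach⟩
    · exact Reach.of_adj_insert hadj
    · exact hreach.mono (Set.insert_subset_insert (hWE x hx (hW.resolve_right fun h => h.2 rfl)))
  obtain ⟨S, hSE, hwS, hS⟩ := exists_thick (fun h => h.elim hT.start fun h => haW h.1.1)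
    (fun h => h.elim hT.finish fun h => h.1.2 rfl) (hTE hw) haw hwd
  exact ⟨S, hwS, fun x hx hxT => ((hSE hx).resolve_left hxT).imp_left And.left, hS⟩

theorem HasTransitive.lift (h : HasTransitive D' a d) (hadj : D.Adj a d) (haW : a ∉ W)
    (hW : ∀ T₁ T₂, Disjoint T₁ T₂ → Thick D' a d T₁ → Thick D' a d T₂ →
      (T₁ ∩ W).Nonempty → ¬ (T₂ ∩ W).Nonempty)
    (hlift : ArcsLift D' D W a d) : HasTransitive D a d := by
  obtain ⟨had, -, T₁, T₂, hT, hT₁, hT₂, u, hu, v, hv, huv⟩ := h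
  obtain ⟨S₁, huS, hST₁, hS₁⟩ := hT₁.exists_expand hlift had haW hu
  obtain ⟨S₂, hvS, hST₂, hS₂⟩ := hT₂.exists_expand hlift had haW hv
  have hnot := hW T₁ T₂ hT hT₁ hT₂
  refine ⟨had, hadj, S₁, S₂, ?_, hS₁, hS₂, u, huS, v, hvS, ?_⟩
  · refine Set.disjoint_left.mpr fun x hx₁ hx₂ => ?_
    by_cases hxT₁ : x ∈ T₁
    · obtain ⟨hxW, hne⟩ := hST₂ x hx₂ (Set.disjoint_left.mp hT hxT₁)
      exact hnot ⟨x, hxT₁, hxW⟩ hne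
    · obtain ⟨hxW, hne⟩ := hST₁ x hx₁ hxT₁
      exact hnot hne ((em (x ∈ T₂)).elim (fun hxT₂ => ⟨x, hxT₂, hxW⟩) fun h => (hST₂ x hx₂ h).2)
  · refine (huv.simulate (A := {a, d}ᶜ) (by grind [Thick]) fun x hx y hy hxy => ⟨hy, ?_⟩).2
    rcases hlift x y (fun h => hx (Or.inr h)) (fun h => hy (Or.inl h)) hxy with hadj | ⟨-, hreach⟩
    · exact Reach.of_adj hadj hy
    · exact hreach.mono (Set.insert_subset hy (by grind))

end HasTransitive

section Separator

variable {V : Type*} {D : Digraph V} {T T₁ T₂ U : Set V} {a d o u v w : V}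

theorem Thick.subset_compl (h : Thick D a d T) : T ⊆ {a, d}ᶜ := by
  rintro x hx (rfl | rfl)
  exacts [h.start hx, h.finish hx]

theorem Thick.exists_adj (h : Thick D a d T) (hw : w ∈ T) : ∃ u, D.Adj u w := by
  rcases Relation.ReflTransGen.cases_tail (h.from_start w hw) with hwa | ⟨u, -, huw⟩
  · exact absurd (hwa ▸ hw) h.start
  · exact ⟨u, huw.1⟩

theorem HasTransitive.of_reach_common (had : a ≠ d) (hadj : D.Adj a d) (hT : Disjoint T₁ T₂)
    (hT₁ : Thick D a d T₁) (hT₂ : Thick D a d T₂) (hu : u ∈ T₁) (huo : Reach D {a, d}ᶜ u o)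
    (hv : v ∈ T₂) (hvo : Reach D {a, d}ᶜ v o) (hod : Reach D {a}ᶜ o d) : HasTransitive D a d := by
  set R : Set V := {w | ∃ u ∈ T₁, Reach D {a, d}ᶜ u w}
  have hTR : T₁ ⊆ R := fun w hw => ⟨w, hw, Reach.refl⟩
  have hR : R ⊆ {a, d}ᶜ := by
    rintro w ⟨u, hu, huw⟩
    exact huw.mem_of_mem (hT₁.subset_compl hu)
  have hstay : ∀ w ∈ R, ∀ x, Reach D {a, d}ᶜ w x → Reach D R w x := by
    rintro w ⟨t, ht, htw⟩ x hwx
    exact hwx.of_between fun y _ hwy _ => ⟨t, ht, htw.trans hwy⟩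
  by_cases hRT : Disjoint R T₂
  · have hoR : o ∈ R := ⟨u, hu, huo⟩
    obtain ⟨x, hox, c, hc, -, hxd⟩ := hod.exists_first_entry (B := {d})
      (fun hod => hR hoR (Or.inr hod)) rfl
    obtain rfl : d = c := hc.symm
    have hox' : Reach D R o x := hstay o hoR x (hox.mono (by grind))
    obtain ⟨S, hSR, hoS, hS⟩ := exists_thick (fun h => hR h (Or.inl rfl))
      (fun h => hR h (Or.inr rfl)) hoR
      (((hT₁.from_start u hu).mono hTR).trans (hstay u (hTR hu) o huo))
      ((hox'.mono (Set.subset_insert _ _)).tail hxd (Set.mem_insert _ _))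
    exact ⟨had, hadj, T₂, S, hRT.symm.mono_right hSR, hT₂, hS, v, hv, o, hoS, hvo⟩
  · obtain ⟨w, ⟨u, hu, huw⟩, hw⟩ := Set.not_disjoint_iff.mp hRT
    exact ⟨had, hadj, T₁, T₂, hT, hT₁, hT₂, u, hu, w, hw, huw⟩

theorem Thick.exists_reach_of_forall_not_closed (hT : Thick D a d T)
    (hU : ∀ u w, D.Adj u w → w ∈ U)
    (hclosed : ∀ X ⊆ U, X.Nonempty → a ∉ X → d ∉ X → o ∉ X →
      ¬ ∀ u ∈ X, ∀ w, D.Adj u w → w ∈ X ∨ w = a ∨ w = d) :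
    ∃ u ∈ T, Reach D {a, d}ᶜ u o := by
  by_contra ho
  set X : Set V := {w | ∃ u ∈ T, Reach D {a, d}ᶜ u w}
  have hX : X ⊆ {a, d}ᶜ := by
    rintro w ⟨u, hu, huw⟩
    exact huw.mem_of_mem (hT.subset_compl hu)
  have hXU : X ⊆ U := by
    rintro w ⟨u, hu, huw⟩
    cases huw with
    | refl => exact (hT.exists_adj hu).elim fun x hx => hU x w hx
    | tail _ hstep => exact hU _ w hstep.1
  obtain ⟨w, hw⟩ := hT.nonempty
  refine hclosed X hXU ⟨w, w, hw, Reach.refl⟩ (fun h => hX h (Or.inl rfl))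
    (fun h => hX h (Or.inr rfl)) ho ?_
  rintro u ⟨t, ht, htu⟩ w huw
  by_cases hw : w ∈ ({a, d} : Set V)
  · exact Or.inr hw
  · exact Or.inl ⟨t, ht, htu.tail huw hw⟩

theorem exists_separator [Finite V] (hn : ¬ HasTransitive D a d) (had : a ≠ d) (hadj : D.Adj a d)
    (hU : ∀ u w, D.Adj u w → w ∈ U)
    (hclosed : ∀ X ⊆ U, X.Nonempty → a ∉ X → d ∉ X → o ∉ X →
      ¬ ∀ u ∈ X, ∀ w, D.Adj u w → w ∈ X ∨ w = a ∨ w = d)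
    (hod : Reach D {a}ᶜ o d) :
    ∃ (Z : Set V) (z : V), a ∈ Z ∧ d ∉ Z ∧ z ≠ d ∧
      (∀ u ∈ Z, ∀ w, D.Adj u w → w ∈ Z ∨ w = z ∨ u = a ∧ w = d) ∧
      ∀ w ∈ Z, w ≠ a → ∃ u ∈ Z, D.Adj u w := by
  rcases exists_closed_or_disjoint_thick (D := D) had with h | ⟨T₁, T₂, hT, hT₁, hT₂⟩
  · exact h
  obtain ⟨u, hu, huo⟩ := hT₁.exists_reach_of_forall_not_closed hU hclosed
  obtain ⟨v, hv, hvo⟩ := hT₂.exists_reach_of_forall_not_closed hU hclosed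
  exact absurd (.of_reach_common had hadj hT hT₁ hT₂ hu huo hv hvo hod) hn

end Separator

section Contraction

variable {V : Type*} {D : Digraph V} {R X : Set V} {a d p q s t u w x y : V}

/-- A digraph on `R ∪ {p, q}` in which the vertices of `R` have out-degree at least three, while
`p` and `q` have a single out-neighbour each, `q` and `x`. -/
structure Config (D : Digraph V) (R : Set V) (p q x : V) : Prop where
  ne : p ≠ q
  p_notMem : p ∉ R
  q_notMem : q ∉ R
  x_mem : x ∈ R
  adj_p : ∀ w, D.Adj p w ↔ w = q
  adj_q : ∀ w, D.Adj q w ↔ w = x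
  tail : ∀ u w, D.Adj u w → u ∈ R ∨ u = p ∨ u = q
  head : ∀ u w, D.Adj u w → w ∈ R ∨ w = p ∨ w = q
  loopless : ∀ u ∈ R, ¬ D.Adj u u
  three : ∀ u ∈ R, ThreeOut D u

/-- At least three vertices of `X` have an arc to `s`. -/
def ThreeIn (D : Digraph V) (X : Set V) (s : V) : Prop :=
  ∃ u ∈ X, ∃ v ∈ X, ∃ w ∈ X, u ≠ v ∧ u ≠ w ∧ v ≠ w ∧ D.Adj u s ∧ D.Adj v s ∧ D.Adj w s

/-- The digraph obtained from `D` by contracting the outside of `X` to the path from `s` to `t`,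
followed by the arc from `t` to `y`. -/
def contract (D : Digraph V) (X : Set V) (s t y : V) : Digraph V :=
  ⟨fun u w => u ∈ X ∧ D.Adj u w ∨ u = s ∧ w = t ∨ u = t ∧ w = y⟩

theorem contract_adj_of_mem (hs : s ∉ X) (ht : t ∉ X) (hu : u ∈ X) :
    (contract D X s t y).Adj u w ↔ D.Adj u w := by
  grind [contract]

theorem contract_config (h3 : ∀ u ∈ X, ThreeOut D u) (hl : ∀ u ∈ X, ¬ D.Adj u u) (hst : s ≠ t)
    (hs : s ∉ X) (ht : t ∉ X) (hout : ∀ u ∈ X, ∀ w, D.Adj u w → w ∈ X ∨ w = s ∨ w = t)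
    (hy : y ∈ X) : Config (contract D X s t y) X s t y where
  ne := hst
  p_notMem := hs
  q_notMem := ht
  x_mem := hy
  adj_p w := by grind [contract]
  adj_q w := by grind [contract]
  tail u w h := by grind [contract]
  head u w h := by grind [contract]
  loopless u hu h := hl u hu ((contract_adj_of_mem hs ht hu).mp h)
  three u hu v w :=
    (h3 u hu v w).imp fun z hz => ⟨(contract_adj_of_mem hs ht hu).mpr hz.1, hz.2⟩

theorem HasTransitive.exists_adj_source (h : HasTransitive D a d) : ∃ w, D.Adj a w ∧ w ≠ d := by
  obtain ⟨-, -, T, -, -, hT, -⟩ := h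
  obtain ⟨u, hu⟩ := hT.nonempty
  obtain ⟨w, hw, haw, -⟩ := hT.exists_first hu
  exact ⟨w, haw, fun hwd => hT.finish (hwd ▸ hw)⟩

theorem HasTransitive.exists_adj_sink (h : HasTransitive D a d) :
    ∃ v w, v ≠ w ∧ v ≠ a ∧ w ≠ a ∧ D.Adj v d ∧ D.Adj w d := by
  obtain ⟨-, -, T₁, T₂, hT, hT₁, hT₂, u₁, hu₁, u₂, hu₂, -⟩ := h
  obtain ⟨v, hv, hvd, -⟩ := hT₁.exists_last hu₁
  obtain ⟨w, hw, hwd, -⟩ := hT₂.exists_last hu₂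
  exact ⟨v, w, fun hvw => Set.disjoint_left.mp hT hv (hvw ▸ hw), fun hva => hT₁.start (hva ▸ hv),
    fun hwa => hT₂.start (hwa ▸ hw), hvd, hwd⟩

namespace Config

theorem source_mem (h : Config D R p q x) (had : HasTransitive D a d) : a ∈ R := by
  obtain ⟨w, haw, hwd⟩ := had.exists_adj_source
  grind [Config, had.2.1]

theorem threeIn_of_hasTransitive (h : Config D R p q x) (had : HasTransitive D a p) :
    ThreeIn D R p := by
  obtain ⟨v, w, hvw, hva, hwa, hv, hw⟩ := had.exists_adj_sink
  have hmem : ∀ u, D.Adj u p → u ∈ R := by grind [Config]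
  exact ⟨a, hmem a had.2.1, v, hmem v hv, w, hmem w hw, hva.symm, hwa.symm, hvw, had.2.1, hv, hw⟩

theorem q_mem_or_of_thick {T : Set V} (h : Config D R p q x) (hT : Thick D a d T)
    (hTR : (T ∩ Rᶜ).Nonempty) : q ∈ T ∨ p ∈ T ∧ q = d := by
  obtain ⟨w, hwT, hwR⟩ := hTR
  obtain ⟨u, huw⟩ := hT.exists_adj hwT
  obtain ⟨v, hvT, hwv, -⟩ := (hT.to_finish w hwT).eq_or_head.resolve_left
    fun hwd => hT.finish (hwd ▸ hwT)
  grind [Config]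

theorem not_thick_of_thick {T₁ T₂ : Set V} (h : Config D R p q x) (hT : Disjoint T₁ T₂)
    (hT₁ : Thick D a d T₁) (hT₂ : Thick D a d T₂) (hTR : (T₁ ∩ Rᶜ).Nonempty) :
    ¬ (T₂ ∩ Rᶜ).Nonempty := fun hTR₂ => by
  have h₁ := h.q_mem_or_of_thick hT₁ hTR
  have h₂ := h.q_mem_or_of_thick hT₂ hTR₂
  grind [Thick]

end Config

theorem contract_arcsLift (h : Config (contract D X s t y) X s t y)
    (hst : Reach D Xᶜ s t)
    (hd : d ∈ X ∨ d = s ∨ d = t) (hty : Reach D (insert y (Xᶜ \ {d})) t y ∨ d = t) :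
    ArcsLift (contract D X s t y) D Xᶜ a d := by
  intro u w hud _ huw
  rcases h.tail u w huw with hu | rfl | rfl
  · exact Or.inl ((contract_adj_of_mem h.p_notMem h.q_notMem hu).mp huw)
  · obtain rfl := (h.adj_p w).mp huw
    exact Or.inr ⟨Or.inl h.p_notMem, hst.mono (by grind)⟩
  · obtain rfl := (h.adj_q w).mp huw
    exact Or.inr ⟨Or.inl h.q_notMem, hty.resolve_right hud.symm⟩

theorem exists_hasTransitive_of_contract (h : Config (contract D X s t y) X s t y)
    (hhas : HasTransitive (contract D X s t y) a d) (hst : Reach D Xᶜ s t)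
    (hty : Reach D (insert y (Xᶜ \ {s})) t y ∨ Reach D (insert y Xᶜ) t y ∧ ¬ ThreeIn D X s) :
    a ∈ X ∧ (d ∈ X ∨ d = s ∨ d = t) ∧ HasTransitive D a d ∧ (d = s → ThreeIn D X s) := by
  have hadj : ∀ u ∈ X, ∀ w, (contract D X s t y).Adj u w → D.Adj u w := fun u hu w =>
    (contract_adj_of_mem h.p_notMem h.q_notMem hu).mp
  have haX : a ∈ X := h.source_mem hhas
  have hd : d ∈ X ∨ d = s ∨ d = t := h.head a d hhas.2.1
  have hds : d = s → ThreeIn D X s := by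
    rintro rfl
    have := h.threeIn_of_hasTransitive hhas
    grind [ThreeIn]
  have hty' : Reach D (insert y (Xᶜ \ {d})) t y ∨ d = t := by
    rcases hd with hdX | rfl | hdt
    · left
      rcases hty with hty | hty
      · exact hty.mono (by grind)
      · exact hty.1.mono (by grind)
    · exact Or.inl (hty.resolve_right fun hty => hty.2 (hds rfl))
    · exact Or.inr hdt
  exact ⟨haX, hd, hhas.lift (hadj a haX d hhas.2.1) (Set.notMem_compl_iff.mpr haX)
    (fun T₁ T₂ hT hT₁ hT₂ => h.not_thick_of_thick hT hT₁ hT₂)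
    (contract_arcsLift h hst hd hty'), hds⟩

end Contraction

section MinConfig

variable {V : Type*} {D : Digraph V} {K R S X : Set V} {p q s t u v x y z : V}

/-- A configuration with as few vertices of out-degree at least three as possible among those
containing no subdivided transitive tournament. -/
structure MinConfig (D : Digraph V) (R : Set V) (p q x : V) : Prop extends Config D R p q x where
  not_hasTransitive : ∀ a d, ¬ HasTransitive D a d
  minimal : ∀ (D' : Digraph V) X p q x, Config D' X p q x → X.ncard < R.ncard →
    ∃ a d, HasTransitive D' a d

theorem Config.mem_of_reach (h : Config D R p q x) (hu : u ∈ R ∨ u = p ∨ u = q)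
    (huv : Reach D S u v) : v ∈ R ∨ v = p ∨ v = q := by
  cases huv with
  | refl => exact hu
  | tail _ hstep => exact h.head _ v hstep.1

namespace MinConfig

theorem false_of_contract [Finite V] (h : MinConfig D R p q x) (hXR : X ⊂ R) (hst : s ≠ t)
    (hs : s ∉ X) (ht : t ∉ X) (hout : ∀ u ∈ X, ∀ w, D.Adj u w → w ∈ X ∨ w = s ∨ w = t)
    (hreach : Reach D Xᶜ s t) (hy : y ∈ X) (hty : Reach D (insert y (Xᶜ \ {s})) t y) : False := by
  have hconfig := contract_config (fun u hu => h.three u (hXR.1 hu))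
    (fun u hu => h.loopless u (hXR.1 hu)) hst hs ht hout hy
  obtain ⟨a, d, hhas⟩ := h.minimal _ X s t y hconfig (Set.ncard_lt_ncard hXR)
  exact h.not_hasTransitive a d
    (exists_hasTransitive_of_contract hconfig hhas hreach (Or.inl hty)).2.2.1

theorem not_closed [Finite V] (h : MinConfig D R p q x) (hXR : X ⊆ R) (hX : X.Nonempty)
    (hout : ∀ u ∈ X, ∀ w, D.Adj u w → w ∈ X) : False := by
  obtain ⟨u, hu⟩ := hX
  obtain ⟨v, huv, hvu, -⟩ := h.three u (hXR hu) u u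
  have hv : v ∈ X := hout u hu v huv
  obtain ⟨y, hvy, hyu, hyv⟩ := h.three v (hXR hv) u v
  exact h.false_of_contract (X := X \ {u, v}) (s := u) (t := v) (y := y) (by grind) hvu.symm
    (by simp) (by simp) (by grind) (Reach.of_adj huv (by simp)) (by grind) (Reach.of_adj_insert hvy)

theorem p_mem_of_closed [Finite V] (h : MinConfig D R p q x) (hK : ∀ u ∈ K, u ∈ R ∨ u = p ∨ u = q)
    (hout : ∀ u ∈ K, ∀ w, D.Adj u w → w ∈ K) (hq : q ∈ K) : p ∈ K := by
  by_contra hp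
  have hqx : D.Adj q x := (h.adj_q x).mpr rfl
  have hx : x ∈ K := hout q hq x hqx
  have hqR : q ∉ R := h.q_notMem
  by_cases hu : ∃ u ∈ K ∩ R, D.Adj u q
  · obtain ⟨u, ⟨huK, huR⟩, huq⟩ := hu
    have hqu : q ≠ u := fun hqu => hqR (hqu ▸ huR)
    have hout' : ∀ a ∈ (K ∩ R) \ {u}, ∀ w, D.Adj a w → w ∈ (K ∩ R) \ {u} ∨ w = u ∨ w = q := by
      grind
    rcases eq_or_ne x u with rfl | hxu
    · obtain ⟨y, hxy, hyq, hyx⟩ := h.three x huR q x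
      exact h.false_of_contract (X := (K ∩ R) \ {x}) (s := q) (t := x) (y := y) (by grind) hqu
        (by grind) (by simp) (by grind) (Reach.of_adj hqx (by simp)) (by grind)
        (Reach.of_adj_insert hxy)
    · exact h.false_of_contract (X := (K ∩ R) \ {u}) (s := u) (t := q) (y := x) (by grind) hqu.symm
        (by simp) (by grind) hout' (Reach.of_adj huq (by grind)) ⟨⟨hx, h.x_mem⟩, hxu⟩
        (Reach.of_adj_insert hqx)
  · exact h.not_closed (X := K ∩ R) Set.inter_subset_right ⟨x, hx, h.x_mem⟩ (by grind)

theorem mem_of_closed [Finite V] (h : MinConfig D R p q x)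
    (hK : ∀ u ∈ K, u ∈ R ∨ u = p ∨ u = q) (hKn : K.Nonempty)
    (hout : ∀ u ∈ K, ∀ w, D.Adj u w → w ∈ K) : p ∈ K ∧ q ∈ K ∧ R ⊆ K := by
  have hpq : D.Adj p q := (h.adj_p q).mpr rfl
  have hqx : D.Adj q x := (h.adj_q x).mpr rfl
  have hq : q ∈ K := by
    by_contra hq
    exact h.not_closed (X := K) (by grind) hKn hout
  have hp : p ∈ K := h.p_mem_of_closed hK hout hq
  refine ⟨hp, hq, ?_⟩
  by_contra hR
  have hpR : p ∉ R := h.p_notMem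
  have hqR : q ∉ R := h.q_notMem
  exact h.false_of_contract (X := K ∩ R) (s := p) (t := q) (y := x)
    (Set.inter_subset_right.ssubset_of_ne fun e => hR (Set.inter_eq_right.mp e)) h.ne
    (by grind) (by grind) (by grind) (Reach.of_adj hpq (by grind)) ⟨hout q hq x hqx, h.x_mem⟩
    (Reach.of_adj_insert hqx)

theorem reach [Finite V] (h : MinConfig D R p q x) (hu : u ∈ R ∨ u = p ∨ u = q) (hy : y ∈ R) :
    Reach D Set.univ u y :=
  (h.mem_of_closed (K := {w | Reach D Set.univ u w}) (fun _ hw => h.mem_of_reach hu hw)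
    ⟨u, Reach.refl⟩ fun _ ha w haw => Reach.tail ha haw (Set.mem_univ w)).2.2 hy

theorem exists_first_entry [Finite V] (h : MinConfig D R p q x) (hu : u ∈ R ∨ u = p ∨ u = q)
    (hX : X.Nonempty) (hXR : X ⊆ R) (huX : u ∉ X) :
    ∃ w, Reach D Xᶜ u w ∧ ∃ y ∈ X, D.Adj w y := by
  obtain ⟨y, hy⟩ := hX
  obtain ⟨w, huw, c, hc, -, hwc⟩ := (h.reach hu (hXR hy)).exists_first_entry huX hy
  exact ⟨w, huw.mono fun z hz => hz.2, c, hc, hwc⟩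

theorem not_out_one [Finite V] (h : MinConfig D R p q x) (hXR : X ⊆ R) (hX : X.Nonempty)
    (hout : ∀ u ∈ X, ∀ w, D.Adj u w → w ∈ X ∨ w = z) : False := by
  by_cases hz : (z ∈ R ∨ z = p ∨ z = q) ∧ z ∉ X
  · obtain ⟨w, hzw, y, hy, hwy⟩ := h.exists_first_entry hz.1 hX hXR hz.2
    obtain ⟨c, hyc, hcz, hcy⟩ := h.three y (hXR hy) z y
    exact h.false_of_contract (X := X \ {y}) (s := z) (t := y) (y := c) (by grind) (by grind)
      (by grind) (by simp) (by grind)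
      ((hzw.mono (by grind)).tail hwy (by simp)) (by grind) (Reach.of_adj_insert hyc)
  · exact h.not_closed hXR hX fun u hu w huw => by grind [h.head u w huw]

theorem not_exists_return [Finite V] (h : MinConfig D R p q x) (hXR : X ⊂ R) (hst : s ≠ t)
    (hs : s ∉ X) (ht : t ∉ X) (hout : ∀ u ∈ X, ∀ w, D.Adj u w → w ∈ X ∨ w = s ∨ w = t)
    (hreach : Reach D Xᶜ s t) : ¬ ∃ w, Reach D (Xᶜ \ {s}) t w ∧ ∃ y ∈ X, D.Adj w y := by
  rintro ⟨w, htw, y, hy, hwy⟩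
  exact h.false_of_contract hXR hst hs ht hout hreach hy
    ((htw.mono (Set.subset_insert _ _)).tail hwy (Set.mem_insert _ _))

theorem not_out_two_of_notMem [Finite V] (h : MinConfig D R p q x) (hXR : X ⊂ R)
    (hX : X.Nonempty) (hst : s ≠ t) (hs : s ∉ X) (ht : t ∉ X)
    (hout : ∀ u ∈ X, ∀ w, D.Adj u w → w ∈ X ∨ w = s ∨ w = t) (hreach : Reach D Xᶜ s t) :
    False := by
  have hsD : s ∈ R ∨ s = p ∨ s = q := by
    obtain ⟨w, -, hsw, -⟩ := hreach.eq_or_head.resolve_left hst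
    exact h.tail s w hsw
  have htD : t ∈ R ∨ t = p ∨ t = q := h.mem_of_reach hsD hreach
  have ht_return := h.not_exists_return hXR hst hs ht hout hreach
  have hts : Reach D Xᶜ t s := by
    obtain ⟨w, htw, y, hy, hwy⟩ := h.exists_first_entry htD hX hXR.1 ht
    by_contra hts
    exact ht_return ⟨w, htw.of_between fun c hc htc _ => ⟨hc, by rintro rfl; exact hts htc⟩, y, hy,
      hwy⟩
  have hs_return := h.not_exists_return hXR hst.symm ht hs
    (fun u hu w huw => (hout u hu w huw).imp_right Or.symm) hts
  obtain ⟨y, hy⟩ := hX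
  have hmem : y ∈ {w | w ∉ X ∧ (Reach D (Xᶜ \ {s}) t w ∨ Reach D (Xᶜ \ {t}) s w)} := by
    refine (h.reach hsD (hXR.1 hy)).mem_of_closed ⟨hs, Or.inr Reach.refl⟩ ?_
    rintro a ⟨ha, hta | hsa⟩ b - hab
    · have hb : b ∉ X := fun hb => ht_return ⟨a, hta, b, hb, hab⟩
      refine ⟨hb, (eq_or_ne b s).elim (fun hbs => Or.inr (hbs ▸ Reach.refl)) fun hbs => ?_⟩
      exact Or.inl (hta.tail hab ⟨hb, hbs⟩)
    · have hb : b ∉ X := fun hb => hs_return ⟨a, hsa, b, hb, hab⟩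
      refine ⟨hb, (eq_or_ne b t).elim (fun hbt => Or.inl (hbt ▸ Reach.refl)) fun hbt => ?_⟩
      exact Or.inr (hsa.tail hab ⟨hb, hbt⟩)
  exact hmem.1 hy

theorem not_out_two [Finite V] (h : MinConfig D R p q x) (hXR : X ⊂ R) (hX : X.Nonempty)
    (hout : ∀ u ∈ X, ∀ w, D.Adj u w → w ∈ X ∨ w = s ∨ w = t) (hreach : Reach D Xᶜ s t) :
    False := by
  by_cases hs : s ∈ X
  · exact h.not_out_one (z := t) hXR.1 hX (by grind)
  by_cases ht : t ∈ X
  · exact h.not_out_one (z := s) hXR.1 hX (by grind)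
  rcases eq_or_ne s t with rfl | hst
  · exact h.not_out_one (z := s) hXR.1 hX (by grind)
  · exact h.not_out_two_of_notMem hXR hX hst hs ht hout hreach

theorem not_out_q [Finite V] (h : MinConfig D R p q x) (hXR : X ⊂ R) (hX : X.Nonempty)
    (hout : ∀ u ∈ X, ∀ w, D.Adj u w → w ∈ X ∨ w = z ∨ w = q) : False := by
  by_cases hzq : Reach D Xᶜ z q
  · exact h.not_out_two hXR hX hout hzq
  have hpq : Reach D Xᶜ p q := Reach.of_adj ((h.adj_p q).mpr rfl) fun hq => h.q_notMem (hXR.1 hq)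
  by_cases hz : z ∈ R
  · have hU : ∀ w, Reach D Xᶜ z w → w ∈ R := fun w hzw => by
      refine (h.mem_of_reach (Or.inl hz) hzw).resolve_right ?_
      rintro (rfl | rfl)
      exacts [hzq (hzw.trans hpq), hzq hzw]
    refine h.not_out_one (X := X ∪ {w | Reach D Xᶜ z w}) (z := q) (Set.union_subset hXR.1 hU)
      hX.inl ?_
    rintro u (hu | hu) w huw
    · rcases hout u hu w huw with hw | rfl | hw
      exacts [Or.inl (Or.inl hw), Or.inl (Or.inr Reach.refl), Or.inr hw]
    · by_cases hw : w ∈ X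
      · exact Or.inl (Or.inl hw)
      · exact Or.inl (Or.inr (Reach.tail hu huw hw))
  · refine h.not_out_one (z := q) hXR.1 hX fun u hu w huw => ?_
    rcases hout u hu w huw with hw | rfl | hw
    · exact Or.inl hw
    · refine Or.inr (((h.head u w huw).resolve_left hz).resolve_left ?_)
      rintro rfl
      exact hzq hpq
    · exact Or.inr hw

end MinConfig

end MinConfig

section MinConfigArcs

variable {V : Type*} {D : Digraph V} {R Z Z₁ Z₂ : Set V}
  {a b c p q s u w x z z₁ z₂ : V}

namespace MinConfig

theorem exists_adj_q [Finite V] (h : MinConfig D R p q x) : ∃ s ∈ R, D.Adj s q := by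
  by_contra hq
  refine h.not_out_one (X := R) (z := p) subset_rfl ⟨x, h.x_mem⟩ fun u hu w huw => ?_
  rcases h.head u w huw with hw | hw | rfl
  exacts [Or.inl hw, Or.inr hw, absurd ⟨u, hu, huw⟩ hq]

theorem adj_q_unique [Finite V] (h : MinConfig D R p q x) (ha : a ∈ R) (haq : D.Adj a q)
    (hb : b ∈ R) (hbq : D.Adj b q) : b = a := by
  have haq' : a ≠ q := fun e => h.q_notMem (e ▸ ha)
  have hap : a ≠ p := fun e => h.p_notMem (e ▸ ha)
  have hpq : D.Adj p q := (h.adj_p q).mpr rfl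
  obtain ⟨Z, z, haZ, hqZ, hzq, hout, -⟩ := exists_separator (U := {w | w ∈ R ∨ w = p ∨ w = q})
    (o := p) (h.not_hasTransitive a q) haq' haq h.head
    (fun X hXU hX haX hqX hpX hout => h.not_out_q (X := X) (by grind) hX hout)
    (Reach.of_adj hpq haq'.symm)
  have hpZ : p ∉ Z := fun hp => by grind [hout p hp q hpq]
  have hRZ : R ⊆ Z := by
    by_contra hRZ
    refine h.not_out_q (X := Z ∩ R) (z := z) (Set.inter_subset_right.ssubset_of_ne fun e =>
      hRZ (Set.inter_eq_right.mp e)) ⟨a, haZ, ha⟩ fun u hu w huw => ?_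
    grind [hout u hu.1 w huw, h.head u w huw]
  grind [hout b (hRZ hb) q hbq]

theorem exists_adj_mem (h : MinConfig D R p q x) (hu : u ∈ R) : ∃ w ∈ R, w ≠ u ∧ D.Adj u w := by
  obtain ⟨w, huw, hwp, hwq⟩ := h.three u hu p q
  exact ⟨w, (h.head u w huw).resolve_right (by simp [hwp, hwq]),
    fun hwu => h.loopless u hu (hwu ▸ huw), huw⟩

theorem not_adj_p [Finite V] (h : MinConfig D R p q x) (hs : s ∈ R) (hsq : D.Adj s q) :
    ¬ D.Adj s p := by
  intro hsp
  obtain ⟨w, hwR, hws, -⟩ := h.exists_adj_mem hs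
  refine h.not_out_two (X := R \ {s}) (s := s) (t := p) (by grind) ⟨w, hwR, hws⟩ ?_
    (Reach.of_adj hsp fun hp => h.p_notMem hp.1)
  intro u hu w huw
  grind [h.head u w huw, h.adj_q_unique hs hsq hu.1]

theorem exists_adj_p [Finite V] (h : MinConfig D R p q x) (hb : b ∈ R) :
    ∃ c ∈ R, c ≠ b ∧ D.Adj c p := by
  by_contra hp
  obtain ⟨w, hwR, hwb, -⟩ := h.exists_adj_mem hb
  refine h.not_out_q (X := R \ {b}) (z := b) (by grind) ⟨w, hwR, hwb⟩ fun u hu w huw => ?_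
  grind [h.head u w huw]

theorem reach_p_avoiding [Finite V] (h : MinConfig D R p q x) (hb : b ∈ R) (hbx : b ≠ x) :
    Reach D {b}ᶜ q p := by
  have hbq : b ≠ q := fun e => h.q_notMem (e ▸ hb)
  by_contra hqp
  have hmem : ∀ w, Reach D {b}ᶜ q w → w ≠ b := fun w hqw => hqw.mem_of_mem (T := {b}ᶜ) hbq.symm
  refine h.not_out_q (X := {w | Reach D {b}ᶜ q w} ∩ R) (z := b)
    (Set.inter_subset_right.ssubset_of_ne fun e => hmem b (Set.inter_eq_right.mp e hb) rfl)
    ⟨x, Reach.of_adj ((h.adj_q x).mpr rfl) hbx.symm, h.x_mem⟩ fun u hu w huw => ?_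
  by_cases hwb : w = b
  · exact Or.inr (Or.inl hwb)
  · have hqw : Reach D {b}ᶜ q w := Reach.tail hu.1 huw hwb
    grind [h.head u w huw]

theorem q_mem_of_separator [Finite V] (h : MinConfig D R p q x) (hb : b ∈ R) (hbZ : b ∈ Z)
    (hpZ : p ∉ Z) (hzp : z ≠ p)
    (hout : ∀ u ∈ Z, ∀ w, D.Adj u w → w ∈ Z ∨ w = z ∨ u = b ∧ w = p) : q ∈ Z := by
  by_contra hqZ
  obtain ⟨c, hc, hcb, hcp⟩ := h.exists_adj_p hb
  have hcZ : c ∉ Z := fun hcZ => by grind [hout c hcZ p hcp]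
  have hout' : ∀ u ∈ Z ∩ R, ∀ w, D.Adj u w → w ∈ Z ∩ R ∨ w = z ∨ w = p := fun u hu w huw => by
    grind [hout u hu.1 w huw, h.head u w huw]
  have hZR : Z ∩ R ⊂ R :=
    Set.inter_subset_right.ssubset_of_ne fun e => hcZ (Set.inter_eq_right.mp e hc)
  have hzp' : ¬ Reach D (Z ∩ R)ᶜ z p := h.not_out_two hZR ⟨b, hbZ, hb⟩ hout'
  have hcU : ¬ Reach D (Z ∩ R)ᶜ z c := fun hzc => hzp' (hzc.tail hcp fun hp => hpZ hp.1)
  refine h.not_out_q (X := (Z ∪ {w | Reach D (Z ∩ R)ᶜ z w}) ∩ R) (z := p)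
    (Set.inter_subset_right.ssubset_of_ne fun e => ?_) ⟨b, Or.inl hbZ, hb⟩ fun u hu w huw => ?_
  · exact (Set.inter_eq_right.mp e hc).elim hcZ hcU
  · have hw : w ∈ Z ∩ R ∪ {w | Reach D (Z ∩ R)ᶜ z w} ∨ w = p :=
      Reach.mem_union_or (hu.1.imp_left fun huZ => ⟨huZ, hu.2⟩) huw fun hu => hout' u hu w huw
    grind [h.head u w huw]

theorem exists_separator_p [Finite V] (h : MinConfig D R p q x) (hb : b ∈ R) (hbp : D.Adj b p)
    (hbx : b ≠ x) (hs : s ∈ R) (hsq : D.Adj s q) :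
    ∃ (Z : Set V) (z : V), b ∈ Z ∧ p ∉ Z ∧ z ≠ p ∧ s ∈ Z ∧
      ∀ u ∈ Z, ∀ w, D.Adj u w → w ∈ Z ∨ w = z ∨ u = b ∧ w = p := by
  have hbq : b ≠ q := fun e => h.q_notMem (e ▸ hb)
  have hbp' : b ≠ p := fun e => h.p_notMem (e ▸ hb)
  obtain ⟨Z, z, hbZ, hpZ, hzp, hout, hin⟩ := exists_separator
    (U := {w | w ∈ R ∨ w = p ∨ w = q}) (o := q) (h.not_hasTransitive b p) hbp' hbp h.head
    (fun X hXU hX hbX hpX hqX hout =>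
      h.not_out_two (X := X) (by grind) hX hout (Reach.of_adj hbp hpX))
    (h.reach_p_avoiding hb hbx)
  have hqZ : q ∈ Z := h.q_mem_of_separator hb hbZ hpZ hzp hout
  refine ⟨Z, z, hbZ, hpZ, hzp, ?_, hout⟩
  obtain ⟨u, hu, huq⟩ := hin q hqZ hbq.symm
  rcases h.tail u q huq with hR | rfl | rfl
  · exact h.adj_q_unique hs hsq hR huq ▸ hu
  · exact absurd hu hpZ
  · exact absurd ((h.adj_q u).mp huq) fun e => h.q_notMem (e ▸ h.x_mem)

theorem subset_union_separators [Finite V] (h : MinConfig D R p q x) (hb : b ∈ R) (hbZ : b ∈ Z₁)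
    (hout₁ : ∀ u ∈ Z₁, ∀ w, D.Adj u w → w ∈ Z₁ ∨ w = z₁ ∨ u = b ∧ w = p)
    (hout₂ : ∀ u ∈ Z₂, ∀ w, D.Adj u w → w ∈ Z₂ ∨ w = z₂ ∨ u = c ∧ w = p)
    (hz₁ : z₁ ∈ Z₂) (hz₂ : z₂ ∈ Z₁) : R ⊆ Z₁ ∪ Z₂ := by
  by_contra hR
  refine h.not_out_q (X := (Z₁ ∪ Z₂) ∩ R) (z := p) (Set.inter_subset_right.ssubset_of_ne fun e =>
    hR (Set.inter_eq_right.mp e)) ⟨b, Or.inl hbZ, hb⟩ fun u hu w huw => ?_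
  have hw : w ∈ Z₁ ∪ Z₂ ∨ w = p := by grind
  grind [h.head u w huw]

theorem separators_cross [Finite V] (h : MinConfig D R p q x) (hb : b ∈ R) (hbZ : b ∉ Z₂)
    (hcZ : c ∉ Z₁) (hp : p ∉ Z₁) (hs : s ∈ R) (hs₁ : s ∈ Z₁) (hs₂ : s ∈ Z₂)
    (hout₁ : ∀ u ∈ Z₁, ∀ w, D.Adj u w → w ∈ Z₁ ∨ w = z₁ ∨ u = b ∧ w = p)
    (hout₂ : ∀ u ∈ Z₂, ∀ w, D.Adj u w → w ∈ Z₂ ∨ w = z₂ ∨ u = c ∧ w = p) :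
    z₁ ∈ Z₂ ∧ z₂ ∈ Z₁ := by
  by_contra hz
  obtain ⟨z, hz⟩ : ∃ z, ∀ u ∈ Z₁ ∩ Z₂, ∀ w, D.Adj u w → w ∈ Z₁ ∩ Z₂ ∨ w = z := by
    by_cases hz₁ : z₁ ∈ Z₂
    · exact ⟨z₁, fun u hu w huw => by grind⟩
    · exact ⟨z₂, fun u hu w huw => by grind⟩
  refine h.not_out_q (X := Z₁ ∩ Z₂ ∩ R) (z := z) (Set.inter_subset_right.ssubset_of_ne fun e =>
    hbZ (Set.inter_eq_right.mp e hb).2) ⟨s, ⟨hs₁, hs₂⟩, hs⟩ fun u hu w huw => ?_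
  grind [hz u hu.1 w huw, h.head u w huw]

theorem adj_p_eq [Finite V] (h : MinConfig D R p q x) (hb : b ∈ R) (hbp : D.Adj b p)
    (hbx : b ≠ x) (hc : c ∈ R) (hcp : D.Adj c p) (hcx : c ≠ x) (hbc : b ≠ c) (ha : a ∈ R)
    (hap : D.Adj a p) : a = b ∨ a = c := by
  obtain ⟨s, hs, hsq⟩ := h.exists_adj_q
  obtain ⟨Z₁, z₁, hbZ₁, hpZ₁, hz₁p, hsZ₁, hout₁⟩ := h.exists_separator_p hb hbp hbx hs hsq
  obtain ⟨Z₂, z₂, hcZ₂, hpZ₂, hz₂p, hsZ₂, hout₂⟩ := h.exists_separator_p hc hcp hcx hs hsq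
  have hZ₁ : ∀ a ∈ Z₁, D.Adj a p → a = b := fun a ha hap => by grind [hout₁ a ha p hap]
  have hZ₂ : ∀ a ∈ Z₂, D.Adj a p → a = c := fun a ha hap => by grind [hout₂ a ha p hap]
  obtain ⟨hz₁, hz₂⟩ := h.separators_cross hb (fun hb => hbc (hZ₂ b hb hbp))
    (fun hc => hbc (hZ₁ c hc hcp).symm) hpZ₁ hs hsZ₁ hsZ₂ hout₁ hout₂
  exact (h.subset_union_separators hb hbZ₁ hout₁ hout₂ hz₁ hz₂ ha).imp
    (fun h₁ => hZ₁ a h₁ hap) fun h₂ => hZ₂ a h₂ hap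

theorem exists_adj_p_iff [Finite V] (h : MinConfig D R p q x) :
    ∃ b ∈ R, ∃ c ∈ R, b ≠ c ∧ ∀ u ∈ R, D.Adj u p ↔ u = b ∨ u = c := by
  obtain ⟨b, hb, hbx, hbp⟩ := h.exists_adj_p h.x_mem
  obtain ⟨c, hc, hcb, hcp⟩ := h.exists_adj_p hb
  refine ⟨b, hb, c, hc, hcb.symm, fun u hu => ⟨fun hup => ?_, ?_⟩⟩
  · by_cases hcx : c = x
    · by_contra! hu'
      have hux : u ≠ x := fun e => hu'.2 (e.trans hcx.symm)
      rcases h.adj_p_eq hb hbp hbx hu hup hux hu'.1.symm hc hcp with hcb' | hcu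
      exacts [hcb hcb', hu'.2 hcu.symm]
    · exact h.adj_p_eq hb hbp hbx hc hcp hcx hcb.symm hu hup
  · rintro (rfl | rfl) <;> assumption

theorem exists_adj_q_iff [Finite V] (h : MinConfig D R p q x) :
    ∃ s ∈ R, ∀ u ∈ R, D.Adj u q ↔ u = s := by
  obtain ⟨s, hs, hsq⟩ := h.exists_adj_q
  exact ⟨s, hs, fun u hu => ⟨h.adj_q_unique hs hsq hu, fun hus => hus ▸ hsq⟩⟩

end MinConfig

end MinConfigArcs

section Suppress

variable {V : Type*} {D E : Digraph V} {K R X : Set V} {a d p q u v w x y : V}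

/-- A minimal configuration with the vertex `p` of out-degree one suppressed: a digraph `E` on
`R ∪ {q}` in which the vertices of `tok` are those with an arc to `q`, and the only arc from `q`
ends in `x`. -/
structure TokenConfig (E : Digraph V) (R : Set V) (q x : V) (tok : Set V) : Prop where
  q_notMem : q ∉ R
  x_mem : x ∈ R
  tok_subset : tok ⊆ R
  tok_ne : ∀ z, ∃ t ∈ tok, t ≠ z
  adj_q : ∀ w, E.Adj q w ↔ w = x
  adj_to_q : ∀ u, E.Adj u q ↔ u ∈ tok
  tail : ∀ u w, E.Adj u w → u ∈ R ∨ u = q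
  head : ∀ u w, E.Adj u w → w ∈ R ∨ w = q
  loopless : ∀ u ∈ R, ¬ E.Adj u u
  not_hasTransitive : ∀ a ∈ R, ∀ d ∈ R, ¬ HasTransitive E a d
  mem_of_closed : ∀ K : Set V, (∀ u ∈ K, u ∈ R ∨ u = q) → K.Nonempty →
    (∀ u ∈ K, ∀ w, E.Adj u w → w ∈ K) → q ∈ K ∧ R ⊆ K
  eq_of_not_out : ∀ X ⊆ R, X.Nonempty → (∀ u ∈ X, ∀ w ∈ R, E.Adj u w → w ∈ X) → X = R
  not_out_one : ∀ X ⊆ R, X.Nonempty → Disjoint X tok → ∀ z,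
    ¬ ∀ u ∈ X, ∀ w, E.Adj u w → w ∈ X ∨ w = z
  not_out_two : ∀ X ⊆ R, X.Nonempty → Disjoint X tok → ∀ y z,
    (∀ u ∈ X, ∀ w, E.Adj u w → w ∈ X ∨ w = y ∨ w = z) → ¬ Reach E Xᶜ y z
  not_reach : ∀ X ⊆ R, X.Nonempty → ¬ tok ⊆ X → ∀ y,
    (∀ u ∈ X, ∀ w ∈ R, E.Adj u w → w ∈ X ∨ w = y) → ¬ Reach E Xᶜ q y

/-- The digraph obtained from `D` by deleting `p` and redirecting its incoming arcs to `q`. -/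
def suppress (D : Digraph V) (p q : V) : Digraph V :=
  ⟨fun u w => D.Adj u w ∧ u ≠ p ∧ w ≠ p ∨ D.Adj u p ∧ w = q⟩

namespace Config

theorem suppress_adj_of_mem (h : Config D R p q x) (hu : u ∈ R) (hw : w ∈ R) :
    (suppress D p q).Adj u w ↔ D.Adj u w := by
  grind [suppress, h.p_notMem, h.q_notMem]

theorem suppress_adj_q (h : Config D R p q x) : (suppress D p q).Adj q w ↔ w = x := by
  grind [suppress, Config]

theorem mem_of_suppress_adj_q (h : Config D R p q x) (hu : (suppress D p q).Adj u q) : u ∈ R := by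
  grind [suppress, Config]

theorem suppress_tail (h : Config D R p q x) (huw : (suppress D p q).Adj u w) :
    u ∈ R ∨ u = q := by
  grind [suppress, Config]

theorem suppress_head (h : Config D R p q x) (huw : (suppress D p q).Adj u w) :
    w ∈ R ∨ w = q := by
  grind [suppress, Config]

theorem suppress_adj_or (h : Config D R p q x) (hu : u ∈ R) (huw : D.Adj u w) :
    w ∈ R ∧ (suppress D p q).Adj u w ∨ (suppress D p q).Adj u q ∧ (w = p ∨ w = q) := by
  grind [suppress, Config]

theorem reach_of_suppress (h : Config D R p q x) (hX : X ⊆ R)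
    (huv : Reach (suppress D p q) Xᶜ u v) : Reach D Xᶜ u v := by
  refine (Reach.simulate (A := Set.univ) huv trivial fun a _ w hw haw => ⟨trivial, ?_⟩).2
  rcases haw with haw | ⟨hap, rfl⟩
  · exact Reach.of_adj haw.1 hw
  · exact Reach.head hap (fun hp => h.p_notMem (hX hp))
      (Reach.of_adj ((h.adj_p w).mpr rfl) hw)

theorem mem_of_suppress_reach (h : Config D R p q x) (hu : u ∈ R)
    (huv : Reach (suppress D p q) X u v) : v ∈ R ∨ v = q := by
  cases huv with
  | refl => exact Or.inl hu
  | tail _ hstep => exact h.suppress_head hstep.1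

theorem suppress_arcsLift (h : Config D R p q x) (hd : d ∈ R) :
    ArcsLift (suppress D p q) D {p, q} a d := by
  rintro u w - - (huw | ⟨hup, rfl⟩)
  · exact Or.inl huw.1
  · have hwd : w ≠ d := fun e => h.q_notMem (e ▸ hd)
    have hpd : p ≠ d := fun e => h.p_notMem (e ▸ hd)
    exact Or.inr ⟨Or.inr ⟨by simp, hwd⟩,
      Reach.head hup (by simp [hpd]) (Reach.of_adj ((h.adj_p w).mpr rfl) (by simp))⟩

end Config

namespace MinConfig

theorem suppress_threeOut [Finite V] (h : MinConfig D R p q x) (hu : u ∈ R) :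
    ThreeOut (suppress D p q) u := by
  classical
  intro y z
  have hup : ¬ (D.Adj u p ∧ D.Adj u q) := fun hup => h.not_adj_p hu hup.2 hup.1
  by_cases hp : D.Adj u p
  · obtain ⟨w, huw, hwy, hwz⟩ := h.three u hu (if y = q then p else y) (if z = q then p else z)
    grind [h.suppress_adj_or hu huw]
  · obtain ⟨w, huw, hwy, hwz⟩ := h.three u hu y z
    exact ⟨w, by grind [h.suppress_adj_or hu huw], hwy, hwz⟩

theorem suppress_not_hasTransitive (h : MinConfig D R p q x) (ha : a ∈ R) (hd : d ∈ R) :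
    ¬ HasTransitive (suppress D p q) a d := by
  intro had
  refine h.not_hasTransitive a d (had.lift (W := {p, q})
    ((h.suppress_adj_of_mem ha hd).mp had.2.1) ?_ ?_ (h.suppress_arcsLift hd))
  · rintro (rfl | rfl)
    exacts [h.p_notMem ha, h.q_notMem ha]
  · have hq : ∀ T, Thick (suppress D p q) a d T → (T ∩ {p, q}).Nonempty → q ∈ T := by
      rintro T hT ⟨w, hw, rfl | rfl⟩
      · obtain ⟨u, hu⟩ := hT.exists_adj hw
        grind [h.suppress_head hu, h.p_notMem, h.ne]
      · exact hw
    exact fun T₁ T₂ hT hT₁ hT₂ h₁ h₂ => Set.disjoint_left.mp hT (hq T₁ hT₁ h₁) (hq T₂ hT₂ h₂)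

theorem suppress_mem_of_closed [Finite V] (h : MinConfig D R p q x)
    (hK : ∀ u ∈ K, u ∈ R ∨ u = q) (hKn : K.Nonempty)
    (hout : ∀ u ∈ K, ∀ w, (suppress D p q).Adj u w → w ∈ K) : q ∈ K ∧ R ⊆ K := by
  have hq : q ∈ K := by
    by_contra hq
    refine h.not_closed (X := K) (by grind) hKn fun u hu w huw => ?_
    grind [h.suppress_adj_or (u := u) (w := w)]
  refine ⟨hq, fun u hu => ?_⟩
  have hp := h.mem_of_closed (K := insert p K) (by grind) ⟨p, Or.inl rfl⟩ fun u hu w huw => by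
    grind [h.adj_p w, h.adj_q w, h.suppress_adj_q (w := x), h.suppress_adj_or (u := u) (w := w)]
  exact (hp.2.2 hu).resolve_left fun e => h.p_notMem (e ▸ hu)

theorem suppress_eq_of_not_out [Finite V] (h : MinConfig D R p q x) (hX : X ⊆ R)
    (hXn : X.Nonempty) (hout : ∀ u ∈ X, ∀ w ∈ R, (suppress D p q).Adj u w → w ∈ X) : X = R := by
  by_contra hXR
  refine h.not_out_q (z := p) (hX.ssubset_of_ne hXR) hXn fun u hu w huw => ?_
  grind [h.suppress_adj_or (hX hu) huw]

theorem subset_of_threeIn [Finite V] (h : MinConfig D R p q x)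
    (hX : ThreeIn (suppress D p q) X q) : {u | (suppress D p q).Adj u q} ⊆ X := by
  obtain ⟨b, -, c, -, -, hp⟩ := h.exists_adj_p_iff
  obtain ⟨s, -, hq⟩ := h.exists_adj_q_iff
  have htok : ∀ u, (suppress D p q).Adj u q → u = b ∨ u = c ∨ u = s := fun u huq => by
    grind [suppress, h.mem_of_suppress_adj_q huq]
  obtain ⟨u, hu, v, hv, w, hw, huv, huw, hvw, huq, hvq, hwq⟩ := hX
  intro t ht
  grind [htok t ht, htok u huq, htok v hvq, htok w hwq]

theorem suppress_not_reach [Finite V] (h : MinConfig D R p q x) (hX : X ⊆ R) (hXn : X.Nonempty)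
    (htok : ¬ {u | (suppress D p q).Adj u q} ⊆ X)
    (hout : ∀ u ∈ X, ∀ w ∈ R, (suppress D p q).Adj u w → w ∈ X ∨ w = y) :
    ¬ Reach (suppress D p q) Xᶜ q y := by
  intro hqy
  have hXR : X ≠ R := by
    rintro rfl
    exact htok fun u hu => h.mem_of_suppress_adj_q hu
  have hy : y ∉ X ∧ y ∈ R := by
    by_contra hy
    exact hXR (h.suppress_eq_of_not_out hX hXn (by grind))
  have hqX : q ∉ X := fun hq => h.q_notMem (hX hq)
  have hyq : y ≠ q := fun e => h.q_notMem (e ▸ hy.2)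
  obtain ⟨v, hv⟩ := hXn
  have hyv : Reach (suppress D p q) Set.univ y v :=
    (h.suppress_mem_of_closed (K := {w | Reach (suppress D p q) Set.univ y w})
      (fun _ hyw => h.mem_of_suppress_reach hy.2 hyw) ⟨y, Reach.refl⟩
      fun u hu w huw => Reach.tail hu huw trivial).2 (hX hv)
  obtain ⟨w, hyw, v, hv, -, hwv⟩ := hyv.exists_first_entry hy.1 hv
  have hconfig := contract_config (fun u hu => h.suppress_threeOut (hX hu))
    (fun u hu => fun huu => h.loopless u (hX hu) ((h.suppress_adj_of_mem (hX hu) (hX hu)).mp huu))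
    hyq.symm hqX hy.1 (fun u hu w huw => by grind [h.suppress_head huw]) hv
  obtain ⟨a, d, had⟩ := h.minimal _ X q y v hconfig (Set.ncard_lt_ncard (hX.ssubset_of_ne hXR))
  obtain ⟨ha, hd, had, hdq⟩ := exists_hasTransitive_of_contract hconfig had hqy
    (Or.inr ⟨(hyw.mono (by grind)).tail hwv (Set.mem_insert _ _),
      fun hthree => htok (h.subset_of_threeIn hthree)⟩)
  refine h.suppress_not_hasTransitive (hX ha) ?_ had
  rcases hd with hd | hd | hd
  · exact hX hd
  · exact absurd (h.subset_of_threeIn (hdq hd)) htok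
  · exact hd ▸ hy.2

theorem tokenConfig_suppress [Finite V] (h : MinConfig D R p q x) :
    TokenConfig (suppress D p q) R q x {u | (suppress D p q).Adj u q} where
  q_notMem := h.q_notMem
  x_mem := h.x_mem
  tok_subset u hu := h.mem_of_suppress_adj_q hu
  tok_ne z := by
    obtain ⟨b, hb, c, hc, hbc, hp⟩ := h.exists_adj_p_iff
    have hb' : (suppress D p q).Adj b q := Or.inr ⟨(hp b hb).mpr (Or.inl rfl), rfl⟩
    have hc' : (suppress D p q).Adj c q := Or.inr ⟨(hp c hc).mpr (Or.inr rfl), rfl⟩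
    by_cases hbz : b = z
    exacts [⟨c, hc', fun hcz => hbc (hbz.trans hcz.symm)⟩, ⟨b, hb', hbz⟩]
  adj_q _ := h.suppress_adj_q
  adj_to_q _ := Iff.rfl
  tail _ _ := h.suppress_tail
  head _ _ := h.suppress_head
  loopless u hu huu := h.loopless u hu ((h.suppress_adj_of_mem hu hu).mp huu)
  not_hasTransitive _ ha _ hd := h.suppress_not_hasTransitive ha hd
  mem_of_closed _ := h.suppress_mem_of_closed
  eq_of_not_out _ := h.suppress_eq_of_not_out
  not_out_one X hX hXn hdis z hout := h.not_out_one (z := z) hX hXn fun u hu w huw => by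
    grind [h.suppress_adj_or (hX hu) huw, Set.disjoint_left.mp hdis hu]
  not_out_two X hX hXn hdis y z hout hyz := by
    obtain ⟨b, hb, c, -, -, hp⟩ := h.exists_adj_p_iff
    have hb' : (suppress D p q).Adj b q := Or.inr ⟨(hp b hb).mpr (Or.inl rfl), rfl⟩
    refine h.not_out_two (s := y) (t := z) (hX.ssubset_of_ne ?_) hXn (fun u hu w huw => ?_)
      (h.reach_of_suppress hX hyz)
    · rintro rfl
      exact Set.disjoint_left.mp hdis hb hb'
    · grind [h.suppress_adj_or (hX hu) huw, Set.disjoint_left.mp hdis hu]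
  not_reach _ hX hXn htok _ := h.suppress_not_reach hX hXn htok

end MinConfig

end Suppress

section Hub

variable {V : Type*} {E : Digraph V} {K R X Y tok : Set V} {a α d m q u v w x y z : V}

namespace TokenConfig

theorem false_of_out_x (h : TokenConfig E R q x tok) (hX : X ⊆ R) (hXn : X.Nonempty)
    (hdis : Disjoint X tok) (hxX : x ∉ X)
    (hout : ∀ u ∈ X, ∀ w, E.Adj u w → w ∈ X ∨ w = z ∨ w = x) : False := by
  have htok : ∀ u ∈ X, ¬ E.Adj u q := fun u hu huq =>
    Set.disjoint_left.mp hdis hu ((h.adj_to_q u).mp huq)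
  by_cases hz : z ∈ R
  · have hzx : ¬ Reach E Xᶜ z x := h.not_out_two X hX hXn hdis z x hout
    have hzq : ¬ Reach E Xᶜ z q := fun hzq => hzx (hzq.tail ((h.adj_q x).mpr rfl) hxX)
    have hUR : ∀ w, Reach E Xᶜ z w → w ∈ R := by
      intro w hzw
      cases hzw with
      | refl => exact hz
      | tail hzv hvw => exact (h.head _ w hvw.1).resolve_right fun e => hzq (e ▸ hzv.tail hvw)
    refine h.not_out_one (X ∪ {w | Reach E Xᶜ z w}) (Set.union_subset hX hUR) hXn.inl
      (Set.disjoint_left.mpr ?_) x fun u hu w huw =>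
        Reach.mem_union_or hu huw (fun hu => hout u hu w huw)
    rintro u (hu | hu) ht
    · exact Set.disjoint_left.mp hdis hu ht
    · exact hzq (hu.tail ((h.adj_to_q u).mpr ht) fun hq => h.q_notMem (hX hq))
  · exact h.not_out_one X hX hXn hdis x fun u hu w huw => by
      grind [hout u hu w huw, h.head u w huw]

theorem exists_separator [Finite V] (h : TokenConfig E R q x tok) (ha : a ∈ R) (hax : E.Adj a x) :
    ∃ Z ⊆ R, a ∈ Z ∧ x ∉ Z ∧ tok ⊆ Z ∧ ∀ u ∈ Z, ∀ w ∈ R, E.Adj u w → w ∈ Z ∨ u = a ∧ w = x := by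
  have hane : a ≠ x := by
    rintro rfl
    exact h.loopless a ha hax
  have hqa : q ≠ a := fun e => h.q_notMem (e ▸ ha)
  have hqx : E.Adj q x := (h.adj_q x).mpr rfl
  have hqx' : q ≠ x := fun e => h.q_notMem (e ▸ h.x_mem)
  obtain ⟨Z, z, haZ, hxZ, hzx, hout, -⟩ := TournamentSubdivision.exists_separator
    (U := {w | w ∈ R ∨ w = q}) (o := q) (h.not_hasTransitive a ha x h.x_mem) hane hax h.head
    (fun X hXU hX haX hxX hqX hout => by
      refine h.not_out_two X (by grind) hX (Set.disjoint_left.mpr fun u hu ht => ?_) a x hout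
        (Reach.of_adj hax hxX)
      grind [hout u hu q ((h.adj_to_q u).mpr ht)])
    (Reach.of_adj hqx hane.symm)
  have hqZ : q ∉ Z := fun hq => by grind [hout q hq x hqx]
  have hZn : (Z ∩ R).Nonempty := ⟨a, haZ, ha⟩
  by_cases hzq : z = q
  · have hout' : ∀ u ∈ Z ∩ R, ∀ w ∈ R, E.Adj u w → w ∈ Z ∩ R ∨ u = a ∧ w = x :=
      fun u hu w hw huw => by grind [hout u hu.1 w huw, h.q_notMem]
    refine ⟨Z ∩ R, Set.inter_subset_right, ⟨haZ, ha⟩, fun e => hxZ e.1, ?_, hout'⟩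
    by_contra ht
    exact h.not_reach (Z ∩ R) Set.inter_subset_right hZn ht x
      (fun u hu w hw huw => (hout' u hu w hw huw).imp_right And.right)
      (Reach.of_adj hqx fun e => hxZ e.1)
  · have htok : ∀ u ∈ Z, ¬ E.Adj u q := fun u hu huq => by grind [hout u hu q huq]
    refine (h.false_of_out_x (z := z) Set.inter_subset_right hZn (Set.disjoint_left.mpr
      fun u hu ht => htok u hu.1 ((h.adj_to_q u).mpr ht)) (fun hx => hxZ hx.1)
      fun u hu w huw => ?_).elim
    grind [hout u hu.1 w huw, h.head u w huw]

theorem exists_unique_adj_x [Finite V] (h : TokenConfig E R q x tok) :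
    ∃ α ∈ R, E.Adj α x ∧ ∀ a ∈ R, E.Adj a x → a = α := by
  obtain ⟨t, ht, htx⟩ := h.tok_ne x
  obtain ⟨α, hα, hαx⟩ : ∃ α ∈ R, E.Adj α x := by
    by_contra hx
    have hR : R \ {x} = R := h.eq_of_not_out (R \ {x}) Set.sdiff_subset
      ⟨t, h.tok_subset ht, htx⟩ fun u hu w hw huw => ⟨hw, fun hwx => hx ⟨u, hu.1, hwx ▸ huw⟩⟩
    exact (hR.symm ▸ h.x_mem).2 rfl
  refine ⟨α, hα, hαx, fun a ha hax => ?_⟩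
  by_contra haα
  obtain ⟨Z, hZR, haZ, hxZ, htZ, hout⟩ := h.exists_separator ha hax
  obtain ⟨Z', -, hαZ', hxZ', htZ', hout'⟩ := h.exists_separator hα hαx
  have hR : Z ∩ Z' = R := h.eq_of_not_out (Z ∩ Z') (Set.inter_subset_left.trans hZR)
    ⟨t, htZ ht, htZ' ht⟩ fun u hu w hw huw => by grind
  exact hxZ (hR.symm ▸ h.x_mem).1

end TokenConfig

/-- The smallest set `Y` containing the tokens that can be left inside `R` only through `x`,
together with the unique in-neighbour `α` of `x` in `R`. -/
structure CoreConfig (E : Digraph V) (R : Set V) (q x : V) (tok : Set V) (α : V) (Y : Set V) :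
    Prop extends TokenConfig E R q x tok where
  adj_x : ∀ a ∈ R, E.Adj a x ↔ a = α
  core_subset : Y ⊆ R
  mem_core : α ∈ Y
  x_notMem : x ∉ Y
  tok_subset_core : tok ⊆ Y
  out_core : ∀ u ∈ Y, ∀ w ∈ R, E.Adj u w → w ∈ Y ∨ w = x
  core_minimal : ∀ X ⊆ R, x ∉ X → tok ⊆ X → (∀ u ∈ X, ∀ w ∈ R, E.Adj u w → w ∈ X ∨ w = x) → Y ⊆ X

theorem TokenConfig.exists_coreConfig [Finite V] (h : TokenConfig E R q x tok) :
    ∃ α Y, CoreConfig E R q x tok α Y := by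
  obtain ⟨t, ht, -⟩ := h.tok_ne x
  obtain ⟨α, hα, hαx, huniq⟩ := h.exists_unique_adj_x
  set P : Set (Set V) := {X | X ⊆ R ∧ x ∉ X ∧ tok ⊆ X ∧
    ∀ u ∈ X, ∀ w ∈ R, E.Adj u w → w ∈ X ∨ w = x}
  obtain ⟨Z, hZ⟩ : ∃ Z, Z ∈ P := by
    obtain ⟨Z, hZR, -, hxZ, htZ, hout⟩ := h.exists_separator hα hαx
    exact ⟨Z, hZR, hxZ, htZ, fun u hu w hw huw => (hout u hu w hw huw).imp_right And.right⟩
  have hYR : ⋂₀ P ⊆ R := fun y hy => hZ.1 (hy Z hZ)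
  have hxY : x ∉ ⋂₀ P := fun hx => hZ.2.1 (hx Z hZ)
  have htY : tok ⊆ ⋂₀ P := fun u hu X hX => hX.2.2.1 hu
  have hYout : ∀ u ∈ ⋂₀ P, ∀ w ∈ R, E.Adj u w → w ∈ ⋂₀ P ∨ w = x := fun u hu w hw huw => by
    by_cases hwx : w = x
    · exact Or.inr hwx
    · exact Or.inl fun X hX => (hX.2.2.2 u (hu X hX) w hw huw).resolve_right hwx
  refine ⟨α, ⋂₀ P, { h with
    adj_x := fun a ha => ⟨huniq a ha, fun e => e ▸ hαx⟩
    core_subset := hYR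
    mem_core := ?_
    x_notMem := hxY
    tok_subset_core := htY
    out_core := hYout
    core_minimal := fun X hXR hxX htX hout => Set.sInter_subset_of_mem ⟨hXR, hxX, htX, hout⟩ }⟩
  by_contra hαY
  have hY : ⋂₀ P = R := h.eq_of_not_out _ hYR ⟨t, htY ht⟩ fun u hu w hw huw => by
    refine (hYout u hu w hw huw).resolve_right ?_
    rintro rfl
    exact hαY (huniq u (hYR hu) huw ▸ hu)
  exact hxY (hY.symm ▸ h.x_mem)

/-- The digraph on `Y ∪ {x}` obtained by contracting everything outside `Y` to `x`. -/
def hubDigraph (E : Digraph V) (R : Set V) (x : V) (tok : Set V) (α : V) (Y : Set V) :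
    Digraph V :=
  ⟨fun u w => u ∈ Y ∧ w ∈ Y ∧ E.Adj u w ∨ (u ∈ tok ∨ u = α) ∧ w = x ∨
    u = x ∧ w ∈ Y ∧ ∃ m ∈ R \ Y, E.Adj m w⟩

/-- The situation after contracting the outside of `Y` to the hub `o`: `Q` is a digraph on
`Y ∪ {o}`, the sets with few exits belong to a pairwise intersecting family `Heavy`, and no arc
inside `Y` has the subdivided transitive tournament of `HasTransitive`. -/
structure HubConfig (Q : Digraph V) (Y : Set V) (o : V) (Heavy : Set V → Prop) : Prop where
  notMem : o ∉ Y
  tail : ∀ u w, Q.Adj u w → u ∈ Y ∨ u = o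
  head : ∀ u w, Q.Adj u w → w ∈ Y ∨ w = o
  adj_hub : ∀ w, Q.Adj o w → w ∈ Y
  not_hasTransitive : ∀ a ∈ Y, ∀ d ∈ Y, ¬ HasTransitive Q a d
  mem_of_closed : ∀ K : Set V, (∀ u ∈ K, u ∈ Y ∨ u = o) → K.Nonempty →
    (∀ u ∈ K, ∀ w, Q.Adj u w → w ∈ K) → o ∈ K ∧ Y ⊆ K
  exists_adj_ne : ∀ z, ∃ w, Q.Adj o w ∧ w ≠ z
  heavy_inter : ∀ X X', Heavy X → Heavy X' → (X ∩ X').Nonempty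
  eq_of_not_out : ∀ X ⊆ Y, X.Nonempty → (∀ u ∈ X, ∀ w ∈ Y, Q.Adj u w → w ∈ X) → X = Y
  heavy : ∀ X ⊆ Y, X.Nonempty → ∀ y ∈ Y, (∀ u ∈ X, ∀ w ∈ Y, Q.Adj u w → w ∈ X ∨ w = y) →
    Reach Q Xᶜ o y → Heavy X
  not_out_two : ∀ X ⊆ Y, X.Nonempty → (∀ u ∈ X, ¬ Q.Adj u o) → ∀ y z,
    (∀ u ∈ X, ∀ w, Q.Adj u w → w ∈ X ∨ w = y ∨ w = z) → ¬ Reach Q Xᶜ y z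

namespace CoreConfig

theorem reach_outside (h : CoreConfig E R q x tok α Y) (hm : m ∈ R \ Y) :
    Reach E (R \ Y) x m := by
  have hx : x ∈ R \ Y ∧ Reach E (R \ Y) x x := ⟨⟨h.x_mem, h.x_notMem⟩, Reach.refl⟩
  have hmem := (h.mem_of_closed {w | (w ∈ Y ∨ w = q) ∨ w ∈ R \ Y ∧ Reach E (R \ Y) x w}
    (by grind [h.core_subset]) ⟨q, Or.inl (Or.inr rfl)⟩ fun u hu w huw => ?_).2 hm.1
  · grind [h.q_notMem]
  · rcases h.head u w huw with hwR | hwq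
    · by_cases hwY : w ∈ Y
      · exact Or.inl (Or.inl hwY)
      · refine Or.inr ⟨⟨hwR, hwY⟩, ?_⟩
        rcases hu with (hu | rfl) | hu
        · obtain rfl := (h.out_core u hu w hwR huw).resolve_left hwY
          exact Reach.refl
        · exact (h.adj_q w).mp huw ▸ Reach.refl
        · exact hu.2.tail huw ⟨hwR, hwY⟩
    · exact Or.inl (Or.inr hwq)

theorem hub_adj_of_mem (h : CoreConfig E R q x tok α Y) (hu : u ∈ Y) (hw : w ∈ Y) :
    (hubDigraph E R x tok α Y).Adj u w ↔ E.Adj u w := by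
  grind [hubDigraph, h.x_notMem]

theorem hub_tail (h : CoreConfig E R q x tok α Y) (huw : (hubDigraph E R x tok α Y).Adj u w) :
    u ∈ Y ∨ u = x := by
  grind [hubDigraph, h.tok_subset_core, h.mem_core]

theorem hub_head (huw : (hubDigraph E R x tok α Y).Adj u w) : w ∈ Y ∨ w = x := by
  grind [hubDigraph]

theorem mem_of_hub_adj (h : CoreConfig E R q x tok α Y)
    (hxw : (hubDigraph E R x tok α Y).Adj x w) : w ∈ Y := by
  grind [hubDigraph, h.tok_subset_core, h.mem_core, h.x_notMem]

theorem hub_adj_x (hu : u ∈ tok ∨ u = α) : (hubDigraph E R x tok α Y).Adj u x :=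
  Or.inr (Or.inl ⟨hu, rfl⟩)

theorem hub_adj_of_outside (hm : m ∈ R \ Y) (hw : w ∈ Y) (hmw : E.Adj m w) :
    (hubDigraph E R x tok α Y).Adj x w :=
  Or.inr (Or.inr ⟨rfl, hw, m, hm, hmw⟩)

theorem adj_or (h : CoreConfig E R q x tok α Y) (hu : u ∈ Y) (huw : E.Adj u w) :
    w ∈ Y ∧ (hubDigraph E R x tok α Y).Adj u w ∨ w = q ∧ u ∈ tok ∨ w = x ∧ u = α := by
  have huR := h.core_subset hu
  grind [h.head u w huw, h.out_core u hu w, h.hub_adj_of_mem (u := u) (w := w), h.adj_x u,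
    h.adj_to_q u]

theorem adj_or_reach_of_hub (h : CoreConfig E R q x tok α Y)
    (huw : (hubDigraph E R x tok α Y).Adj u w) :
    E.Adj u w ∨ (u = x ∨ w = x) ∧ Reach E (insert w (insert q (R \ Y))) u w := by
  have hαx : E.Adj α x := (h.adj_x α (h.core_subset h.mem_core)).mpr rfl
  rcases huw with huw | ⟨hu | rfl, rfl⟩ | ⟨rfl, hw, m, hm, hmw⟩
  · exact Or.inl huw.2.2
  · exact Or.inr ⟨Or.inr rfl, Reach.head ((h.adj_to_q u).mpr hu) (by simp)
      (Reach.of_adj ((h.adj_q w).mpr rfl) (by simp))⟩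
  · exact Or.inl hαx
  · exact Or.inr ⟨Or.inl rfl, ((h.reach_outside hm).mono (by grind)).tail hmw (by simp)⟩

theorem reach_of_hub (h : CoreConfig E R q x tok α Y) (hX : X ⊆ Y)
    (huv : Reach (hubDigraph E R x tok α Y) Xᶜ u v) : Reach E Xᶜ u v := by
  refine (Reach.simulate (A := Set.univ) huv trivial fun a _ w hw haw => ⟨trivial, ?_⟩).2
  rcases h.adj_or_reach_of_hub haw with haw | ⟨-, haw⟩
  · exact Reach.of_adj haw hw
  · exact haw.mono (by grind [h.q_notMem, h.core_subset])

theorem hub_arcsLift (h : CoreConfig E R q x tok α Y) (hd : d ∈ Y) :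
    ArcsLift (hubDigraph E R x tok α Y) E (insert q (R \ Y)) a d := by
  intro u w _ _ huw
  have hdW : d ∉ insert q (R \ Y) := by grind [h.q_notMem, h.core_subset]
  have hxW : x ∈ insert q (R \ Y) := Or.inr ⟨h.x_mem, h.x_notMem⟩
  refine (h.adj_or_reach_of_hub huw).imp_right fun ⟨hx, huw⟩ => ⟨by grind, ?_⟩
  rwa [Set.sdiff_singleton_eq_self hdW]

theorem hub_not_hasTransitive (h : CoreConfig E R q x tok α Y) (ha : a ∈ Y) (hd : d ∈ Y) :
    ¬ HasTransitive (hubDigraph E R x tok α Y) a d := by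
  intro had
  refine h.not_hasTransitive a (h.core_subset ha) d (h.core_subset hd)
    (had.lift ((h.hub_adj_of_mem ha hd).mp had.2.1) (by grind [h.q_notMem, h.core_subset]) ?_
      (h.hub_arcsLift hd))
  have hx : ∀ T, Thick (hubDigraph E R x tok α Y) a d T →
      (T ∩ insert q (R \ Y)).Nonempty → x ∈ T := by
    rintro T hT ⟨w, hw, hwW⟩
    obtain ⟨u, hu⟩ := hT.exists_adj hw
    grind [hub_head hu, h.q_notMem, h.core_subset]
  exact fun T₁ T₂ hT hT₁ hT₂ h₁ h₂ => Set.disjoint_left.mp hT (hx T₁ hT₁ h₁) (hx T₂ hT₂ h₂)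

theorem hub_mem_of_closed (h : CoreConfig E R q x tok α Y) (hKY : ∀ u ∈ K, u ∈ Y ∨ u = x)
    (hK : K.Nonempty) (hout : ∀ u ∈ K, ∀ w, (hubDigraph E R x tok α Y).Adj u w → w ∈ K) :
    x ∈ K ∧ Y ⊆ K := by
  have hx : x ∈ K := by
    by_contra hx
    have hKY' : K ⊆ Y := fun u hu => (hKY u hu).resolve_right fun e => hx (e ▸ hu)
    refine hx ((h.mem_of_closed K (fun u hu => Or.inl (h.core_subset (hKY' hu))) hK
      fun u hu w huw => ?_).2 h.x_mem)
    rcases h.adj_or (hKY' hu) huw with hw | hw | hw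
    · exact hout u hu w hw.2
    · exact absurd (hout u hu x (hub_adj_x (Or.inl hw.2))) hx
    · exact hw.1 ▸ hout u hu x (hub_adj_x (Or.inr hw.2))
  have hR := (h.mem_of_closed (K ∪ insert q (R \ Y)) (by grind [h.core_subset, h.x_mem]) hK.inl
    fun u hu w huw => ?_).2
  · exact ⟨hx, fun y hy => by grind [hR (h.core_subset hy), h.q_notMem, h.core_subset]⟩
  · by_cases huY : u ∈ Y
    · have huK : u ∈ K := by grind [h.q_notMem, h.core_subset]
      grind [h.adj_or huY huw]
    · rcases eq_or_ne u q with rfl | huq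
      · exact Or.inl ((h.adj_q w).mp huw ▸ hx)
      · have hu' : u ∈ R \ Y := by grind [h.x_mem]
        have hw : w ∈ Y → w ∈ K := fun hw => hout x hx w (hub_adj_of_outside hu' hw huw)
        grind [h.head u w huw]

theorem hub_exists_adj_ne (h : CoreConfig E R q x tok α Y) (z : V) :
    ∃ w, (hubDigraph E R x tok α Y).Adj x w ∧ w ≠ z := by
  by_contra! hz
  refine h.not_out_one (R \ Y) Set.sdiff_subset ⟨x, h.x_mem, h.x_notMem⟩
    (Set.disjoint_left.mpr fun u hu hut => hu.2 (h.tok_subset_core hut)) z fun u hu w huw => ?_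
  have hwq : w ≠ q := by
    rintro rfl
    exact hu.2 (h.tok_subset_core ((h.adj_to_q u).mp huw))
  have hw : w ∈ Y → w = z := fun hw => hz w (hub_adj_of_outside hu hw huw)
  grind [h.head u w huw]

theorem hub_eq_of_not_out (h : CoreConfig E R q x tok α Y) (hXY : X ⊆ Y) (hX : X.Nonempty)
    (hout : ∀ u ∈ X, ∀ w ∈ Y, (hubDigraph E R x tok α Y).Adj u w → w ∈ X) : X = Y := by
  have hout' : ∀ u ∈ X, ∀ w ∈ R, E.Adj u w → w ∈ X ∨ w = x := fun u hu w hw huw => by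
    grind [h.adj_or (hXY hu) huw, h.q_notMem]
  have hxX : x ∉ X := fun hx => h.x_notMem (hXY hx)
  by_cases ht : tok ⊆ X
  · exact hXY.antisymm (h.core_minimal X (hXY.trans h.core_subset) hxX ht hout')
  · exact absurd (Reach.of_adj ((h.adj_q x).mpr rfl) hxX)
      (h.not_reach X (hXY.trans h.core_subset) hX ht x hout')

theorem hub_heavy (h : CoreConfig E R q x tok α Y) (hXY : X ⊆ Y) (hX : X.Nonempty)
    (hout : ∀ u ∈ X, ∀ w ∈ Y, (hubDigraph E R x tok α Y).Adj u w → w ∈ X ∨ w = y)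
    (hxy : Reach (hubDigraph E R x tok α Y) Xᶜ x y) :
    tok ⊆ X ∨ α ∈ X ∧ (X ∩ tok).Nonempty := by
  have hxX : x ∉ X := fun hx => h.x_notMem (hXY hx)
  have hxy' := h.reach_of_hub hXY hxy
  by_contra! hlight
  by_cases hαX : α ∈ X
  · have hdis : Disjoint X tok := Set.disjoint_iff_inter_eq_empty.mpr (hlight.2 hαX)
    refine h.not_out_two X (hXY.trans h.core_subset) hX hdis x y (fun u hu w huw => ?_) hxy'
    grind [h.adj_or (hXY hu) huw, Set.disjoint_left.mp hdis hu]
  · refine h.not_reach X (hXY.trans h.core_subset) hX hlight.1 y (fun u hu w hw huw => ?_)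
      (Reach.head ((h.adj_q x).mpr rfl) hxX hxy')
    grind [h.adj_or (hXY hu) huw, h.q_notMem]

theorem hub_not_out_two (h : CoreConfig E R q x tok α Y) (hXY : X ⊆ Y) (hX : X.Nonempty)
    (hXx : ∀ u ∈ X, ¬ (hubDigraph E R x tok α Y).Adj u x)
    (hout : ∀ u ∈ X, ∀ w, (hubDigraph E R x tok α Y).Adj u w → w ∈ X ∨ w = y ∨ w = z) :
    ¬ Reach (hubDigraph E R x tok α Y) Xᶜ y z := by
  intro hyz
  refine h.not_out_two X (hXY.trans h.core_subset) hX (Set.disjoint_left.mpr fun u hu hut =>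
    hXx u hu (hub_adj_x (Or.inl hut))) y z (fun u hu w huw => ?_) (h.reach_of_hub hXY hyz)
  rcases h.adj_or (hXY hu) huw with hw | hw | hw
  exacts [hout u hu w hw.2, absurd (hub_adj_x (Or.inl hw.2)) (hXx u hu),
    absurd (hub_adj_x (Or.inr hw.2)) (hXx u hu)]

theorem hubConfig (h : CoreConfig E R q x tok α Y) :
    HubConfig (hubDigraph E R x tok α Y) Y x
      (fun X => tok ⊆ X ∨ α ∈ X ∧ (X ∩ tok).Nonempty) where
  notMem := h.x_notMem
  tail _ _ := h.hub_tail
  head _ _ := hub_head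
  adj_hub _ := h.mem_of_hub_adj
  not_hasTransitive _ ha _ hd := h.hub_not_hasTransitive ha hd
  mem_of_closed _ := h.hub_mem_of_closed
  exists_adj_ne := h.hub_exists_adj_ne
  heavy_inter X X' hX hX' := by
    obtain ⟨t, ht, -⟩ := h.tok_ne x
    rcases hX with hX | ⟨hα, s, hs, hst⟩ <;> rcases hX' with hX' | ⟨hα', s', hs', hst'⟩
    exacts [⟨t, hX ht, hX' ht⟩, ⟨s', hX hst', hs'⟩, ⟨s, hs, hX' hst⟩, ⟨α, hα, hα'⟩]
  eq_of_not_out _ := h.hub_eq_of_not_out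
  heavy _ hXY hX _ _ hout hxy := h.hub_heavy hXY hX hout hxy
  not_out_two _ hXY hX hXx _ _ hout := h.hub_not_out_two hXY hX hXx hout

end CoreConfig

end Hub

section Parts

variable {V : Type*} {Q : Digraph V} {Y S S' W Ω Z Z₁ Z₂ : Set V} {Heavy : Set V → Prop}
  {a a₁ a₂ a₃ d e o u w y z z₁ z₂ : V}

theorem Reach.notMem_of_only_exit {D : Digraph V} (h : Reach D {a}ᶜ u d) (hua : u ≠ a)
    (hdW : d ∉ W) (hW : ∀ u ∈ W, ∀ w, D.Adj u w → w ∈ W ∨ u = a) : u ∉ W := fun hu =>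
  hdW (h.mem_of_closed (A := W ∩ {a}ᶜ) ⟨hu, hua⟩ fun u hu w hw huw =>
    ⟨(hW u hu.1 w huw).resolve_right hu.2, hw⟩).1

/-- A nonempty subset of `Y` such that all arcs entering it have the same head. -/
def SingleEntry (Q : Digraph V) (Y S : Set V) : Prop :=
  S ⊆ Y ∧ S.Nonempty ∧ ∃ e, ∀ u ∉ S, ∀ w ∈ S, Q.Adj u w → w = e

/-- A maximal set with a single entry. The parts of a hub configuration partition `Y`. -/
def IsPart (Q : Digraph V) (Y Ω : Set V) : Prop :=
  SingleEntry Q Y Ω ∧ ∀ S, SingleEntry Q Y S → (S ∩ Ω).Nonempty → S ⊆ Ω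

theorem IsPart.eq (h : IsPart Q Y S) (h' : IsPart Q Y S') (hu : u ∈ S) (hu' : u ∈ S') : S = S' :=
  (h'.2 S h.1 ⟨u, hu, hu'⟩).antisymm (h.2 S' h'.1 ⟨u, hu', hu⟩)

/-- The vertex `z` separates `a ∈ Z` from `d ∉ Z` in `Q` without the arc from `a` to `d`: all
other arcs leaving `Z` go to `z`. -/
structure Separates (Q : Digraph V) (a d : V) (Z : Set V) (z : V) : Prop where
  mem : a ∈ Z
  notMem : d ∉ Z
  ne : z ≠ d
  out : ∀ u ∈ Z, ∀ w, Q.Adj u w → w ∈ Z ∨ w = z ∨ u = a ∧ w = d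

theorem Separates.eq_of_adj (h : Separates Q a d Z z) (hu : u ∈ Z) (hud : Q.Adj u d) : u = a := by
  grind [h.out u hu d hud, h.notMem, h.ne]

namespace HubConfig

theorem exists_entering_adj (h : HubConfig Q Y o Heavy) (hSY : S ⊆ Y) (hS : S.Nonempty) :
    ∃ u ∉ S, ∃ w ∈ S, Q.Adj u w := by
  by_contra! hS'
  obtain ⟨y, hy⟩ := hS
  have hY := (h.mem_of_closed {u | (u ∈ Y ∨ u = o) ∧ u ∉ S} (fun u hu => hu.1)
    ⟨o, Or.inr rfl, fun ho => h.notMem (hSY ho)⟩ fun u hu w huw =>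
      ⟨h.head u w huw, fun hw => hS' u hu.2 w hw huw⟩).2
  exact (hY (hSY hy)).2 hy

theorem singleEntry_union (h : HubConfig Q Y o Heavy) (hS : SingleEntry Q Y S)
    (hS' : SingleEntry Q Y S') (hSS' : (S ∩ S').Nonempty) : SingleEntry Q Y (S ∪ S') := by
  obtain ⟨hSY, hSn, e, he⟩ := hS
  obtain ⟨hSY', -, e', he'⟩ := hS'
  obtain ⟨u, hu, w, hw, huw⟩ := h.exists_entering_adj (Set.inter_subset_left.trans hSY) hSS'
  have hee' : e ∈ S' ∨ e' ∈ S := by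
    by_cases huS : u ∈ S
    · exact Or.inr (he' u (fun huS' => hu ⟨huS, huS'⟩) w hw.2 huw ▸ hw.1)
    · exact Or.inl (he u huS w hw.1 huw ▸ hw.2)
  refine ⟨Set.union_subset hSY hSY', hSn.inl, ?_⟩
  rcases hee' with hee' | hee'
  · exact ⟨e', fun v hv w hw hvw => by grind⟩
  · exact ⟨e, fun v hv w hw hvw => by grind⟩

theorem exists_part [Finite V] (h : HubConfig Q Y o Heavy) (hy : y ∈ Y) :
    ∃ Ω, IsPart Q Y Ω ∧ y ∈ Ω := by
  obtain ⟨Ω, ⟨hΩ, hyΩ⟩, hmax⟩ := Set.Finite.exists_maximal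
    (Set.toFinite {S | SingleEntry Q Y S ∧ y ∈ S})
    ⟨{y}, ⟨Set.singleton_subset_iff.mpr hy, ⟨y, rfl⟩, y, fun _ _ _ hw _ => hw⟩, rfl⟩
  exact ⟨Ω, ⟨hΩ, fun S hS hn => Set.subset_union_left.trans
    (hmax ⟨h.singleEntry_union hS hΩ hn, Or.inr hyΩ⟩ Set.subset_union_right)⟩, hyΩ⟩

theorem exists_entry (h : HubConfig Q Y o Heavy) (hΩ : IsPart Q Y Ω) :
    ∃ e ∈ Ω, ∀ u ∉ Ω, ∀ w ∈ Ω, Q.Adj u w → w = e := by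
  obtain ⟨⟨hΩY, hΩn, e, he⟩, -⟩ := hΩ
  obtain ⟨u, hu, w, hw, huw⟩ := h.exists_entering_adj hΩY hΩn
  exact ⟨e, he u hu w hw huw ▸ hw, he⟩

theorem hub_notMem_part (h : HubConfig Q Y o Heavy) (hΩ : IsPart Q Y Ω) : o ∉ Ω :=
  fun ho => h.notMem (hΩ.1.1 ho)

theorem mem_of_single_exit (h : HubConfig Q Y o Heavy) (hΩ : IsPart Q Y Ω) (hd : d ∈ Ω)
    (ho : o ∈ W) (hdW : d ∉ W) (hout : ∀ u ∈ W, ∀ w, Q.Adj u w → w ∈ W ∨ w = e) (ha : a ∈ Y)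
    (haΩ : a ∉ Ω) : a ∈ W := by
  by_contra haW
  refine haΩ (hΩ.2 (Y \ W) ⟨Set.sdiff_subset, ⟨a, ha, haW⟩, e, fun u hu w hw huw => ?_⟩
    ⟨d, ⟨hΩ.1.1 hd, hdW⟩, hd⟩ ⟨ha, haW⟩)
  grind [h.tail u w huw]

theorem reach_of_mem_part (h : HubConfig Q Y o Heavy) (hΩ : IsPart Q Y Ω) (hd : d ∈ Ω)
    (ha : a ∈ Y) (haΩ : a ∉ Ω) : Reach Q {a}ᶜ o d := by
  by_contra hod
  have hoa : o ≠ a := fun e => h.notMem (e ▸ ha)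
  have hoa' : Reach Q {a}ᶜ o a := h.mem_of_single_exit (e := a) (W := {u | Reach Q {a}ᶜ o u})
    hΩ hd Reach.refl hod (fun u hu w huw => or_iff_not_imp_right.mpr (Reach.tail hu huw)) ha haΩ
  exact hoa'.mem_of_mem hoa rfl

theorem heavy_of_part (h : HubConfig Q Y o Heavy) (hΩ : IsPart Q Y Ω) (hy : y ∈ Y) (hyΩ : y ∉ Ω)
    (hout : ∀ u ∈ Ω, ∀ w ∈ Y, Q.Adj u w → w ∈ Ω ∨ w = y) : Heavy Ω := by
  obtain ⟨e, he, hentry⟩ := h.exists_entry hΩ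
  have hnot : ∀ u, Reach Q Ωᶜ o u → u ∉ Ω := fun u hou => hou.mem_of_mem (h.hub_notMem_part hΩ)
  refine h.heavy Ω hΩ.1.1 hΩ.1.2.1 y hy hout ?_
  refine h.mem_of_single_exit (e := e) (W := {u | Reach Q Ωᶜ o u}) hΩ he Reach.refl
    (fun hoe => hnot e hoe he) (fun u hu w huw => ?_) hy hyΩ
  by_cases hw : w ∈ Ω
  · exact Or.inr (hentry u (hnot u hu) w hw huw)
  · exact Or.inl (Reach.tail hu huw hw)

theorem hub_notMem_of_separates (h : HubConfig Q Y o Heavy) (hΩ : IsPart Q Y Ω) (hd : d ∈ Ω)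
    (ha : a ∈ Y) (haΩ : a ∉ Ω) (hsep : Separates Q a d Z z) (hzd : ¬ Reach Q Zᶜ z d) :
    o ∉ Z ∪ {w | Reach Q Zᶜ z w} :=
  (h.reach_of_mem_part hΩ hd ha haΩ).notMem_of_only_exit (fun e => h.notMem (e ▸ ha))
    (by simp [hsep.notMem, hzd]) fun u hu w huw =>
      Reach.mem_union_or hu huw fun hu => by grind [hsep.out u hu w huw]

theorem eq_hub_of_separates (h : HubConfig Q Y o Heavy) (hΩ : IsPart Q Y Ω) (hd : d ∈ Ω)
    (ha : a ∈ Y) (haΩ : a ∉ Ω) (hsep : Separates Q a d Z z) (ho : o ∉ Z) : z = o := by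
  by_contra hzo
  have hod : o ≠ d := fun e => h.hub_notMem_part hΩ (e ▸ hd)
  have hzd : ¬ Reach Q Zᶜ z d := fun hzd => by
    refine h.not_out_two (Z ∩ Y) Set.inter_subset_right ⟨a, hsep.mem, ha⟩ (fun u hu huo => ?_) z d
      (fun u hu w huw => ?_) (hzd.mono (by grind))
    · grind [hsep.out u hu.1 o huo]
    · grind [hsep.out u hu.1 w huw, h.head u w huw]
  have hoW := h.hub_notMem_of_separates hΩ hd ha haΩ hsep hzd
  set W := Z ∪ {w | Reach Q Zᶜ z w}
  have hout : ∀ u ∈ W, ∀ w, Q.Adj u w → w ∈ W ∨ w = d := fun u hu w huw =>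
    Reach.mem_union_or hu huw fun hu => (hsep.out u hu w huw).imp_right (Or.imp_right And.right)
  refine h.not_out_two (W ∩ Y) Set.inter_subset_right ⟨a, Or.inl hsep.mem, ha⟩
    (fun u hu huo => ?_) d d (fun u hu w huw => ?_) Reach.refl
  · grind [hout u hu.1 o huo]
  · grind [hout u hu.1 w huw, h.head u w huw]

theorem heavy_of_separates (h : HubConfig Q Y o Heavy) (hΩ : IsPart Q Y Ω) (hd : d ∈ Ω)
    (ha : a ∈ Y) (haΩ : a ∉ Ω) (hsep : Separates Q a d Z o) : Heavy (Z ∩ Y) := by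
  refine h.heavy _ Set.inter_subset_right ⟨a, hsep.mem, ha⟩ d (hΩ.1.1 hd) (fun u hu w hw huw => ?_)
    ?_
  · grind [hsep.out u hu.1 w huw, h.notMem]
  · by_contra hod
    exact h.hub_notMem_of_separates hΩ hd ha haΩ hsep
      (fun hod' => hod (hod'.mono (by grind))) (Or.inr Reach.refl)

theorem separates_or_heavy [Finite V] (h : HubConfig Q Y o Heavy) (hΩ : IsPart Q Y Ω)
    (hd : d ∈ Ω) (haΩ : a ∉ Ω) (had : Q.Adj a d) :
    (a = o ∨ ∃ Z z, Separates Q a d Z z ∧ o ∈ Z) ∨ ∃ Z, Separates Q a d Z o ∧ Heavy (Z ∩ Y) := by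
  rcases (h.tail a d had).symm with hao | ha
  · exact Or.inl (Or.inl hao)
  have hdY := hΩ.1.1 hd
  obtain ⟨Z, z, haZ, hdZ, hzd, hout, -⟩ := exists_separator (U := {w | w ∈ Y ∨ w = o}) (o := o)
    (h.not_hasTransitive a ha d hdY) (fun e => haΩ (e ▸ hd)) had h.head
    (fun X hXU hX haX hdX hoX hout => by
      refine h.not_out_two X (by grind) hX (fun u hu huo => ?_) a d hout (Reach.of_adj had hdX)
      grind [hout u hu o huo, h.notMem])
    (h.reach_of_mem_part hΩ hd ha haΩ)
  have hsep : Separates Q a d Z z := ⟨haZ, hdZ, hzd, hout⟩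
  by_cases ho : o ∈ Z
  · exact Or.inl (Or.inr ⟨Z, z, hsep, ho⟩)
  · obtain rfl := h.eq_hub_of_separates hΩ hd ha haΩ hsep ho
    exact Or.inr ⟨Z, hsep, h.heavy_of_separates hΩ hd ha haΩ hsep⟩

theorem eq_of_heavy (h : HubConfig Q Y o Heavy) (hd : d ∈ Y) (h₁ : Separates Q a₁ d Z₁ o)
    (h₂ : Separates Q a₂ d Z₂ o) (hH₁ : Heavy (Z₁ ∩ Y)) (hH₂ : Heavy (Z₂ ∩ Y)) : a₁ = a₂ := by
  by_contra hne
  have hY := h.eq_of_not_out (Z₁ ∩ Y ∩ (Z₂ ∩ Y)) (by grind) (h.heavy_inter _ _ hH₁ hH₂)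
    fun u hu w hw huw => by
      grind [h₁.out u hu.1.1 w huw, h₂.out u hu.2.1 w huw, h.notMem, h₁.notMem, h₂.notMem]
  exact h₁.notMem (hY.symm ▸ hd).1.1

theorem mem_union_of_separates (h : HubConfig Q Y o Heavy) (hΩ : IsPart Q Y Ω) (hd : d ∈ Ω)
    (h₁ : Separates Q a₁ d Z₁ z₁) (h₂ : Separates Q a₂ d Z₂ z₂) (ho : o ∈ Z₁)
    (hz₁ : z₁ ∈ Z₂) (hz₂ : z₂ ∈ Z₁) (ha : a ∈ Y) (haΩ : a ∉ Ω) : a ∈ Z₁ ∪ Z₂ :=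
  h.mem_of_single_exit (e := d) hΩ hd (Or.inl ho) (by grind [h₁.notMem, h₂.notMem])
    (fun u hu w huw => by
      rcases hu with hu | hu
      · grind [h₁.out u hu w huw]
      · grind [h₂.out u hu w huw]) ha haΩ

theorem mem_inter_of_separates (h : HubConfig Q Y o Heavy) (hΩ : IsPart Q Y Ω) (hd : d ∈ Ω)
    (h₁ : Separates Q a₁ d Z₁ z₁) (h₂ : Separates Q a₂ d Z₂ z₂) (hne : a₁ ≠ a₂) (ho₁ : o ∈ Z₁)
    (ho₂ : o ∈ Z₂) (hz : z₁ ∉ Z₂ ∨ z₂ ∉ Z₁) (ha : a ∈ Y) (haΩ : a ∉ Ω) : a ∈ Z₁ ∩ Z₂ := by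
  have hout : ∀ u ∈ Z₁ ∩ Z₂, ∀ w, Q.Adj u w → (w ∈ Z₁ ∨ w = z₁) ∧ (w ∈ Z₂ ∨ w = z₂) :=
    fun u hu w huw => by
      grind [h₁.out u hu.1 w huw, h₂.out u hu.2 w huw, h₁.notMem, h₂.notMem, h₁.ne, h₂.ne]
  obtain ⟨e, he⟩ : ∃ e, ∀ u ∈ Z₁ ∩ Z₂, ∀ w, Q.Adj u w → w ∈ Z₁ ∩ Z₂ ∨ w = e := by
    rcases hz with hz | hz
    · exact ⟨z₂, fun u hu w huw => by grind [hout u hu w huw]⟩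
    · exact ⟨z₁, fun u hu w huw => by grind [hout u hu w huw]⟩
  exact h.mem_of_single_exit hΩ hd ⟨ho₁, ho₂⟩ (fun hdZ => h₁.notMem hdZ.1) he ha haΩ

theorem false_of_two_separates_hub (h : HubConfig Q Y o Heavy) (hΩ : IsPart Q Y Ω) (hd : d ∈ Ω)
    (h₁ : a₁ = o ∨ ∃ Z z, Separates Q a₁ d Z z ∧ o ∈ Z)
    (h₂ : a₂ = o ∨ ∃ Z z, Separates Q a₂ d Z z ∧ o ∈ Z) (ha₁Ω : a₁ ∉ Ω) (ha₃Ω : a₃ ∉ Ω)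
    (ha₁d : Q.Adj a₁ d) (ha₂d : Q.Adj a₂ d) (ha₃d : Q.Adj a₃ d) (h₁₂ : a₁ ≠ a₂) (h₁₃ : a₁ ≠ a₃)
    (h₂₃ : a₂ ≠ a₃) : False := by
  rcases h₁ with rfl | ⟨Z₁, z₁, h₁, ho₁⟩ <;> rcases h₂ with rfl | ⟨Z₂, z₂, h₂, ho₂⟩
  · exact h₁₂ rfl
  · exact h₁₂ (h₂.eq_of_adj ho₂ ha₁d)
  · exact h₁₂ (h₁.eq_of_adj ho₁ ha₂d).symm
  by_cases hz : z₁ ∈ Z₂ ∧ z₂ ∈ Z₁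
  · rcases h.tail a₃ d ha₃d with ha₃ | rfl
    · rcases h.mem_union_of_separates hΩ hd h₁ h₂ ho₁ hz.1 hz.2 ha₃ ha₃Ω with ha₃Z | ha₃Z
      exacts [h₁₃ (h₁.eq_of_adj ha₃Z ha₃d).symm, h₂₃ (h₂.eq_of_adj ha₃Z ha₃d).symm]
    · exact h₁₃ (h₁.eq_of_adj ho₁ ha₃d).symm
  · rcases h.tail a₁ d ha₁d with ha₁ | rfl
    · exact h₁₂ (h₂.eq_of_adj (h.mem_inter_of_separates hΩ hd h₁ h₂ h₁₂ ho₁ ho₂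
        (not_and_or.mp hz) ha₁ ha₁Ω).2 ha₁d)
    · exact h₁₂ (h₂.eq_of_adj ho₂ ha₁d)

theorem ncard_entering_le [Finite V] (h : HubConfig Q Y o Heavy) (hΩ : IsPart Q Y Ω)
    (hd : d ∈ Ω) : {u | u ∉ Ω ∧ Q.Adj u d}.ncard ≤ 2 := by
  by_contra hcard
  rw [not_le, Set.two_lt_ncard_iff] at hcard
  obtain ⟨a, b, c, ⟨ha, had⟩, ⟨hb, hbd⟩, ⟨hc, hcd⟩, hab, hac, hbc⟩ := hcard
  have hdY := hΩ.1.1 hd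
  rcases h.separates_or_heavy hΩ hd ha had with hA | ⟨_, hA, hA'⟩ <;>
    rcases h.separates_or_heavy hΩ hd hb hbd with hB | ⟨_, hB, hB'⟩
  · exact h.false_of_two_separates_hub hΩ hd hA hB ha hc had hbd hcd hab hac hbc
  · rcases h.separates_or_heavy hΩ hd hc hcd with hC | ⟨_, hC, hC'⟩
    exacts [h.false_of_two_separates_hub hΩ hd hA hC ha hb had hcd hbd hac hab hbc.symm,
      hbc (h.eq_of_heavy hdY hB hC hB' hC')]
  · rcases h.separates_or_heavy hΩ hd hc hcd with hC | ⟨_, hC, hC'⟩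
    exacts [h.false_of_two_separates_hub hΩ hd hB hC hb ha hbd hcd had hbc hab.symm hac.symm,
      hac (h.eq_of_heavy hdY hA hC hA' hC')]
  · exact hab (h.eq_of_heavy hdY hA hB hA' hB')

end HubConfig

end Parts

section Counting

variable {V : Type*} {Q D : Digraph V} {Y R S S' T : Set V} {Heavy : Set V → Prop} {o p q u w x : V}

theorem two_mul_card_le_sum_add_one {ι : Type*} {s : Finset ι} {f : ι → ℕ}
    (hpos : ∀ i ∈ s, 1 ≤ f i) (huniq : ∀ i ∈ s, ∀ j ∈ s, f i < 2 → f j < 2 → i = j) :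
    2 * s.card ≤ ∑ i ∈ s, f i + 1 := by
  classical
  by_cases h : ∃ i ∈ s, f i < 2
  · obtain ⟨i, hi, hi2⟩ := h
    have hrest : (s.erase i).card • 2 ≤ ∑ j ∈ s.erase i, f j := by
      refine Finset.card_nsmul_le_sum _ _ _ fun j hj => ?_
      by_contra! hj2
      exact Finset.ne_of_mem_erase hj (huniq j (Finset.mem_of_mem_erase hj) i hi hj2 hi2)
    have hcard := Finset.card_erase_add_one hi
    have hsum := Finset.add_sum_erase s f hi
    have hi1 := hpos i hi
    rw [smul_eq_mul] at hrest
    omega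
  · push Not at h
    have hsum : s.card • 2 ≤ ∑ i ∈ s, f i := Finset.card_nsmul_le_sum _ _ _ h
    rw [smul_eq_mul] at hsum
    omega

theorem ncard_le_ncard_of_bipartite {ι κ : Type*} [Finite ι] [Finite κ] {r : ι → κ → Prop}
    {s : Set ι} {t : Set κ} (hpos : ∀ i ∈ s, ∃ j ∈ t, r i j)
    (huniq : ∀ i ∈ s, ∀ j ∈ s, {k ∈ t | r i k}.Subsingleton → {k ∈ t | r j k}.Subsingleton → i = j)
    (hle : ∀ j ∈ t, {i ∈ s | r i j}.ncard ≤ 2) : s.ncard ≤ t.ncard := by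
  classical
  lift s to Finset ι using s.toFinite
  lift t to Finset κ using t.toFinite
  simp only [Finset.mem_coe] at *
  have hsub : ∀ i, (t.bipartiteAbove r i).card < 2 → {k | k ∈ t ∧ r i k}.Subsingleton :=
    fun i hi k hk l hl => Finset.card_le_one.mp (Nat.lt_succ_iff.mp hi) k
      (Finset.mem_filter.mpr hk) l (Finset.mem_filter.mpr hl)
  have habove := two_mul_card_le_sum_add_one (s := s) (f := fun i => (t.bipartiteAbove r i).card)
    (fun i hi => have ⟨j, hj, hij⟩ := hpos i hi
      Finset.card_pos.mpr ⟨j, Finset.mem_filter.mpr ⟨hj, hij⟩⟩)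
    fun i hi j hj hi2 hj2 => huniq i hi j hj (hsub i hi2) (hsub j hj2)
  have hbelow := Finset.sum_le_card_nsmul t (fun j => (s.bipartiteBelow r j).card) 2 fun j hj => by
    simpa only [← Set.ncard_coe_finset, Finset.bipartiteBelow, Finset.coe_filter] using hle j hj
  rw [Finset.sum_card_bipartiteAbove_eq_sum_card_bipartiteBelow] at habove
  rw [Set.ncard_coe_finset, Set.ncard_coe_finset]
  rw [smul_eq_mul] at hbelow
  omega

/-- The blocks of a hub configuration: its parts and the hub. -/
def IsBlock (Q : Digraph V) (Y : Set V) (o : V) (S : Set V) : Prop := S = {o} ∨ IsPart Q Y S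

/-- The quotient digraph on sets: some arc goes from `S` to a different set `T`. -/
def ArcBetween (Q : Digraph V) (S T : Set V) : Prop := S ≠ T ∧ ∃ u ∈ S, ∃ w ∈ T, Q.Adj u w

namespace HubConfig

theorem eq_of_mem_block (h : HubConfig Q Y o Heavy) (hS : IsBlock Q Y o S)
    (hS' : IsBlock Q Y o S') (hu : u ∈ S) (hu' : u ∈ S') : S = S' := by
  rcases hS with rfl | hS <;> rcases hS' with rfl | hS'
  · rfl
  · exact absurd (Set.mem_singleton_iff.mp hu ▸ hu') (h.hub_notMem_part hS')
  · exact absurd (Set.mem_singleton_iff.mp hu' ▸ hu) (h.hub_notMem_part hS)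
  · exact hS.eq hS' hu hu'

theorem ncard_arcBetween_le [Finite V] (h : HubConfig Q Y o Heavy) (hT : IsPart Q Y T) :
    {S | IsBlock Q Y o S ∧ ArcBetween Q S T}.ncard ≤ 2 := by
  obtain ⟨e, he, hentry⟩ := h.exists_entry hT
  have hadj : ∀ S, IsBlock Q Y o S ∧ ArcBetween Q S T → ∃ u ∈ S, u ∉ T ∧ Q.Adj u e := by
    rintro S ⟨hS, hne, u, hu, w, hw, huw⟩
    have huT : u ∉ T := fun huT => hne (h.eq_of_mem_block hS (Or.inr hT) hu huT)
    exact ⟨u, hu, huT, hentry u huT w hw huw ▸ huw⟩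
  have : Nonempty V := ⟨e⟩
  choose! f hf hf' using hadj
  exact (Set.ncard_le_ncard_of_injOn f hf' (fun S hS S' hS' hff =>
    h.eq_of_mem_block hS.1 hS'.1 (hf S hS) (hff ▸ hf S' hS'))).trans (h.ncard_entering_le hT he)

theorem exists_arcBetween [Finite V] (h : HubConfig Q Y o Heavy) (hu : u ∈ S) (huw : Q.Adj u w)
    (hw : w ∈ Y) (hwS : w ∉ S) : ∃ T, w ∈ T ∧ IsPart Q Y T ∧ ArcBetween Q S T := by
  obtain ⟨T, hT, hwT⟩ := h.exists_part hw
  exact ⟨T, hwT, hT, fun hST => hwS (hST ▸ hwT), u, hu, w, hwT, huw⟩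

theorem not_subsingleton_arcBetween_hub [Finite V] (h : HubConfig Q Y o Heavy) :
    ¬ {T | IsPart Q Y T ∧ ArcBetween Q {o} T}.Subsingleton := by
  intro hsub
  have hout : ∀ w, Q.Adj o w → ∃ T, w ∈ T ∧ IsPart Q Y T ∧ ArcBetween Q {o} T := fun w how =>
    h.exists_arcBetween rfl how (h.adj_hub w how) fun hwo => h.notMem (hwo ▸ h.adj_hub w how)
  obtain ⟨v, hov, -⟩ := h.exists_adj_ne o
  obtain ⟨T, -, hT⟩ := hout v hov
  obtain ⟨e, -, hentry⟩ := h.exists_entry hT.1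
  obtain ⟨w, how, hwe⟩ := h.exists_adj_ne e
  obtain ⟨T', hwT', hT'⟩ := hout w how
  exact hwe (hentry o (h.hub_notMem_part hT.1) w (hsub hT' hT ▸ hwT') how)

theorem exists_arcBetween_of_part [Finite V] (h : HubConfig Q Y o Heavy) (hS : IsPart Q Y S) :
    ∃ T, IsPart Q Y T ∧ ArcBetween Q S T := by
  by_contra! hcon
  obtain rfl := h.eq_of_not_out S hS.1.1 hS.1.2.1 fun u hu w hw huw => by
    by_contra hwS
    obtain ⟨T, -, hT, hST⟩ := h.exists_arcBetween hu huw hw hwS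
    exact hcon T hT hST
  obtain ⟨e, -, hentry⟩ := h.exists_entry hS
  obtain ⟨w, how, hwe⟩ := h.exists_adj_ne e
  exact hwe (hentry o h.notMem w (h.adj_hub w how) how)

theorem heavy_of_subsingleton_arcBetween [Finite V] (h : HubConfig Q Y o Heavy)
    (hS : IsPart Q Y S) (hsub : {T | IsPart Q Y T ∧ ArcBetween Q S T}.Subsingleton) :
    Heavy S := by
  obtain ⟨T, hT, hST⟩ := h.exists_arcBetween_of_part hS
  obtain ⟨e, he, hentry⟩ := h.exists_entry hT
  refine h.heavy_of_part hS (hT.1.1 he) (fun heS => hST.1 (hS.eq hT heS he))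
    fun u hu w hw huw => or_iff_not_imp_left.mpr fun hwS => ?_
  obtain ⟨T', hwT', hT', hST'⟩ := h.exists_arcBetween hu huw hw hwS
  obtain rfl : T' = T := hsub ⟨hT', hST'⟩ ⟨hT, hST⟩
  exact hentry u (fun huT => hST.1 (hS.eq hT hu huT)) w hwT' huw

/-- Counting the arcs of the quotient digraph: at most two enter each part, whereas two leave the
hub and each part, with one exception. -/
theorem false [Finite V] (h : HubConfig Q Y o Heavy) : False := by
  have hle : {S | IsBlock Q Y o S}.ncard ≤ {T | IsPart Q Y T}.ncard := by
    refine ncard_le_ncard_of_bipartite (r := ArcBetween Q) ?_ ?_ fun T hT =>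
      h.ncard_arcBetween_le hT
    · rintro S (rfl | hS)
      · by_contra! hcon
        exact h.not_subsingleton_arcBetween_hub fun T hT => absurd hT.2 (hcon T hT.1)
      · exact h.exists_arcBetween_of_part hS
    · have hheavy : ∀ S, IsBlock Q Y o S →
          {T | IsPart Q Y T ∧ ArcBetween Q S T}.Subsingleton → Heavy S := by
        rintro S (rfl | hS) hsub
        exacts [absurd hsub h.not_subsingleton_arcBetween_hub,
          h.heavy_of_subsingleton_arcBetween hS hsub]
      intro S hS S' hS' hsub hsub'
      obtain ⟨u, hu, hu'⟩ := h.heavy_inter S S' (hheavy S hS hsub) (hheavy S' hS' hsub')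
      exact h.eq_of_mem_block hS hS' hu hu'
  have hlt : {T | IsPart Q Y T} ⊂ {S | IsBlock Q Y o S} :=
    ⟨fun T hT => Or.inr hT, fun hsub => h.hub_notMem_part (hsub (Or.inl rfl)) rfl⟩
  exact (Set.ncard_lt_ncard hlt).not_ge hle

end HubConfig

theorem Config.exists_hasTransitive [Finite V] (h : Config D R p q x) :
    ∃ a d, HasTransitive D a d := by
  induction hn : R.ncard using Nat.strong_induction_on generalizing D R p q x with
  | _ n ih =>
  subst hn
  by_contra! hcon
  have hmin : MinConfig D R p q x :=
    { h with
      not_hasTransitive := hcon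
      minimal := fun D' X p q x h' hlt => ih _ hlt h' rfl }
  obtain ⟨α, Y, hY⟩ := hmin.tokenConfig_suppress.exists_coreConfig
  exact hY.hubConfig.false

theorem hasModel_transitive [Finite V] [Nonempty V] {G : Digraph V} (hG : G.Loopless)
    (h3 : ∀ u, ThreeOut G u) : HasModel G transitiveArcs := by
  obtain ⟨p⟩ := ‹Nonempty V›
  obtain ⟨q, hpq, hqp, -⟩ := h3 p p p
  obtain ⟨x, hqx, hxp, hxq⟩ := h3 q p q
  set D : Digraph V := ⟨fun u w => u ∉ ({p, q} : Set V) ∧ G.Adj u w ∨ u = p ∧ w = q ∨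
    u = q ∧ w = x⟩ with hD
  have hDG : D ≤ G := by
    rintro u w (huw | ⟨rfl, rfl⟩ | ⟨rfl, rfl⟩)
    exacts [huw.2, hpq, hqx]
  have hconf : Config D {p, q}ᶜ p q x :=
    { ne := hqp.symm
      p_notMem := by simp
      q_notMem := by simp
      x_mem := by simp [hxp, hxq]
      adj_p := by simp [hD, hqp.symm]
      adj_q := by simp [hD, hqp]
      tail := by grind
      head := by grind
      loopless := fun u _ huu => hG u (hDG huu)
      three := fun u hu y z => (h3 u y z).imp fun w hw => ⟨Or.inl ⟨hu, hw.1⟩, hw.2⟩ }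
  obtain ⟨a, d, had⟩ := hconf.exists_hasTransitive
  exact (had.mono hDG).hasModel

end Counting

end TournamentSubdivision

theorem mainTheorem11 {V : Type*} [Finite V] [Nonempty V] (G : Digraph V)
    (hG : G.Loopless)
    (hout : ∀ v, 3 ≤ G.outDegree v)
    (hin : ∀ v, 3 ≤ G.inDegree v)
    (H : Digraph (Fin 4)) (hH : H.IsOrientation (⊤ : SimpleGraph (Fin 4))) :
    G.ContainsSubdivision H := by
  open TournamentSubdivision in
  obtain ⟨k, τ, hτ⟩ := exists_fourTournaments_of_isOrientation hH
  have h3 : ∀ v, ThreeOut G v := fun v => threeOut_of_outDegree (hout v)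
  have h3' : ∀ v, ThreeOut (reversed G) v := fun v => threeOut_of_outDegree (hin v)
  suffices hmodel : ∀ k, HasModel G (fourTournaments k) from
    (hmodel k).containsSubdivision τ.injective hτ
  intro k
  fin_cases k
  · exact hasModel_transitive hG h3
  · exact (hasModel_strong_source hG h3).1
  · exact (hasModel_strong_source hG h3).2
  · exact (hasModel_strong_source (G := reversed G) hG h3').2.of_reversed
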